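/- Let $S$ be a finite set with three distinct chosen labels, denoted $0,1,\infty$, let $n=|S|-3$, and let $\overline{\mathcal M}_{0,S}$ be the (smooth projective, complex) moduli space of stable $S$-labelled curves of genus $0$. For a partition of $S$ into two parts with at least two elements each (a stable 2-partition) $\sigma=\sigma_1|\sigma_2$, let $D_\sigma\subset\overline{\mathcal M}_{0,S}$ be the boundary divisor of those stable curves that have a node separating the points labelled by $\sigma_1$ from the points labelled by $\sigma_2$; it is a prime divisor. For $s\in S^\circ:=S-\{0,1,\infty\}$ let $t_s$ be the rational function on $\overline{\mathcal M}_{0,S}$ that is the pullback, along the forgetful morphism $\overline{\mathcal M}_{0,S}\to\overline{\mathcal M}_{0,\{0,1,\infty,s\}}\cong\mathbf P^1$, of the affine coordinate that takes the values $0,1,\infty$ at the boundary points $s0|1\infty$, $s1|0\infty$, $s\infty|01$. Given a function $\varepsilon:S^\circ\to\{0,1\}$ and an ordering of $S^\circ$, consider the meromorphic $n$-form $$\Omega(\varepsilon)=\bigwedge_{s\in S^\circ}\frac{dt_s}{t_s-\varepsilon_s}$$ on $\overline{\mathcal M}_{0,S}$. Put $S(0)=\{s\in S^\circ:\varepsilon_s=0\}$,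 $S(1)=\{s\in S^\circ:\varepsilon_s=1\}$, $S(\infty)=S(0)\cup S(1)=S^\circ$, and say that a 2-partition of $S$ has type $\alpha\in\{0,1,\infty\}$ with respect to $\varepsilon$ if one of its parts is of the form $\{\alpha\}\cup T$ with $T$ a non-empty subset of $S(\alpha)$. Then the divisor of singularities (polar divisor, counted with multiplicities) of $\Omega(\varepsilon)$ on $\overline{\mathcal M}_{0,S}$ is $$A(\varepsilon)=\sum_{\sigma}D_\sigma ,$$ the sum, with all coefficients equal to $1$, over all stable 2-partitions $\sigma$ of $S$ that have some type with respect to $\varepsilon$. -/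

import Mathlib

open scoped OnePoint

noncomputable section

namespace ModuliZero

/-! ### The projective line and cross-ratios -/

section CrossRatio

variable {F : Type*} [Field F]

/-- Homogeneous coordinates of a point of the projective line `F ∪ {∞}`. -/
def homog (p : OnePoint F) : F × F := p.elim (1, 0) (fun a => (a, 1))

/-- The determinant `p₀ q₁ - p₁ q₀` of the homogeneous coordinates of two points; it vanishes
exactly when the points coincide. -/
def bracket (p q : OnePoint F) : F :=
  (homog p).1 * (homog q).2 - (homog p).2 * (homog q).1

/-- The cross-ratio of four points with `a, b, c` pairwise distinct: the image of `d` under the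
automorphism of the projective line that takes `a, b, c` to `0, 1, ∞`. -/
def crossRatio (a b c d : OnePoint F) : OnePoint F :=
  open Classical in
  if bracket d c * bracket b a = 0 then ∞
  else ((bracket d a * bracket b c / (bracket d c * bracket b a) : F) : OnePoint F)

theorem exists_homog_smul [DecidableEq F] (g : GL (Fin 2) F) (p : OnePoint F) :
    ∃ l : F, l ≠ 0 ∧
      l * (homog (g • p)).1 = g 0 0 * (homog p).1 + g 0 1 * (homog p).2 ∧
      l * (homog (g • p)).2 = g 1 0 * (homog p).1 + g 1 1 * (homog p).2 := by
  have hdet : g 0 0 * g 1 1 - g 0 1 * g 1 0 ≠ 0 := by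
    have := g.det_ne_zero
    rwa [Matrix.det_fin_two] at this
  cases p with
  | infty =>
    rw [OnePoint.smul_infty_eq_ite]
    by_cases h : g 1 0 = 0
    · refine ⟨g 0 0, fun h0 => hdet (by simp [h0, h]), ?_, ?_⟩ <;> simp [h, homog]
    · refine ⟨g 1 0, h, ?_, ?_⟩ <;> simp [h, homog]
      field_simp
  | coe k =>
    rw [OnePoint.smul_some_eq_ite]
    by_cases h : g 1 0 * k + g 1 1 = 0
    · refine ⟨g 0 0 * k + g 0 1, fun h0 => hdet ?_, ?_, ?_⟩
      · by_cases hk : g 1 0 = 0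
        · have : g 1 1 = 0 := by simpa [hk] using h
          simp [this, hk]
        · linear_combination g 0 0 * h - g 1 0 * h0
      · simp [h, homog]
      · simp [h, homog]
    · refine ⟨g 1 0 * k + g 1 1, h, ?_, ?_⟩ <;> simp [h, homog]
      field_simp

/-- Cross-ratios are invariant under automorphisms of the projective line. -/
theorem crossRatio_smul [DecidableEq F] (g : GL (Fin 2) F) (a b c d : OnePoint F) :
    crossRatio (g • a) (g • b) (g • c) (g • d) = crossRatio a b c d := by
  have hdet : g 0 0 * g 1 1 - g 0 1 * g 1 0 ≠ 0 := by
    have := g.det_ne_zero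
    rwa [Matrix.det_fin_two] at this
  have key : ∀ p : OnePoint F, ∃ l : F, l ≠ 0 ∧
      (homog (g • p)).1 = l * (g 0 0 * (homog p).1 + g 0 1 * (homog p).2) ∧
      (homog (g • p)).2 = l * (g 1 0 * (homog p).1 + g 1 1 * (homog p).2) := by
    intro p
    obtain ⟨l, hl, h1, h2⟩ := exists_homog_smul g p
    refine ⟨l⁻¹, inv_ne_zero hl, ?_, ?_⟩
    · rw [← h1]; field_simp
    · rw [← h2]; field_simp
  obtain ⟨la, hla, ha1, ha2⟩ := key a
  obtain ⟨lb, hlb, hb1, hb2⟩ := key b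
  obtain ⟨lc, hlc, hc1, hc2⟩ := key c
  obtain ⟨ld, hld, hd1, hd2⟩ := key d
  set D := g 0 0 * g 1 1 - g 0 1 * g 1 0 with hD
  have e1 : bracket (g • d) (g • c) = ld * lc * D * bracket d c := by
    simp only [bracket, hd1, hd2, hc1, hc2, hD]; ring
  have e2 : bracket (g • b) (g • a) = lb * la * D * bracket b a := by
    simp only [bracket, hb1, hb2, ha1, ha2, hD]; ring
  have e3 : bracket (g • d) (g • a) = ld * la * D * bracket d a := by
    simp only [bracket, hd1, hd2, ha1, ha2, hD]; ring
  have e4 : bracket (g • b) (g • c) = lb * lc * D * bracket b c := by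
    simp only [bracket, hb1, hb2, hc1, hc2, hD]; ring
  have hL : ld * lc * D * (lb * la * D) ≠ 0 := by positivity
  have f1 : bracket (g • d) (g • c) * bracket (g • b) (g • a)
      = ld * lc * D * (lb * la * D) * (bracket d c * bracket b a) := by rw [e1, e2]; ring
  have f2 : bracket (g • d) (g • a) * bracket (g • b) (g • c)
      = ld * lc * D * (lb * la * D) * (bracket d a * bracket b c) := by rw [e3, e4]; ring
  unfold crossRatio
  rw [f1, f2]
  by_cases h : bracket d c * bracket b a = 0
  · simp [h]
  · rw [if_neg h, if_neg (mul_ne_zero hL h), mul_div_mul_left _ _ hL]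

end CrossRatio

/-! ### Stable pointed curves of genus zero -/

/-- A stable `S`-labelled complex curve of genus `0`: a tree of projective lines glued at nodes.
The vertices of the tree are the irreducible components (each a copy of the projective line
`OnePoint ℂ`) and its edges are the nodes. `node h` is the position on the component `v` of the
node joining `v` to the component `w`, where `h : v ~ w`; `comp s` is the component carrying the
point labelled `s`, and `mark s` is the position of that point on it. All special points of one
component are distinct, and every component has at least three of them. -/
structure StableCurve (S : Type*) where
  size : ℕ
  graph : SimpleGraph (Fin size)
  isTree : graph.IsTree
  node : ∀ {v w : Fin size}, graph.Adj v w → OnePoint ℂ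
  comp : S → Fin size
  mark : S → OnePoint ℂ
  node_inj : ∀ {v w w' : Fin size} (h : graph.Adj v w) (h' : graph.Adj v w'),
    node h = node h' → w = w'
  mark_inj : ∀ {s s' : S}, comp s = comp s' → mark s = mark s' → s = s'
  mark_ne_node : ∀ (s : S) {w : Fin size} (h : graph.Adj (comp s) w), mark s ≠ node h
  stable : ∀ v : Fin size, 3 ≤ {w | graph.Adj v w}.ncard + {s | comp s = v}.ncard

namespace StableCurve

variable {S : Type*} (C C' : StableCurve S)

/-- Isomorphism of stable labelled curves: an isomorphism of the dual trees together with an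
automorphism of the projective line for each component, matching nodes and labelled points. -/
def Iso : Prop :=
  ∃ (f : C.graph ≃g C'.graph) (g : Fin C.size → GL (Fin 2) ℂ),
    (∀ s, C'.comp s = f (C.comp s)) ∧
    (∀ s, C'.mark s = g (C.comp s) • C.mark s) ∧
    (∀ {v w : Fin C.size} (h : C.graph.Adj v w),
      C'.node (f.map_adj_iff.2 h) = g v • C.node h)

/-- The path in the dual tree from `v` to `u`. -/
def path (v u : Fin C.size) : C.graph.Walk v u := (C.isTree.existsUnique_path v u).choose

theorem path_isPath (v u : Fin C.size) : (C.path v u).IsPath :=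
  (C.isTree.existsUnique_path v u).choose_spec.1

theorem eq_path {v u : Fin C.size} (p : C.graph.Walk v u) (hp : p.IsPath) : p = C.path v u :=
  (C.isTree.existsUnique_path v u).unique hp (C.path_isPath v u)

theorem path_not_nil {v u : Fin C.size} (h : v ≠ u) : ¬ (C.path v u).Nil :=
  fun hn => h hn.eq

/-- The special point of the component `v` in the direction of the label `s`: the labelled point
itself if it lies on `v`, and otherwise the node of `v` through which the chain of components
from `v` to the component of `s` leaves `v`. -/
def pos (v : Fin C.size) (s : S) : OnePoint ℂ :=
  if h : v = C.comp s then C.mark s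
  else C.node (SimpleGraph.Walk.adj_snd (C.path_not_nil h))

/-- The labels `i, j, k` are seen from the component `v` in three different directions. -/
def Separates (v : Fin C.size) (i j k : S) : Prop :=
  C.pos v i ≠ C.pos v j ∧ C.pos v j ≠ C.pos v k ∧ C.pos v i ≠ C.pos v k

/-- Two labels seen in the same direction from `v` lie behind a common node of `v`. -/
theorem exists_of_pos_eq {v : Fin C.size} {i j : S} (hij : i ≠ j) (h : C.pos v i = C.pos v j) :
    v ≠ C.comp i ∧ v ≠ C.comp j ∧ (C.path v (C.comp i)).snd = (C.path v (C.comp j)).snd := by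
  unfold pos at h
  by_cases hi : v = C.comp i
  · subst hi
    by_cases hj : C.comp i = C.comp j
    · simp only [dif_pos, dif_pos hj] at h
      exact absurd (C.mark_inj hj h) hij
    · simp only [dif_pos, dif_neg hj] at h
      exact absurd h (C.mark_ne_node i _)
  · by_cases hj : v = C.comp j
    · subst hj
      simp only [dif_pos, dif_neg hi] at h
      exact absurd h.symm (C.mark_ne_node j _)
    · simp only [dif_neg hi, dif_neg hj] at h
      exact ⟨hi, hj, C.node_inj _ _ h⟩

theorem dist_snd_add_one {v u : Fin C.size} (h : v ≠ u) :
    C.graph.dist (C.path v u).snd u + 1 = C.graph.dist v u := by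
  obtain ⟨p, hp⟩ := C.isTree.connected.exists_walk_length_eq_dist v u
  have hpp : p = C.path v u := C.eq_path p (p.isPath_of_length_eq_dist hp)
  have hn := C.path_not_nil h
  rw [← hpp] at hn ⊢
  have h1 := SimpleGraph.Walk.length_tail_add_one hn
  have h2 : C.graph.dist p.snd u ≤ p.tail.length := SimpleGraph.dist_le _
  have h4 : C.graph.dist v u ≤ C.graph.dist v p.snd + C.graph.dist p.snd u :=
    C.isTree.connected.dist_triangle
  have h5 : C.graph.dist v p.snd = 1 :=
    SimpleGraph.dist_eq_one_iff_adj.2 (SimpleGraph.Walk.adj_snd hn)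
  omega

/-- Any three distinct labels are separated by some component. -/
theorem exists_separates {i j k : S} (hij : i ≠ j) (hjk : j ≠ k) (hik : i ≠ k) :
    ∃ v, C.Separates v i j k := by
  have : Nonempty (Fin C.size) := C.isTree.connected.nonempty
  let φ : Fin C.size → ℕ := fun v =>
    C.graph.dist v (C.comp i) + C.graph.dist v (C.comp j) + C.graph.dist v (C.comp k)
  obtain ⟨v, hv⟩ := Finite.exists_min φ
  have step : ∀ a b c : S, a ≠ b → (∀ w, φ w = C.graph.dist w (C.comp a) +
      C.graph.dist w (C.comp b) + C.graph.dist w (C.comp c)) → C.pos v a ≠ C.pos v b := by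
    intro a b c hab hφ heq
    obtain ⟨ha, hb, hs⟩ := C.exists_of_pos_eq hab heq
    have h1 := C.dist_snd_add_one ha
    have h2 := C.dist_snd_add_one hb
    rw [← hs] at h2
    have h3 := hv (C.path v (C.comp a)).snd
    rw [hφ, hφ] at h3
    have h4 : C.graph.dist (C.path v (C.comp a)).snd (C.comp c) ≤
        C.graph.dist (C.path v (C.comp a)).snd v + C.graph.dist v (C.comp c) :=
      C.isTree.connected.dist_triangle
    have h5 : C.graph.dist (C.path v (C.comp a)).snd v = 1 :=
      SimpleGraph.dist_eq_one_iff_adj.2 (SimpleGraph.Walk.adj_snd (C.path_not_nil ha)).symm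
    omega
  exact ⟨v, step i j k hij fun w => rfl, step j k i hjk fun w => by simp only [φ]; omega,
    step i k j hik fun w => by simp only [φ]; omega⟩

theorem path_snd_eq {v w u : Fin C.size} (hvw : v ≠ w) (hvu : v ≠ u)
    (h : (C.path v u).snd ≠ (C.path v w).snd) : w ≠ u ∧ (C.path w u).snd = (C.path w v).snd := by
  have hp := C.path_not_nil hvw
  have hq := C.path_not_nil hvu
  have hpr : ¬ (C.path v w).reverse.Nil := by simpa using hp
  have hpath : ((C.path v w).reverse.append (C.path v u)).IsPath := by
    rw [C.isTree.isAcyclic.isPath_iff_isChain, SimpleGraph.Walk.edges_append,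
      List.isChain_append]
    refine ⟨(C.isTree.isAcyclic.isPath_iff_isChain _).1 (C.path_isPath v w).reverse,
      (C.isTree.isAcyclic.isPath_iff_isChain _).1 (C.path_isPath v u), ?_⟩
    intro x hx y hy hxy
    rw [← SimpleGraph.Walk.cons_tail_eq _ hq] at hy
    rw [SimpleGraph.Walk.edges_reverse, List.getLast?_reverse,
      ← SimpleGraph.Walk.cons_tail_eq _ hp] at hx
    simp only [SimpleGraph.Walk.edges_cons, List.head?_cons, Option.mem_def,
      Option.some.injEq] at hx hy
    rw [← hx, ← hy, Sym2.congr_right] at hxy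
    exact h hxy.symm
  have e1 := C.eq_path _ hpath
  have e2 := C.eq_path _ (C.path_isPath v w).reverse
  constructor
  · rintro rfl
    have h0 := SimpleGraph.Walk.length_eq_zero_iff.2
      (SimpleGraph.Walk.isPath_iff_nil.1 hpath)
    simp only [SimpleGraph.Walk.length_append, SimpleGraph.Walk.length_reverse] at h0
    exact hp (SimpleGraph.Walk.length_eq_zero_iff.1 (by omega))
  · rw [← e1, ← e2]
    generalize (C.path v w).reverse = r at hpr
    cases r with
    | nil => simp at hpr
    | cons _ _ => simp

theorem separates_unique {v w : Fin C.size} {i j k : S} (hv : C.Separates v i j k)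
    (hw : C.Separates w i j k) : v = w := by
  by_contra hvw
  -- a label that is not seen from `v` in the direction of `w` is seen from `w` in that of `v`
  have key : ∀ s, (∀ h : v ≠ C.comp s, (C.path v (C.comp s)).snd ≠ (C.path v w).snd) →
      C.pos w s = C.node (SimpleGraph.Walk.adj_snd (C.path_not_nil (Ne.symm hvw))) := by
    intro s hs
    by_cases h : v = C.comp s
    · subst h
      unfold pos
      rw [dif_neg (Ne.symm hvw)]
    · obtain ⟨h1, h2⟩ := C.path_snd_eq hvw h (hs h)
      unfold pos
      rw [dif_neg h1]
      congr 1
  have key2 : ∀ s, ¬ (∀ h : v ≠ C.comp s, (C.path v (C.comp s)).snd ≠ (C.path v w).snd) →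
      C.pos v s = C.node (SimpleGraph.Walk.adj_snd (C.path_not_nil hvw)) := by
    intro s hs
    push Not at hs
    obtain ⟨h, hs⟩ := hs
    unfold pos
    rw [dif_neg h]
    congr 1
  obtain ⟨a1, a2, a3⟩ := hv
  obtain ⟨b1, b2, b3⟩ := hw
  have ki := key i
  have kj := key j
  have kk := key k
  have li := key2 i
  have lj := key2 j
  have lk := key2 k
  by_cases pi : ∀ h : v ≠ C.comp i, (C.path v (C.comp i)).snd ≠ (C.path v w).snd <;>
  by_cases pj : ∀ h : v ≠ C.comp j, (C.path v (C.comp j)).snd ≠ (C.path v w).snd <;>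
  by_cases pk : ∀ h : v ≠ C.comp k, (C.path v (C.comp k)).snd ≠ (C.path v w).snd <;>
  simp_all

theorem Iso.exists_pos {C C' : StableCurve S} (h : C.Iso C') (v : Fin C.size) :
    ∃ (v' : Fin C'.size) (g : GL (Fin 2) ℂ), ∀ s, C'.pos v' s = g • C.pos v s := by
  obtain ⟨f, g, hc, hm, hn⟩ := h
  refine ⟨f v, g v, fun s => ?_⟩
  by_cases hv : v = C.comp s
  · subst hv
    unfold pos
    rw [dif_pos (hc s).symm, dif_pos rfl, hm]
  · have hv' : f v ≠ C'.comp s := by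
      rw [hc]; exact fun e => hv (f.injective e)
    unfold pos
    rw [dif_neg hv, dif_neg hv', ← hn]
    have : (C'.path (f v) (C'.comp s)).snd = f (C.path v (C.comp s)).snd := by
      rw [hc]
      have e := C'.eq_path (v := f v) (u := f (C.comp s)) ((C.path v (C.comp s)).map f.toHom)
        ((C.path_isPath v (C.comp s)).map f.injective)
      rw [← e]
      exact SimpleGraph.Walk.getVert_map ..
    congr 1

/-- The cross-ratio of the four labels `q 0, q 1, q 2, q 3` on the stable curve `C`: the point of
the moduli space of four-labelled stable curves (a projective line) obtained by forgetting all
other labels and contracting unstable components. Concretely, it is computed on the component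
that separates the first three labels. -/
def cross (q : Fin 4 ↪ S) : OnePoint ℂ :=
  let v := (C.exists_separates (i := q 0) (j := q 1) (k := q 2)
    (by simp) (by simp) (by simp)).choose
  crossRatio (C.pos v (q 0)) (C.pos v (q 1)) (C.pos v (q 2)) (C.pos v (q 3))

theorem cross_eq {q : Fin 4 ↪ S} {v : Fin C.size} (hv : C.Separates v (q 0) (q 1) (q 2)) :
    C.cross q = crossRatio (C.pos v (q 0)) (C.pos v (q 1)) (C.pos v (q 2)) (C.pos v (q 3)) := by
  have h := (C.exists_separates (i := q 0) (j := q 1) (k := q 2)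
    (by simp) (by simp) (by simp)).choose_spec
  rw [C.separates_unique hv h]
  rfl

theorem Iso.cross_eq {C C' : StableCurve S} (h : C.Iso C') (q : Fin 4 ↪ S) :
    C.cross q = C'.cross q := by
  obtain ⟨v, hv⟩ := C.exists_separates (i := q 0) (j := q 1) (k := q 2)
    (by simp) (by simp) (by simp)
  obtain ⟨v', g, hg⟩ := h.exists_pos v
  have hv' : C'.Separates v' (q 0) (q 1) (q 2) := by
    simpa [Separates, hg] using hv
  rw [C.cross_eq hv, C'.cross_eq hv', hg, hg, hg, hg, crossRatio_smul]

/-- The curve `C` has a node at which it falls apart into two pieces, one of which carries exactly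
the labels in `P`, and the other one those in the complement of `P`. -/
def HasNode (P : Set S) : Prop :=
  ∃ (v w : Fin C.size) (h : C.graph.Adj v w), P = {s | C.pos v s = C.node h}

end StableCurve

/-! ### The moduli space as a variety

A complex point of the moduli space is an isomorphism class of stable labelled curves. The
structure of a projective variety is the one for which the map to the product of projective lines
given by all cross-ratios (all forgetful maps to moduli spaces of four-labelled curves) is a closed
embedding. -/

/-- The moduli space of stable `S`-labelled complex curves of genus `0` (its complex points). -/
def Mbar (S : Type*) : Type _ := Quot (StableCurve.Iso (S := S))

/-- The affine coordinate of a point of the projective line, with the value `0` at `∞`. -/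
def finPart {F : Type*} [Field F] (p : OnePoint F) : F := p.elim 0 id

section Variety

variable {S : Type*}

/-- The cross-ratio coordinates on the moduli space. -/
def coord (q : Fin 4 ↪ S) (x : Mbar S) : OnePoint ℂ :=
  Quot.lift (fun C => C.cross q) (fun _ _ h => h.cross_eq q) x

/-- The value at `x` of a polynomial in the cross-ratios; only used if `x` lies in the affine
chart where the cross-ratios that occur in the polynomial are finite. -/
def value (P : MvPolynomial (Fin 4 ↪ S) ℂ) (x : Mbar S) : ℂ :=
  MvPolynomial.eval (fun q => finPart (coord q x)) P

/-- All cross-ratios that occur in the polynomial `P` are finite at `x`. -/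
def DefinedAt (P : MvPolynomial (Fin 4 ↪ S) ℂ) (x : Mbar S) : Prop :=
  ∀ q ∈ P.vars, coord q x ≠ ∞

/-- The principal open subset `P ≠ 0` of the affine chart where the cross-ratios in the finite
set `I` are finite. -/
def basicOpen (I : Finset (Fin 4 ↪ S)) (P : MvPolynomial (Fin 4 ↪ S) ℂ) : Set (Mbar S) :=
  {x | (∀ q ∈ I, coord q x ≠ ∞) ∧ value P x ≠ 0}

/-- The Zariski topology. -/
instance : TopologicalSpace (Mbar S) :=
  TopologicalSpace.generateFrom {U | ∃ I P, P.vars ⊆ I ∧ U = basicOpen I P}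

/-- A prime divisor: an irreducible Zariski closed subset of codimension one. -/
def PrimeDivisor (S : Type*) : Type _ :=
  {Z : TopologicalSpace.IrreducibleCloseds (Mbar S) // Order.coheight Z = 1}

/-- The subset `D` of the moduli space is a prime divisor. -/
def IsPrimeDivisor (D : Set (Mbar S)) : Prop := ∃ Z : PrimeDivisor S, (Z.1 : Set (Mbar S)) = D

/-! ### Rational functions

The labels called `0, 1, ∞` are `b 0, b 1, b 2` for an embedding `b : Fin 3 ↪ S`. -/

/-- The labels other than `0, 1, ∞`. -/
def Free (b : Fin 3 ↪ S) : Type _ := {s : S // s ∉ Set.range b}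

variable (b : Fin 3 ↪ S)

/-- The field of rational functions on the moduli space. The open stratum is the set of
configurations of distinct points `t s ∈ ℂ - {0, 1}`, where `s` runs over the labels other
than `0, 1, ∞`. -/
abbrev FunctionField : Type _ := FractionRing (MvPolynomial (Free b) ℂ)

/-- The generic configuration: the labels `0, 1, ∞` are put at `0, 1, ∞`, and any other label `s`
at the indeterminate with index `s`. -/
def generic (s : S) : OnePoint (FunctionField b) :=
  open Classical in
  if h : s ∈ Set.range b then (if s = b 0 then ((0 : FunctionField b) : OnePoint _)
    else if s = b 1 then ((1 : FunctionField b) : OnePoint _) else ∞)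
  else ((algebraMap (MvPolynomial (Free b) ℂ) (FunctionField b)
    (MvPolynomial.X ⟨s, h⟩) : FunctionField b) : OnePoint _)

/-- A cross-ratio as a rational function on the moduli space. -/
def crossFun (q : Fin 4 ↪ S) : FunctionField b :=
  finPart (crossRatio (generic b (q 0)) (generic b (q 1)) (generic b (q 2)) (generic b (q 3)))

/-- The rational function `f` is regular at the point `x`: it is a quotient of polynomials in
the cross-ratios that are finite at `x`, the denominator being nonzero at `x`. -/
def RegularAt (f : FunctionField b) (x : Mbar S) : Prop :=
  ∃ P Q : MvPolynomial (Fin 4 ↪ S) ℂ, DefinedAt P x ∧ DefinedAt Q x ∧ value Q x ≠ 0 ∧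
    MvPolynomial.aeval (crossFun b) Q ≠ 0 ∧
    f = MvPolynomial.aeval (crossFun b) P / MvPolynomial.aeval (crossFun b) Q

variable {b}

theorem DefinedAt.add {P Q : MvPolynomial (Fin 4 ↪ S) ℂ} {x : Mbar S} (hP : DefinedAt P x)
    (hQ : DefinedAt Q x) : DefinedAt (P + Q) x := by
  classical
  intro q hq
  rcases Finset.mem_union.1 (MvPolynomial.vars_add_subset P Q hq) with h | h
  exacts [hP q h, hQ q h]

theorem DefinedAt.mul {P Q : MvPolynomial (Fin 4 ↪ S) ℂ} {x : Mbar S} (hP : DefinedAt P x)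
    (hQ : DefinedAt Q x) : DefinedAt (P * Q) x := by
  classical
  intro q hq
  rcases Finset.mem_union.1 (MvPolynomial.vars_mul P Q hq) with h | h
  exacts [hP q h, hQ q h]

theorem DefinedAt.C (c : ℂ) (x : Mbar S) : DefinedAt (MvPolynomial.C c) x := by
  intro q hq
  simp at hq

theorem RegularAt.algebraMap (c : ℂ) (x : Mbar S) :
    RegularAt b (algebraMap ℂ (FunctionField b) c) x :=
  ⟨MvPolynomial.C c, MvPolynomial.C 1, .C c x, .C 1 x, by simp [value], by simp, by simp⟩

theorem RegularAt.add {f g : FunctionField b} {x : Mbar S} (hf : RegularAt b f x)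
    (hg : RegularAt b g x) : RegularAt b (f + g) x := by
  obtain ⟨P, Q, hP, hQ, h0, h1, rfl⟩ := hf
  obtain ⟨P', Q', hP', hQ', h0', h1', rfl⟩ := hg
  refine ⟨P * Q' + Q * P', Q * Q', (hP.mul hQ').add (hQ.mul hP'), hQ.mul hQ', ?_, ?_, ?_⟩
  · simpa [value] using ⟨h0, h0'⟩
  · simpa using ⟨h1, h1'⟩
  · simp only [map_add, map_mul]
    rw [div_add_div _ _ h1 h1']

theorem RegularAt.mul {f g : FunctionField b} {x : Mbar S} (hf : RegularAt b f x)
    (hg : RegularAt b g x) : RegularAt b (f * g) x := by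
  obtain ⟨P, Q, hP, hQ, h0, h1, rfl⟩ := hf
  obtain ⟨P', Q', hP', hQ', h0', h1', rfl⟩ := hg
  refine ⟨P * P', Q * Q', hP.mul hP', hQ.mul hQ', ?_, ?_, ?_⟩
  · simpa [value] using ⟨h0, h0'⟩
  · simpa using ⟨h1, h1'⟩
  · simp only [map_mul]
    rw [div_mul_div_comm]

/-- A function that is regular at `x` is invertible at `x`, or the difference to `1` is. -/
theorem RegularAt.inv_or {f : FunctionField b} {x : Mbar S} (hf : RegularAt b f x) :
    (f ≠ 0 ∧ RegularAt b f⁻¹ x) ∨ (1 - f ≠ 0 ∧ RegularAt b (1 - f)⁻¹ x) := by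
  obtain ⟨P, Q, hP, hQ, h0, h1, rfl⟩ := hf
  by_cases hPx : value P x ≠ 0 ∧ MvPolynomial.aeval (crossFun b) P ≠ 0
  · exact Or.inl ⟨div_ne_zero hPx.2 h1, Q, P, hQ, hP, hPx.1, hPx.2, by rw [inv_div]⟩
  by_cases hR : MvPolynomial.aeval (crossFun b) P = 0
  · right
    rw [hR]
    simpa using RegularAt.algebraMap (b := b) 1 x
  have hPx0 : value P x = 0 := by
    by_contra h
    exact hPx ⟨h, hR⟩
  by_cases hQP : MvPolynomial.aeval (crossFun b) (Q + MvPolynomial.C (-1) * P) = 0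
  · left
    have : MvPolynomial.aeval (crossFun b) P = MvPolynomial.aeval (crossFun b) Q := by
      simp only [map_add, map_mul, map_neg, map_one] at hQP
      linear_combination -hQP
    rw [this, div_self h1]
    simpa using RegularAt.algebraMap (b := b) 1 x
  right
  have e : 1 - MvPolynomial.aeval (crossFun b) P / MvPolynomial.aeval (crossFun b) Q
      = MvPolynomial.aeval (crossFun b) (Q + MvPolynomial.C (-1) * P) /
        MvPolynomial.aeval (crossFun b) Q := by
    simp only [map_add, map_mul, map_neg, map_one]
    field_simp
    ring
  rw [e]
  refine ⟨div_ne_zero hQP h1, Q, _, hQ, hQ.add ((DefinedAt.C _ x).mul hP), ?_, hQP, by rw [inv_div]⟩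
  have : value (Q + MvPolynomial.C (-1) * P) x = value Q x := by
    unfold value at hPx0 ⊢
    simp [hPx0]
  rwa [this]

theorem isOpen_regularAt (f : FunctionField b) : IsOpen {x : Mbar S | RegularAt b f x} := by
  classical
  rw [isOpen_iff_forall_mem_open]
  rintro x ⟨P, Q, hP, hQ, h0, h1, rfl⟩
  refine ⟨basicOpen (P.vars ∪ Q.vars) Q, ?_,
    TopologicalSpace.isOpen_generateFrom_of_mem ⟨_, Q, Finset.subset_union_right, rfl⟩, ?_⟩
  · rintro y ⟨hy, hy0⟩
    exact ⟨P, Q, fun q hq => hy q (Finset.mem_union_left _ hq),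
      fun q hq => hy q (Finset.mem_union_right _ hq), hy0, h1, rfl⟩
  · refine ⟨fun q hq => ?_, h0⟩
    rcases Finset.mem_union.1 hq with h | h
    exacts [hP q h, hQ q h]

theorem exists_regularAt_of_regularAt (Z : TopologicalSpace.IrreducibleCloseds (Mbar S))
    {f g : FunctionField b} (hf : ∃ x ∈ Z, RegularAt b f x) (hg : ∃ x ∈ Z, RegularAt b g x) :
    ∃ x ∈ Z, RegularAt b f x ∧ RegularAt b g x := by
  obtain ⟨x, hxZ, hx⟩ := hf
  obtain ⟨y, hyZ, hy⟩ := hg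
  obtain ⟨z, hzZ, hz1, hz2⟩ := Z.isIrreducible.2 _ _ (isOpen_regularAt f) (isOpen_regularAt g)
    ⟨x, hxZ, hx⟩ ⟨y, hyZ, hy⟩
  exact ⟨z, hzZ, hz1, hz2⟩

variable (b)

/-- The local ring of the moduli space along the irreducible closed subset `Z`: the rational
functions that are regular at some (equivalently, at the general) point of `Z`. -/
def localRing (Z : TopologicalSpace.IrreducibleCloseds (Mbar S)) :
    Subalgebra ℂ (FunctionField b) where
  carrier := {f | ∃ x ∈ Z, RegularAt b f x}
  mul_mem' hf hg := by
    obtain ⟨x, hx, h1, h2⟩ := exists_regularAt_of_regularAt Z hf hg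
    exact ⟨x, hx, h1.mul h2⟩
  add_mem' hf hg := by
    obtain ⟨x, hx, h1, h2⟩ := exists_regularAt_of_regularAt Z hf hg
    exact ⟨x, hx, h1.add h2⟩
  algebraMap_mem' c := by
    obtain ⟨x, hx⟩ := Z.isIrreducible.1
    exact ⟨x, hx, RegularAt.algebraMap c x⟩

instance (Z : TopologicalSpace.IrreducibleCloseds (Mbar S)) : IsLocalRing (localRing b Z) := by
  refine IsLocalRing.of_isUnit_or_isUnit_one_sub_self ?_
  rintro ⟨f, x, hx, hf⟩
  rcases hf.inv_or with ⟨h0, h⟩ | ⟨h0, h⟩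
  · left
    refine IsUnit.of_mul_eq_one (⟨f⁻¹, x, hx, h⟩ : localRing b Z) (Subtype.ext ?_)
    exact mul_inv_cancel₀ h0
  · right
    refine IsUnit.of_mul_eq_one (⟨(1 - f)⁻¹, x, hx, h⟩ : localRing b Z) (Subtype.ext ?_)
    exact mul_inv_cancel₀ h0

/-! ### Rational differential forms and their polar divisors -/

/-- Rational differential forms of degree `n` on the moduli space. -/
abbrev RatForm (n : ℕ) : Type _ := ⋀[FunctionField b]^n (Ω[FunctionField b⁄ℂ])

/-- The forms of degree `n` that are regular along `Z`: the image of the `n`-th exterior power of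
the module of Kähler differentials of the local ring along `Z`. -/
def regularForms (n : ℕ) (Z : TopologicalSpace.IrreducibleCloseds (Mbar S)) :
    Submodule (localRing b Z) (RatForm b n) :=
  Submodule.span (localRing b Z) {ω | ∃ f : Fin n → localRing b Z,
    ω = exteriorPower.ιMulti (FunctionField b) n
      (fun i => KaehlerDifferential.D ℂ (FunctionField b) (f i : FunctionField b))}

/-- `A` is the polar divisor (divisor of singularities) of the rational form `ω`: the multiplicity
in `A` of each prime divisor `Z` is the order of the pole of `ω` along `Z` (zero if `ω` is regular
along `Z`), that is, the least `m` such that multiplication with the `m`-th power of the maximal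
ideal of the local ring along `Z` makes `ω` regular. -/
def IsPolarDivisor {n : ℕ} (ω : RatForm b n) (A : PrimeDivisor S → ℕ) : Prop :=
  ∀ Z : PrimeDivisor S,
    IsLeast {m : ℕ | ∀ f ∈ IsLocalRing.maximalIdeal (localRing b Z.1) ^ m,
      f • ω ∈ regularForms b n Z.1} (A Z)

/-- The coordinate `t s`: the cross-ratio of the labels `0, 1, ∞, s`, that is, the pullback of
the affine coordinate along the map to the moduli space of curves with labels `0, 1, ∞, s`. -/
def tCoord (s : Free b) : FunctionField b :=
  crossFun b ⟨Fin.snoc (α := fun _ => S) b s.1,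
    Fin.snoc_injective_iff.2 ⟨b.injective, s.2⟩⟩

/-- The form `⋀ d t_s / (t_s - ε_s)`, the product being taken in the order given by `e`. -/
def Omega (ε : Free b → Fin 2) {n : ℕ} (e : Fin n ≃ Free b) : RatForm b n :=
  exteriorPower.ιMulti (FunctionField b) n (fun i =>
    (tCoord b (e i) - ((ε (e i) : ℕ) : FunctionField b))⁻¹ •
      KaehlerDifferential.D ℂ (FunctionField b) (tCoord b (e i)))

/-- The subsets `S(0), S(1), S(∞)` of the set of labels other than `0, 1, ∞`. -/
def typeSet {b : Fin 3 ↪ S} (ε : Free b → Fin 2) : Fin 3 → Set (Free b) :=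
  ![{s | ε s = 0}, {s | ε s = 1}, {s | ε s = 0} ∪ {s | ε s = 1}]

end Variety

/-! ### Boundary divisors -/

/-- Stable (unordered) 2-partitions of `S`: two parts with at least two elements each. -/
def StablePartition (S : Type*) [Fintype S] [DecidableEq S] : Type _ :=
  {σ : Finpartition (Finset.univ : Finset S) // σ.parts.card = 2 ∧ ∀ P ∈ σ.parts, 2 ≤ P.card}

variable {S : Type*} [Fintype S] [DecidableEq S]

instance : Fintype (StablePartition S) :=
  inferInstanceAs (Fintype {σ : Finpartition (Finset.univ : Finset S) //
    σ.parts.card = 2 ∧ ∀ P ∈ σ.parts, 2 ≤ P.card})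

/-- The boundary divisor of a stable 2-partition: the stable curves with a node that separates
the labels in one part from those in the other. It is the closure of the stratum of curves with
two components that carry the labels in the two parts. -/
def boundaryDivisor (σ : StablePartition S) : Set (Mbar S) :=
  {x | ∃ C : StableCurve S, Quot.mk _ C = x ∧ ∃ P ∈ σ.1.parts, C.HasNode (P : Set S)}

/-- The 2-partition `σ` has type `α` with respect to `ε`, where `α = 0, 1, 2` stands for
the labels `0, 1, ∞`. -/
def HasType {b : Fin 3 ↪ S} (ε : Free b → Fin 2) (σ : StablePartition S) (α : Fin 3) : Prop :=
  ∃ P ∈ σ.1.parts, ∃ T : Set (Free b), T.Nonempty ∧ T ⊆ typeSet ε α ∧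
    (P : Set S) = {b α} ∪ Subtype.val '' T

open Classical in
/-- The divisor `A(ε)`: the sum of the boundary divisors of the stable 2-partitions that have some
type with respect to `ε`. -/
def divisorA {b : Fin 3 ↪ S} (ε : Free b → Fin 2) (Z : PrimeDivisor S) : ℕ :=
  ∑ σ : StablePartition S with ∃ α, HasType ε σ α,
    if boundaryDivisor σ = (Z.1 : Set (Mbar S)) then 1 else 0

end ModuliZero

end

noncomputable section

namespace ModuliZero

open Filter Topology

/-! ### Cross-ratios -/

section CrossRatio

variable {F : Type*} [Field F]

/-! On the open stratum the labelled points are distinct, so all `t s` are regular there and all `t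
s - ε s` invertible. The form therefore has no pole along a prime divisor that meets the open
stratum, and only the boundary divisors matter.

Along `D_σ` let `P` be the part with at most one of the labels 0, 1, ∞. Suppose first that ∞ is not
in `P`. Choose an anchor in `P`, namely the one of 0, 1 that lies in `P` if there is one, and a
further label `free` in `P`. The points of `P` collide on the divisor. So one blows up: with `u =
t_free - t_anchor` and `x_s = (t_s - t_anchor) / u` for the other labels of `P`, the functions `u`,
`x_s` and the remaining `t_s` are local coordinates, and `u = 0` is the divisor. If `m` labels of
`P` differ from the anchor, the product of the `dt_s` is `u ^ (m - 1)` times the coordinate volume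
form. Among the factors `t_s - ε_s`, exactly those vanish on the divisor, and to first order, for
which `s` is one of these `m` labels and the anchor is the label `ε_s`. If ∞ lies in `P`, the same
computation is made with the coordinates `1 / t_s`; there each of the `m` labels contributes a
simple pole whatever `ε_s` is. In all cases the order of the form along `D_σ` is `N - 1`, where `N`
counts those of the `m` labels that are not of the type of the anchor. Hence the pole is at most
simple, and it occurs exactly if `N = 0`, that is, if `σ` has a type (`Frame.exists_Omega_eq`).

The geometry has to be derived from cross-ratios. Lying on `D_σ` means that certain cross-ratios are
infinite (`StableCurve.hasNode_iff`), so `D_σ` is closed. Smoothing nodes shows that curves with two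
components are dense in `D_σ` (`boundaryDivisor_subset_closure`) and smooth curves are dense
everywhere (`dense_openStratum`). Parametrization by affine spaces then yields irreducibility
(`isIrreducible_of_parametrization`), and density shows that identities between cross-ratios as
rational functions hold at every point where they are defined (`value_eq_zero`).

A `Chart` contains what is needed of local coordinates: they take arbitrary generic values on `u =
0`, and they generate the function field. Every nonzero rational function is then a power of `u`
times a quotient of polynomials not divisible by `u` (`Chart.exists_factorization`). So the local
ring is a discrete valuation ring with uniformizer `u`, nothing lies strictly between `D_σ` and the
whole space (`Chart.eq_univ_of_lt`), and the regular forms of top degree are the multiples of the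
volume form by the local ring (`Chart.exists_eq_smul_volume`). The pole order is the exponent of `u`
(`Chart.isLeast_pole`). -/

@[simp] theorem homog_infty : homog (∞ : OnePoint F) = (1, 0) := rfl

@[simp] theorem homog_coe (a : F) : homog (a : OnePoint F) = (a, 1) := rfl

@[simp] theorem finPart_coe (a : F) : finPart (a : OnePoint F) = a := rfl

@[simp] theorem finPart_infty : finPart (∞ : OnePoint F) = 0 := rfl

theorem coe_finPart {p : OnePoint F} (h : p ≠ ∞) : ((finPart p : F) : OnePoint F) = p := by
  cases p with
  | infty => exact absurd rfl h
  | coe a => rfl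

theorem bracket_eq_zero_iff {p q : OnePoint F} : bracket p q = 0 ↔ p = q := by
  cases p <;> cases q <;> simp [bracket, sub_eq_zero]

theorem crossRatio_eq_infty_iff {a b c d : OnePoint F} (hab : a ≠ b) :
    crossRatio a b c d = ∞ ↔ d = c := by
  have h : bracket b a ≠ 0 := fun h => hab (bracket_eq_zero_iff.1 h).symm
  unfold crossRatio
  rw [← bracket_eq_zero_iff (p := d)]
  by_cases h' : bracket d c = 0 <;> simp [h, h']

theorem crossRatio_of_ne {a b c d : OnePoint F} (hab : a ≠ b) (hdc : d ≠ c) :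
    crossRatio a b c d =
      ((bracket d a * bracket b c / (bracket d c * bracket b a) : F) : OnePoint F) := by
  have h : bracket b a ≠ 0 := fun h => hab (bracket_eq_zero_iff.1 h).symm
  have h' : bracket d c ≠ 0 := fun h => hdc (bracket_eq_zero_iff.1 h)
  simp [crossRatio, h, h']

/-- The projective coordinate in which `a, b, c` have the coordinates `0, 1, ∞`. -/
theorem exists_smul_eq_crossRatio [DecidableEq F] {a b c : OnePoint F} (hab : a ≠ b) (hbc : b ≠ c)
    (hac : a ≠ c) : ∃ g : GL (Fin 2) F, ∀ d, g • d = crossRatio a b c d := by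
  have h1 : bracket b c ≠ 0 := fun h => hbc (bracket_eq_zero_iff.1 h)
  have h2 : bracket b a ≠ 0 := fun h => hab (bracket_eq_zero_iff.1 h).symm
  have h3 : bracket a c ≠ 0 := fun h => hac (bracket_eq_zero_iff.1 h)
  -- The rows are the numerator and the denominator of the cross-ratio, as linear forms in the
  -- homogeneous coordinates of `d`.
  let A : Matrix (Fin 2) (Fin 2) F :=
    !![(homog a).2 * bracket b c, -((homog a).1 * bracket b c);
       (homog c).2 * bracket b a, -((homog c).1 * bracket b a)]
  have hA : A.det ≠ 0 := by
    have : A.det = bracket b c * bracket b a * bracket a c := by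
      rw [Matrix.det_fin_two]
      simp only [A, Matrix.of_apply, Matrix.cons_val', Matrix.cons_val_zero, Matrix.cons_val_one,
        Matrix.cons_val_fin_one]
      simp only [bracket]
      ring
    rw [this]
    exact mul_ne_zero (mul_ne_zero h1 h2) h3
  let g : GL (Fin 2) F := Matrix.GeneralLinearGroup.mkOfDetNeZero A hA
  refine ⟨g, fun d => ?_⟩
  obtain ⟨l, hl, e1, e2⟩ := exists_homog_smul g d
  have e1' : l * (homog (g • d)).1 = bracket d a * bracket b c := by
    rw [e1]
    change (homog a).2 * bracket b c * _ + -((homog a).1 * bracket b c) * _ = _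
    simp only [bracket]; ring
  have e2' : l * (homog (g • d)).2 = bracket d c * bracket b a := by
    rw [e2]
    change (homog c).2 * bracket b a * _ + -((homog c).1 * bracket b a) * _ = _
    simp only [bracket]; ring
  unfold crossRatio
  rw [← e1', ← e2']
  generalize g • d = p
  cases p with
  | infty => simp
  | coe k =>
    simp only [homog_coe, mul_one, hl, if_false]
    rw [mul_div_cancel_left₀ _ hl]

theorem crossRatio_zero_one_infty (d : OnePoint F) :
    crossRatio ((0 : F) : OnePoint F) ((1 : F) : OnePoint F) ∞ d = d := by
  cases d with
  | infty => simp [crossRatio, bracket]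
  | coe k => simp [crossRatio, bracket]

/-- Any point can be moved to infinity. -/
theorem exists_smul_eq_infty [DecidableEq F] (p : OnePoint F) : ∃ g : GL (Fin 2) F, g • p = ∞ := by
  cases p with
  | infty => exact ⟨1, one_smul _ _⟩
  | coe k =>
    refine ⟨Matrix.GeneralLinearGroup.mkOfDetNeZero !![0, 1; 1, -k] (by simp), ?_⟩
    rw [OnePoint.smul_some_eq_ite, if_pos]
    simp [Matrix.GeneralLinearGroup.mkOfDetNeZero]

/-- The affine transformation `z ↦ (z - c) / l` of the projective line. -/
theorem exists_smul_affine [DecidableEq F] (c : F) {l : F} (hl : l ≠ 0) :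
    ∃ g : GL (Fin 2) F, g • (∞ : OnePoint F) = ∞ ∧
      ∀ z : F, g • (z : OnePoint F) = (((z - c) / l : F) : OnePoint F) := by
  refine ⟨Matrix.GeneralLinearGroup.mkOfDetNeZero !![1, -c; 0, l] (by simpa using hl), ?_, fun z => ?_⟩
  · rw [OnePoint.smul_infty_eq_ite, if_pos]
    simp [Matrix.GeneralLinearGroup.mkOfDetNeZero]
  · rw [OnePoint.smul_some_eq_ite, if_neg]
    · simp [Matrix.GeneralLinearGroup.mkOfDetNeZero, sub_eq_add_neg]
    · simpa [Matrix.GeneralLinearGroup.mkOfDetNeZero] using hl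

end CrossRatio

/-! ### Limits of points of the projective line -/

/-- The family `f` of points of the projective line converges to `p`: after rescaling, the
homogeneous coordinates converge. -/
def HasLimit {T : Type*} (l : Filter T) (f : T → OnePoint ℂ) (p : OnePoint ℂ) : Prop :=
  ∃ r : T → ℂ, (∀ᶠ t in l, r t ≠ 0) ∧
    Tendsto (fun t => r t * (homog (f t)).1) l (𝓝 (homog p).1) ∧
    Tendsto (fun t => r t * (homog (f t)).2) l (𝓝 (homog p).2)

namespace HasLimit

variable {T : Type*} {l : Filter T}

theorem const (p : OnePoint ℂ) : HasLimit l (fun _ => p) p :=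
  ⟨fun _ => 1, by simp, by simpa using tendsto_const_nhds, by simpa using tendsto_const_nhds⟩

theorem of_tendsto {f : T → ℂ} {p : ℂ} (h : Tendsto f l (𝓝 p)) :
    HasLimit l (fun t => (f t : OnePoint ℂ)) p :=
  ⟨fun _ => 1, by simp, by simpa using h, by simpa using tendsto_const_nhds⟩

theorem of_cobounded {f : T → ℂ} (h : Tendsto f l (Bornology.cobounded ℂ)) :
    HasLimit l (fun t => (f t : OnePoint ℂ)) ∞ := by
  have h0 : ∀ᶠ t in l, f t ≠ 0 := h.eventually_ne_cobounded 0
  refine ⟨fun t => (f t)⁻¹, ?_, ?_, ?_⟩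
  · filter_upwards [h0] with t ht using inv_ne_zero ht
  · refine (tendsto_congr' ?_).2 (tendsto_const_nhds (x := (1 : ℂ)))
    filter_upwards [h0] with t ht
    simp [ht]
  · simpa [Function.comp_def] using tendsto_inv₀_cobounded.comp h

theorem congr' {f g : T → OnePoint ℂ} {p : OnePoint ℂ} (h : HasLimit l f p)
    (hfg : ∀ᶠ t in l, f t = g t) : HasLimit l g p := by
  obtain ⟨r, h0, h1, h2⟩ := h
  refine ⟨r, h0, h1.congr' ?_, h2.congr' ?_⟩ <;>
  · filter_upwards [hfg] with t ht
    rw [ht]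

theorem tendsto_bracket {f g : T → OnePoint ℂ} {p q : OnePoint ℂ} {r r' : T → ℂ}
    (h1 : Tendsto (fun t => r t * (homog (f t)).1) l (𝓝 (homog p).1))
    (h2 : Tendsto (fun t => r t * (homog (f t)).2) l (𝓝 (homog p).2))
    (h1' : Tendsto (fun t => r' t * (homog (g t)).1) l (𝓝 (homog q).1))
    (h2' : Tendsto (fun t => r' t * (homog (g t)).2) l (𝓝 (homog q).2)) :
    Tendsto (fun t => r t * r' t * ModuliZero.bracket (f t) (g t)) l
      (𝓝 (ModuliZero.bracket p q)) := by
  refine ((h1.mul h2').sub (h2.mul h1')).congr fun t => ?_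
  simp only [ModuliZero.bracket]
  ring

theorem eventually_ne {f g : T → OnePoint ℂ} {p q : OnePoint ℂ} (hf : HasLimit l f p)
    (hg : HasLimit l g q) (hpq : p ≠ q) : ∀ᶠ t in l, f t ≠ g t := by
  obtain ⟨r, h0, h1, h2⟩ := id hf
  obtain ⟨r', h0', h1', h2'⟩ := id hg
  have hb := tendsto_bracket h1 h2 h1' h2'
  filter_upwards [hb.eventually_ne (fun h => hpq (bracket_eq_zero_iff.1 h))] with t ht he
  exact ht (by rw [bracket_eq_zero_iff.2 he, mul_zero])

/-- The cross-ratio is homogeneous of degree zero in each point, so rescaling does no harm, and the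
two inequalities keep its denominator away from zero. The points `p₁` and `p₂`, or `p₀` and `p₂`,
may coincide. -/
theorem crossRatio {f₀ f₁ f₂ f₃ : T → OnePoint ℂ} {p₀ p₁ p₂ p₃ : OnePoint ℂ}
    (H₀ : HasLimit l f₀ p₀) (H₁ : HasLimit l f₁ p₁) (H₂ : HasLimit l f₂ p₂)
    (H₃ : HasLimit l f₃ p₃) (h01 : p₀ ≠ p₁) (h32 : p₃ ≠ p₂) :
    (∀ᶠ t in l, ModuliZero.crossRatio (f₀ t) (f₁ t) (f₂ t) (f₃ t) ≠ ∞) ∧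
    Tendsto (fun t => finPart (ModuliZero.crossRatio (f₀ t) (f₁ t) (f₂ t) (f₃ t))) l
      (𝓝 (finPart (ModuliZero.crossRatio p₀ p₁ p₂ p₃))) := by
  have e01 := H₀.eventually_ne H₁ h01
  have e32 := H₃.eventually_ne H₂ h32
  refine ⟨?_, ?_⟩
  · filter_upwards [e01, e32] with t h h'
    exact fun e => h' ((crossRatio_eq_infty_iff h).1 e)
  obtain ⟨r₀, n₀, u₀, v₀⟩ := id H₀
  obtain ⟨r₁, n₁, u₁, v₁⟩ := id H₁
  obtain ⟨r₂, n₂, u₂, v₂⟩ := id H₂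
  obtain ⟨r₃, n₃, u₃, v₃⟩ := id H₃
  have b30 := tendsto_bracket u₃ v₃ u₀ v₀
  have b12 := tendsto_bracket u₁ v₁ u₂ v₂
  have b32 := tendsto_bracket u₃ v₃ u₂ v₂
  have b10 := tendsto_bracket u₁ v₁ u₀ v₀
  have hne : ModuliZero.bracket p₃ p₂ * ModuliZero.bracket p₁ p₀ ≠ 0 :=
    mul_ne_zero (fun h => h32 (bracket_eq_zero_iff.1 h))
      (fun h => h01 (bracket_eq_zero_iff.1 h).symm)
  rw [crossRatio_of_ne h01 h32, finPart_coe]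
  refine ((b30.mul b12).div (b32.mul b10) hne).congr' ?_
  filter_upwards [e01, e32, n₀, n₁, n₂, n₃] with t h h' m₀ m₁ m₂ m₃
  rw [crossRatio_of_ne h h', finPart_coe]
  -- Each scaling factor occurs once in the numerator and once in the denominator, and cancels.
  have hm : r₀ t * r₁ t * r₂ t * r₃ t ≠ 0 := by positivity
  rw [← mul_div_mul_left _ (ModuliZero.bracket (f₃ t) (f₂ t) * _) hm, Pi.div_apply]
  congr 1 <;> ring

end HasLimit

/-! ### The Zariski topology -/

section Topology

variable {S : Type*}

theorem mem_basicOpen {I : Finset (Fin 4 ↪ S)} {P : MvPolynomial (Fin 4 ↪ S) ℂ} {x : Mbar S} :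
    x ∈ basicOpen I P ↔ (∀ q ∈ I, coord q x ≠ ∞) ∧ value P x ≠ 0 := Iff.rfl

theorem isOpen_basicOpen {I : Finset (Fin 4 ↪ S)} {P : MvPolynomial (Fin 4 ↪ S) ℂ}
    (h : P.vars ⊆ I) : IsOpen (basicOpen I P) :=
  TopologicalSpace.isOpen_generateFrom_of_mem ⟨I, P, h, rfl⟩

@[simp] theorem value_mul (P Q : MvPolynomial (Fin 4 ↪ S) ℂ) (x : Mbar S) :
    value (P * Q) x = value P x * value Q x := by simp [value]

@[simp] theorem value_one (x : Mbar S) : value (1 : MvPolynomial (Fin 4 ↪ S) ℂ) x = 1 := by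
  simp [value]

theorem basicOpen_inter [DecidableEq (Fin 4 ↪ S)] (I J : Finset (Fin 4 ↪ S))
    (P Q : MvPolynomial (Fin 4 ↪ S) ℂ) :
    basicOpen I P ∩ basicOpen J Q = basicOpen (I ∪ J) (P * Q) := by
  ext x
  simp only [Set.mem_inter_iff, mem_basicOpen, Finset.mem_union, value_mul, mul_ne_zero_iff]
  constructor
  · rintro ⟨⟨h1, h2⟩, h3, h4⟩
    exact ⟨fun q hq => hq.elim (h1 q) (h3 q), h2, h4⟩
  · rintro ⟨h1, h2, h4⟩
    exact ⟨⟨fun q hq => h1 q (Or.inl hq), h2⟩, fun q hq => h1 q (Or.inr hq), h4⟩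

theorem isTopologicalBasis_basicOpen : TopologicalSpace.IsTopologicalBasis
    {U : Set (Mbar S) | ∃ I P, P.vars ⊆ I ∧ U = basicOpen I P} := by
  classical
  refine ⟨?_, ?_, rfl⟩
  · rintro _ ⟨I, P, hI, rfl⟩ _ ⟨J, Q, hJ, rfl⟩ x hx
    refine ⟨_, ⟨I ∪ J, P * Q, ?_, basicOpen_inter I J P Q⟩, hx, subset_rfl⟩
    exact (MvPolynomial.vars_mul P Q).trans (Finset.union_subset_union hI hJ)
  · refine Set.eq_univ_of_forall fun x => ⟨_, ⟨∅, 1, ?_, rfl⟩, ?_⟩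
    · simp
    · simp [mem_basicOpen]

theorem isOpen_coord_ne_infty (q : Fin 4 ↪ S) : IsOpen {x : Mbar S | coord q x ≠ ∞} := by
  convert isOpen_basicOpen (I := {q}) (P := (1 : MvPolynomial (Fin 4 ↪ S) ℂ)) (by simp) using 1
  ext x
  simp [mem_basicOpen]

theorem isClosed_coord_eq_infty (q : Fin 4 ↪ S) : IsClosed {x : Mbar S | coord q x = ∞} := by
  rw [← isOpen_compl_iff]
  exact isOpen_coord_ne_infty q

/-- A limit in the classical sense is a limit in the Zariski topology. -/
theorem mem_closure_of_tendsto {T : Type*} {l : Filter T} [l.NeBot] {A : Set (Mbar S)}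
    {x : Mbar S} (y : T → Mbar S) (hy : ∀ᶠ t in l, y t ∈ A)
    (h : ∀ q, coord q x ≠ ∞ → (∀ᶠ t in l, coord q (y t) ≠ ∞) ∧
      Tendsto (fun t => finPart (coord q (y t))) l (𝓝 (finPart (coord q x)))) :
    x ∈ closure A := by
  rw [isTopologicalBasis_basicOpen.mem_closure_iff]
  rintro _ ⟨I, P, hI, rfl⟩ ⟨hx1, hx2⟩
  have h1 : ∀ᶠ t in l, ∀ q ∈ I, coord q (y t) ≠ ∞ :=
    (Filter.eventually_all_finset I).2 fun q hq => (h q (hx1 q hq)).1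
  have h2 : Tendsto (fun t => value P (y t)) l (𝓝 (value P x)) := by
    unfold value
    simp only [MvPolynomial.eval_eq]
    refine tendsto_finsetSum _ fun d hd => tendsto_const_nhds.mul
      (tendsto_finsetProd _ fun q hq => Tendsto.pow ?_ _)
    refine (h q (hx1 q (hI ?_))).2
    exact MvPolynomial.mem_vars_iff_mem_support q |>.2 ⟨d, hd, hq⟩
  obtain ⟨t, ht1, ht2, ht3⟩ := (h1.and ((h2.eventually_ne hx2).and hy)).exists
  exact ⟨y t, ⟨ht1, ht2⟩, ht3⟩

end Topology

end ModuliZero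

namespace ModuliZero

/-- Four distinct labels. -/
def quad {S : Type*} {k l i j : S} (hkl : k ≠ l) (hki : k ≠ i) (hkj : k ≠ j) (hli : l ≠ i)
    (hlj : l ≠ j) (hij : i ≠ j) : Fin 4 ↪ S :=
  ⟨![k, l, i, j], by
    intro a c hac
    fin_cases a <;> fin_cases c <;> simp_all [eq_comm]⟩

/-! ### The two sides of a node -/

namespace StableCurve

variable {S : Type*} (C : StableCurve S)

/-- The component `u` lies on the side of `w` of the node joining `v` and `w`. -/
def OnSide (v w u : Fin C.size) : Prop := v ≠ u ∧ (C.path v u).snd = w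

/-- The labels behind a node of the component `v`. -/
def behind {v w : Fin C.size} (h : C.graph.Adj v w) : Set S := {s | C.pos v s = C.node h}

theorem node_congr {v w w' : Fin C.size} (h : C.graph.Adj v w) (h' : C.graph.Adj v w')
    (e : w = w') : C.node h = C.node h' := by subst e; rfl

theorem mem_behind_iff {v w : Fin C.size} (h : C.graph.Adj v w) {s : S} :
    s ∈ C.behind h ↔ C.OnSide v w (C.comp s) := by
  change C.pos v s = C.node h ↔ _
  unfold pos OnSide
  by_cases hv : v = C.comp s
  · subst hv
    simpa using C.mark_ne_node s h
  · rw [dif_neg hv]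
    exact ⟨fun e => ⟨hv, C.node_inj _ _ e⟩, fun e => C.node_congr _ _ e.2⟩

theorem path_snd_of_adj {v w : Fin C.size} (h : C.graph.Adj v w) : (C.path v w).snd = w := by
  have : (SimpleGraph.Walk.cons h SimpleGraph.Walk.nil).IsPath := by
    simp [h.ne]
  rw [← C.eq_path _ this]
  rfl

theorem onSide_self {v w : Fin C.size} (h : C.graph.Adj v w) : C.OnSide v w w :=
  ⟨h.ne, C.path_snd_of_adj h⟩

/-- The path from `v` to `u` starts with `w`, or that from `w` to `u` starts with `v`. Not both:
each first step lowers the distance to `u` by one. -/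
theorem onSide_iff_not {v w u : Fin C.size} (h : C.graph.Adj v w) :
    C.OnSide v w u ↔ ¬ C.OnSide w v u := by
  constructor
  · rintro ⟨h1, h2⟩ ⟨h3, h4⟩
    have e1 := C.dist_snd_add_one h1
    have e2 := C.dist_snd_add_one h3
    rw [h2] at e1
    rw [h4] at e2
    omega
  · intro hn
    by_cases hw : w = u
    · subst hw
      exact C.onSide_self h
    · have hs : (C.path w u).snd ≠ (C.path w v).snd := by
        rw [C.path_snd_of_adj h.symm]
        exact fun e => hn ⟨hw, e⟩
      obtain ⟨h1, h2⟩ := C.path_snd_eq h.ne.symm hw hs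
      exact ⟨h1, h2.trans (C.path_snd_of_adj h)⟩

theorem mem_behind_symm_iff {v w : Fin C.size} (h : C.graph.Adj v w) {s : S} :
    s ∈ C.behind h.symm ↔ s ∉ C.behind h := by
  rw [mem_behind_iff, mem_behind_iff, onSide_iff_not _ h.symm]

theorem behind_symm {v w : Fin C.size} (h : C.graph.Adj v w) :
    C.behind h.symm = (C.behind h)ᶜ := by
  ext s
  exact C.mem_behind_symm_iff h

/-- The node of `u` through which the chain of components from `u` to `v` leaves `u`. -/
def toward {u v : Fin C.size} (h : u ≠ v) : OnePoint ℂ :=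
  C.node (SimpleGraph.Walk.adj_snd (C.path_not_nil h))

/-- From a component behind a node, all labels that are not behind the node are seen in the
direction of the node. -/
theorem pos_eq_toward {v w u : Fin C.size} (h : C.graph.Adj v w) (hu : C.OnSide v w u) {s : S}
    (hs : s ∉ C.behind h) : C.pos u s = C.toward hu.1.symm := by
  rw [mem_behind_iff] at hs
  unfold pos toward
  by_cases hv : v = C.comp s
  · subst hv
    rw [dif_neg hu.1.symm]
  · have hne : (C.path v (C.comp s)).snd ≠ (C.path v u).snd := by
      rw [hu.2]
      exact fun e => hs ⟨hv, e⟩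
    obtain ⟨h1, h2⟩ := C.path_snd_eq hu.1 hv hne
    rw [dif_neg h1]
    exact C.node_congr _ _ h2

theorem pos_eq_pos_of_notMem {v w u : Fin C.size} (h : C.graph.Adj v w) (hu : C.OnSide v w u)
    {s s' : S} (hs : s ∉ C.behind h) (hs' : s' ∉ C.behind h) : C.pos u s = C.pos u s' :=
  (C.pos_eq_toward h hu hs).trans (C.pos_eq_toward h hu hs').symm

theorem pos_eq_pos_of_mem {v w u : Fin C.size} (h : C.graph.Adj v w) (hu : ¬ C.OnSide v w u)
    {s s' : S} (hs : s ∈ C.behind h) (hs' : s' ∈ C.behind h) : C.pos u s = C.pos u s' := by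
  refine C.pos_eq_pos_of_notMem h.symm (s := s) (s' := s') ?_ ?_ ?_
  · rwa [onSide_iff_not _ h.symm]
  · rwa [mem_behind_symm_iff, not_not]
  · rwa [mem_behind_symm_iff, not_not]

theorem onSide_of_onSide {v w w' u : Fin C.size} (h : C.graph.Adj v w)
    (hne : w' ≠ v) (hu : C.OnSide w w' u) : C.OnSide v w u := by
  rw [onSide_iff_not _ h]
  rintro ⟨h1, h2⟩
  exact hne (hu.2.symm.trans h2)

/-- At least two labels lie behind each node. -/
theorem two_le_ncard_behind [Finite S] {v w : Fin C.size} (h : C.graph.Adj v w) :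
    2 ≤ (C.behind h).ncard := by
  classical
  -- Induction on a bound for the number of components beyond the node. A further node of `w` has
  -- fewer components beyond it; if there is none, stability leaves at least two labels on `w`
  -- itself.
  obtain ⟨m, hm⟩ : ∃ m, (Finset.univ.filter (C.OnSide v w)).card ≤ m := ⟨_, le_rfl⟩
  induction m generalizing v w with
  | zero =>
    have : w ∈ Finset.univ.filter (C.OnSide v w) := by simpa using C.onSide_self h
    have := Finset.card_pos.2 ⟨w, this⟩
    omega
  | succ m ih =>
    by_cases hw : ∃ w', C.graph.Adj w w' ∧ w' ≠ v
    · obtain ⟨w', h', hne⟩ := hw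
      have hlt : (Finset.univ.filter (C.OnSide w w')).card
          < (Finset.univ.filter (C.OnSide v w)).card := by
        refine Finset.card_lt_card ⟨fun u hu => ?_, fun hsub => ?_⟩
        · rw [Finset.mem_filter] at hu ⊢
          exact ⟨hu.1, C.onSide_of_onSide h hne hu.2⟩
        · have := hsub (x := w) (by simpa using C.onSide_self h)
          simp [OnSide] at this
      refine (ih h' (by omega)).trans (Set.ncard_le_ncard (fun s hs => ?_) (Set.toFinite _))
      rw [mem_behind_iff] at hs ⊢
      exact C.onSide_of_onSide h hne hs
    · push Not at hw
      have h1 : {w' | C.graph.Adj w w'} = {v} := by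
        ext w'
        exact ⟨fun e => hw w' e, fun e => by rw [Set.mem_singleton_iff.1 e]; exact h.symm⟩
      have h2 := C.stable w
      rw [h1, Set.ncard_singleton] at h2
      have h3 : {s | C.comp s = w}.ncard ≤ (C.behind h).ncard := by
        refine Set.ncard_le_ncard (fun s hs => ?_) (Set.toFinite _)
        have hs' : C.comp s = w := hs
        rw [mem_behind_iff, hs']
        exact C.onSide_self h
      omega

/-- Two labels that are seen in the same direction lie behind a common node. -/
theorem exists_behind_of_pos_eq {v : Fin C.size} {i j : S} (hij : i ≠ j)
    (h : C.pos v i = C.pos v j) : ∃ (w : Fin C.size) (hw : C.graph.Adj v w),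
      C.node hw = C.pos v i := by
  obtain ⟨h1, -, -⟩ := C.exists_of_pos_eq hij h
  refine ⟨_, SimpleGraph.Walk.adj_snd (C.path_not_nil h1), ?_⟩
  unfold pos
  rw [dif_neg h1]

theorem cross_eq_infty_iff {q : Fin 4 ↪ S} {v : Fin C.size}
    (hv : C.Separates v (q 0) (q 1) (q 2)) : C.cross q = ∞ ↔ C.pos v (q 3) = C.pos v (q 2) := by
  rw [C.cross_eq hv, crossRatio_eq_infty_iff hv.1]

/-- There is a node with exactly the labels in `P` behind it if and only if all cross-ratios of two
labels in `P` and two labels outside of `P` degenerate. -/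
theorem hasNode_iff [Finite S] {P : Set S} (hP : 2 ≤ P.ncard) (hP' : 2 ≤ Pᶜ.ncard) :
    C.HasNode P ↔ ∀ q : Fin 4 ↪ S, q 0 ∉ P → q 1 ∉ P → q 2 ∈ P → q 3 ∈ P → C.cross q = ∞ := by
  constructor
  · rintro ⟨v, w, h, rfl⟩ q h0 h1 h2 h3
    obtain ⟨u, hu⟩ := C.exists_separates (i := q 0) (j := q 1) (k := q 2)
      (by simp) (by simp) (by simp)
    rw [C.cross_eq_infty_iff hu]
    refine C.pos_eq_pos_of_mem h (fun hs => ?_) h3 h2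
    exact hu.1 (C.pos_eq_pos_of_notMem h hs h0 h1)
  · intro H
    have sees : ∀ (u : Fin C.size) (k l i j : S), k ≠ l → k ∉ P → l ∉ P → i ∈ P → j ∈ P →
        C.Separates u k l i → C.pos u j = C.pos u i := by
      intro u k l i j hkl hk hl hi hj hu
      by_cases hij : i = j
      · rw [hij]
      have hki : k ≠ i := fun e => hk (e ▸ hi)
      have hkj : k ≠ j := fun e => hk (e ▸ hj)
      have hli : l ≠ i := fun e => hl (e ▸ hi)
      have hlj : l ≠ j := fun e => hl (e ▸ hj)
      let q := quad hkl hki hkj hli hlj hij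
      have hq : C.cross q = ∞ := H q hk hl hi hj
      exact (C.cross_eq_infty_iff (q := q) (v := u) hu).1 hq
    obtain ⟨k, l, hk, hl, hkl⟩ : ∃ k l, k ∈ Pᶜ ∧ l ∈ Pᶜ ∧ k ≠ l := by
      obtain ⟨k, hk, l, hl, hkl⟩ := (Set.one_lt_ncard (Set.toFinite _)).1 hP'
      exact ⟨k, l, hk, hl, hkl⟩
    obtain ⟨i, hi, j, hj, hij⟩ := (Set.one_lt_ncard (Set.toFinite _)).1 hP
    have step : ∀ (u : Fin C.size) (k l : S), k ≠ l → k ∉ P → l ∉ P → C.Separates u k l i →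
        ∃ (w : Fin C.size) (h : C.graph.Adj u w), P ⊆ C.behind h ∧ C.node h = C.pos u i := by
      intro u k l hkl hk hl hu
      have hall := fun j hj => sees u k l i j hkl hk hl hi hj hu
      obtain ⟨w, hw, e⟩ := C.exists_behind_of_pos_eq hij (hall j hj).symm
      exact ⟨w, hw, fun s hs => (hall s hs).trans e.symm, e⟩
    have hex : ∃ m, ∃ (v w : Fin C.size) (h : C.graph.Adj v w), P ⊆ C.behind h ∧
        (C.behind h).ncard = m := by
      obtain ⟨u, hu⟩ := C.exists_separates (i := k) (j := l) (k := i) hkl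
        (fun e => hl (e ▸ hi)) (fun e => hk (e ▸ hi))
      obtain ⟨w, h, h1, -⟩ := step u k l hkl hk hl hu
      exact ⟨_, u, w, h, h1, rfl⟩
    classical
    -- Among the nodes with all of `P` behind them, take one with the fewest labels behind it. If
    -- there were an extra label `m` behind it, a component separating `m`, `i` and a label `k'` in
    -- front of the node would lie beyond the node. From there all of `P` is seen in the direction
    -- of `i`, and the node in this direction excludes `m`, against minimality.
    obtain ⟨v, w, h, hsub, hcard⟩ := Nat.find_spec hex
    refine ⟨v, w, h, hsub.antisymm fun m hm => ?_⟩
    by_contra hmP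
    obtain ⟨k', hk'⟩ : (C.behind h.symm).Nonempty := by
      have := C.two_le_ncard_behind h.symm
      exact Set.nonempty_of_ncard_ne_zero (by omega)
    rw [mem_behind_symm_iff _ h] at hk'
    have hk'P : k' ∉ P := fun e => hk' (hsub e)
    have hmk : m ≠ k' := by
      rintro rfl
      exact hk' hm
    obtain ⟨u, hu⟩ := C.exists_separates (i := m) (j := k') (k := i) hmk
        (fun e => hk'P (e ▸ hi)) (fun e => hmP (e ▸ hi))
    obtain ⟨w', h', h1, h2⟩ := step u m k' hmk hmP hk'P hu
    have hside : C.OnSide v w u := by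
      by_contra hn
      exact hu.2.2 (C.pos_eq_pos_of_mem h hn hm (hsub hi))
    refine Nat.find_min hex (m := (C.behind h').ncard) ?_ ⟨u, w', h', h1, rfl⟩
    rw [← hcard]
    refine Set.ncard_lt_ncard ⟨fun s hs => ?_, fun hsup => ?_⟩ (Set.toFinite _)
    · by_contra hsn
      have e := C.pos_eq_pos_of_notMem h hside hsn hk'
      exact hu.2.1 (e.symm.trans (Eq.trans hs h2))
    · exact hu.2.2 (Eq.trans (hsup hm) h2)

end StableCurve

/-! ### Boundary divisors are closed -/

section

variable {S : Type*}

@[simp] theorem coord_mk (q : Fin 4 ↪ S) (C : StableCurve S) :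
    coord q (Quot.mk _ C : Mbar S) = C.cross q := rfl

variable [Fintype S] [DecidableEq S]

namespace StablePartition

variable (σ : StablePartition S)

theorem exists_parts : ∃ P : Finset S, σ.1.parts = {P, Pᶜ} := by
  obtain ⟨P, Q, hPQ, h⟩ := Finset.card_eq_two.1 σ.2.1
  refine ⟨P, ?_⟩
  have hd : Disjoint P Q := σ.1.disjoint (by simp [h]) (by simp [h]) hPQ
  have hs : P ∪ Q = Finset.univ := by
    have := σ.1.sup_parts
    rw [h] at this
    simpa using this
  have hQ : Q = Pᶜ := by
    ext s
    have h1 : s ∈ P ∪ Q := by rw [hs]; exact Finset.mem_univ s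
    rw [Finset.mem_union] at h1
    rw [Finset.mem_compl]
    exact ⟨fun h2 h3 => Finset.disjoint_left.1 hd h3 h2, fun h2 => h1.resolve_left h2⟩
  rw [h, hQ]

theorem compl_mem {P : Finset S} (hP : P ∈ σ.1.parts) : Pᶜ ∈ σ.1.parts := by
  obtain ⟨Q, hQ⟩ := σ.exists_parts
  rw [hQ] at hP ⊢
  rcases Finset.mem_insert.1 hP with rfl | h
  · simp
  · rw [Finset.mem_singleton.1 h, compl_compl]
    simp

theorem parts_eq {P : Finset S} (hP : P ∈ σ.1.parts) : σ.1.parts = {P, Pᶜ} := by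
  obtain ⟨Q, hQ⟩ := σ.exists_parts
  rw [hQ] at hP ⊢
  rcases Finset.mem_insert.1 hP with rfl | h
  · rfl
  · rw [Finset.mem_singleton.1 h, compl_compl, Finset.pair_comm]

theorem two_le_card {P : Finset S} (hP : P ∈ σ.1.parts) : 2 ≤ P.card := σ.2.2 P hP

variable {σ} in
theorem eq_of_mem {τ : StablePartition S} {P : Finset S} (hP : P ∈ σ.1.parts)
    (hP' : P ∈ τ.1.parts) : σ = τ := by
  refine Subtype.ext (Finpartition.ext ?_)
  rw [σ.parts_eq hP, τ.parts_eq hP']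

/-- The stable partition with a given part. -/
theorem exists_of_two_le {P : Finset S} (h : 2 ≤ P.card) (h' : 2 ≤ Pᶜ.card) :
    ∃ σ : StablePartition S, P ∈ σ.1.parts := by
  have hne : P ≠ ∅ := by rintro rfl; simp at h
  have hne' : Pᶜ ≠ ∅ := by intro e; rw [e] at h'; simp at h'
  have hPP : P ≠ Pᶜ := by
    intro e
    obtain ⟨s, hs⟩ := Finset.nonempty_iff_ne_empty.2 hne
    have hs' := hs
    rw [e, Finset.mem_compl] at hs'
    exact hs' hs
  let π : Finpartition (Finset.univ : Finset S) :=
    { parts := {P, Pᶜ}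
      supIndep := by
        rw [Finset.supIndep_pair hPP]
        exact disjoint_compl_right
      sup_parts := by simp
      bot_notMem := by
        simp only [Finset.bot_eq_empty, Finset.mem_insert, Finset.mem_singleton, not_or]
        exact ⟨hne.symm, hne'.symm⟩ }
  have hparts : π.parts = {P, Pᶜ} := rfl
  refine ⟨⟨π, ?_, ?_⟩, by simp [hparts]⟩
  · rw [hparts, Finset.card_pair hPP]
  · intro Q hQ
    rw [hparts, Finset.mem_insert, Finset.mem_singleton] at hQ
    rcases hQ with rfl | rfl <;> assumption

end StablePartition

theorem StableCurve.HasNode.compl {S : Type*} {C : StableCurve S} {P : Set S} (h : C.HasNode P) :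
    C.HasNode Pᶜ := by
  obtain ⟨v, w, h, rfl⟩ := h
  exact ⟨w, v, h.symm, (C.behind_symm h).symm⟩

/-- Having a node is a property of a representative, but its description by cross-ratios is
invariant under isomorphism. The choice of the part is irrelevant because a node can be read from
either side. -/
theorem mk_mem_boundaryDivisor_iff {σ : StablePartition S} {P : Finset S} (hP : P ∈ σ.1.parts)
    (C : StableCurve S) :
    (Quot.mk _ C : Mbar S) ∈ boundaryDivisor σ ↔ C.HasNode (P : Set S) := by
  have h2 : 2 ≤ (P : Set S).ncard := by
    rw [Set.ncard_coe_finset]; exact σ.two_le_card hP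
  have h2' : 2 ≤ (P : Set S)ᶜ.ncard := by
    rw [← Finset.coe_compl, Set.ncard_coe_finset]; exact σ.two_le_card (σ.compl_mem hP)
  constructor
  · rintro ⟨C', hC', Q, hQ, hn⟩
    have hn' : C'.HasNode (P : Set S) := by
      rw [σ.parts_eq hP, Finset.mem_insert, Finset.mem_singleton] at hQ
      rcases hQ with rfl | rfl
      · exact hn
      · simpa using hn.compl
    rw [StableCurve.hasNode_iff _ h2 h2'] at hn' ⊢
    intro q h0 h1 h3 h4
    rw [← coord_mk, ← hC', coord_mk]
    exact hn' q h0 h1 h3 h4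
  · exact fun h => ⟨C, rfl, P, hP, h⟩

theorem mem_boundaryDivisor_iff {σ : StablePartition S} {P : Finset S} (hP : P ∈ σ.1.parts)
    (x : Mbar S) : x ∈ boundaryDivisor σ ↔
      ∀ q : Fin 4 ↪ S, q 0 ∉ P → q 1 ∉ P → q 2 ∈ P → q 3 ∈ P → coord q x = ∞ := by
  obtain ⟨C⟩ := x
  have h2 : 2 ≤ (P : Set S).ncard := by
    rw [Set.ncard_coe_finset]; exact σ.two_le_card hP
  have h2' : 2 ≤ (P : Set S)ᶜ.ncard := by
    rw [← Finset.coe_compl, Set.ncard_coe_finset]; exact σ.two_le_card (σ.compl_mem hP)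
  have := mk_mem_boundaryDivisor_iff hP C
  rw [StableCurve.hasNode_iff _ h2 h2'] at this
  exact this

theorem isClosed_boundaryDivisor (σ : StablePartition S) : IsClosed (boundaryDivisor σ) := by
  obtain ⟨P, hP⟩ := σ.exists_parts
  have : boundaryDivisor σ = ⋂ q : Fin 4 ↪ S, {x | q 0 ∉ P → q 1 ∉ P → q 2 ∈ P → q 3 ∈ P →
      coord q x = ∞} := by
    ext x
    rw [mem_boundaryDivisor_iff (P := P) (by simp [hP])]
    simp
  rw [this]
  refine isClosed_iInter fun q => ?_
  by_cases h : q 0 ∉ P ∧ q 1 ∉ P ∧ q 2 ∈ P ∧ q 3 ∈ P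
  · simpa [h.1, h.2.1, h.2.2.1, h.2.2.2] using isClosed_coord_eq_infty q
  · convert isClosed_univ
    rw [Set.eq_univ_iff_forall]
    exact fun x h0 h1 h2 h3 => absurd ⟨h0, h1, h2, h3⟩ h

/-! ### The open stratum -/

/-- The open stratum: no cross-ratio degenerates. -/
def openStratum (S : Type*) : Set (Mbar S) := {x | ∀ q, coord q x ≠ ∞}

theorem isOpen_openStratum {S : Type*} [Finite S] : IsOpen (openStratum S) := by
  have : openStratum S = ⋂ q : Fin 4 ↪ S, {x | coord q x ≠ ∞} := by
    ext x
    simp [openStratum]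
  rw [this]
  exact isOpen_iInter_of_finite isOpen_coord_ne_infty

/-- An infinite cross-ratio means that two labels are seen in the same direction from the separating
component, and in that direction there must be a node. -/
theorem exists_mem_boundaryDivisor {x : Mbar S} (hx : x ∉ openStratum S) :
    ∃ σ, x ∈ boundaryDivisor σ := by
  obtain ⟨C⟩ := x
  obtain ⟨q, hq⟩ : ∃ q, C.cross q = ∞ := by
    by_contra hn
    exact hx fun q hq => hn ⟨q, hq⟩
  obtain ⟨v, hv⟩ := C.exists_separates (i := q 0) (j := q 1) (k := q 2)
      (by simp) (by simp) (by simp)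
  rw [C.cross_eq_infty_iff hv] at hq
  obtain ⟨w, hw, -⟩ := C.exists_behind_of_pos_eq (by simp) hq
  classical
  let P : Finset S := (C.behind hw).toFinset
  have hP : (P : Set S) = C.behind hw := by simp [P]
  obtain ⟨σ, hσ⟩ := StablePartition.exists_of_two_le (P := P)
    (by rw [← Set.ncard_coe_finset, hP]; exact C.two_le_ncard_behind hw)
    (by rw [← Set.ncard_coe_finset, Finset.coe_compl, hP, ← C.behind_symm]
        exact C.two_le_ncard_behind hw.symm)
  exact ⟨σ, C, rfl, P, hσ, v, w, hw, hP⟩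

theorem disjoint_openStratum_boundaryDivisor (σ : StablePartition S) :
    Disjoint (openStratum S) (boundaryDivisor σ) := by
  rw [Set.disjoint_left]
  intro x hx hσ
  obtain ⟨P, hP⟩ := σ.exists_parts
  have hPσ : P ∈ σ.1.parts := by simp [hP]
  rw [mem_boundaryDivisor_iff hPσ] at hσ
  obtain ⟨i, hi, j, hj, hij⟩ := Finset.one_lt_card.1 (σ.two_le_card hPσ)
  obtain ⟨k, hk, l, hl, hkl⟩ := Finset.one_lt_card.1 (σ.two_le_card (σ.compl_mem hPσ))
  rw [Finset.mem_compl] at hk hl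
  have hki : k ≠ i := fun e => hk (e ▸ hi)
  have hkj : k ≠ j := fun e => hk (e ▸ hj)
  have hli : l ≠ i := fun e => hl (e ▸ hi)
  have hlj : l ≠ j := fun e => hl (e ▸ hj)
  let q := quad hkl hki hkj hli hlj hij
  exact hx q (hσ q hk hl hi hj)

/-- A curve without nodes has a component that sees all labels in different directions. -/
theorem exists_pos_injective {S : Type*} {C : StableCurve S} (hC : Quot.mk _ C ∈ openStratum S)
    (b : Fin 3 ↪ S) : ∃ v, Function.Injective (C.pos v) := by
  obtain ⟨v, hv⟩ := C.exists_separates (i := b 0) (j := b 1) (k := b 2)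
      (by simp) (by simp) (by simp)
  refine ⟨v, fun i j h => ?_⟩
  by_contra hij
  -- At most one of `b 0, b 1, b 2` is seen in the common direction of `i` and `j`. Two others,
  -- together with `i` and `j`, form an infinite cross-ratio.
  obtain ⟨k, l, hkl, hk, hl⟩ : ∃ k l, C.pos v k ≠ C.pos v l ∧ C.pos v k ≠ C.pos v i ∧
      C.pos v l ≠ C.pos v i := by
    obtain ⟨h1, h2, h3⟩ := hv
    by_cases e0 : C.pos v (b 0) = C.pos v i
    · exact ⟨b 1, b 2, h2, fun e => h1 (e0.trans e.symm), fun e => h3 (e0.trans e.symm)⟩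
    · by_cases e1 : C.pos v (b 1) = C.pos v i
      · exact ⟨b 0, b 2, h3, e0, fun e => h2 (e1.trans e.symm)⟩
      · exact ⟨b 0, b 1, h1, e0, e1⟩
  have a1 : k ≠ l := fun e => hkl (by rw [e])
  have a2 : k ≠ i := fun e => hk (by rw [e])
  have a3 : k ≠ j := fun e => hk (by rw [e, h])
  have a4 : l ≠ i := fun e => hl (by rw [e])
  have a5 : l ≠ j := fun e => hl (by rw [e, h])
  let q := quad a1 a2 a3 a4 a5 hij
  exact hC q ((C.cross_eq_infty_iff (q := q) (v := v) ⟨hkl, hl, hk⟩).2 h.symm)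

end

end ModuliZero

namespace ModuliZero

open Filter Topology

/-! ### Degenerations -/

/-- A stable curve lies in the closure of a set `A` of stable curves if, seen from each component,
it is the limit of curves in `A` seen from suitable components. -/
theorem mk_mem_closure_of_hasLimit {S T : Type*} {l : Filter T} [l.NeBot] {A : Set (Mbar S)}
    {C : StableCurve S} (g : Fin C.size → GL (Fin 2) ℂ) (f : Fin C.size → S → T → OnePoint ℂ)
    (hf : ∀ u s, HasLimit l (f u s) (g u • C.pos u s))
    (hA : ∀ᶠ t in l, ∃ D : StableCurve S, Quot.mk _ D ∈ A ∧ ∀ u,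
      ∃ (v : Fin D.size) (G : GL (Fin 2) ℂ), ∀ s, f u s t = G • D.pos v s) :
    Quot.mk _ C ∈ closure A := by
  classical
  let Q : T → StableCurve S → Prop := fun t D => Quot.mk _ D ∈ A ∧ ∀ u,
      ∃ (v : Fin D.size) (G : GL (Fin 2) ℂ), ∀ s, f u s t = G • D.pos v s
  let y : T → StableCurve S := fun t => if h : ∃ D, Q t D then h.choose else C
  have hy : ∀ᶠ t in l, Q t (y t) := by
    filter_upwards [hA] with t ht
    have : ∃ D, Q t D := ht
    simp only [y, dif_pos this]
    exact this.choose_spec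
  refine mem_closure_of_tendsto (fun t => Quot.mk _ (y t)) (hy.mono fun t ht => ht.1) fun q hq => ?_
  obtain ⟨u, hu⟩ := C.exists_separates (i := q 0) (j := q 1) (k := q 2)
      (by simp) (by simp) (by simp)
  have e : C.cross q = crossRatio (g u • C.pos u (q 0)) (g u • C.pos u (q 1))
      (g u • C.pos u (q 2)) (g u • C.pos u (q 3)) := by
    rw [crossRatio_smul, C.cross_eq hu]
  have hinj := MulAction.injective (α := GL (Fin 2) ℂ) (β := OnePoint ℂ) (g u)
  have n01 : g u • C.pos u (q 0) ≠ g u • C.pos u (q 1) := hinj.ne hu.1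
  have n12 : g u • C.pos u (q 1) ≠ g u • C.pos u (q 2) := hinj.ne hu.2.1
  have n02 : g u • C.pos u (q 0) ≠ g u • C.pos u (q 2) := hinj.ne hu.2.2
  have n32 : g u • C.pos u (q 3) ≠ g u • C.pos u (q 2) :=
    hinj.ne fun h => hq ((C.cross_eq_infty_iff hu).2 h)
  obtain ⟨h1, h2⟩ := (hf u (q 0)).crossRatio (hf u (q 1)) (hf u (q 2)) (hf u (q 3)) n01 n32
  -- Distinct limits have distinct approximants, so near the limit the component `v` of the nearby
  -- curve separates the first three labels and computes its cross-ratio.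
  have hev : ∀ᶠ t in l, (y t).cross q =
      crossRatio (f u (q 0) t) (f u (q 1) t) (f u (q 2) t) (f u (q 3) t) := by
    filter_upwards [hy, (hf u (q 0)).eventually_ne (hf u (q 1)) n01,
      (hf u (q 1)).eventually_ne (hf u (q 2)) n12,
      (hf u (q 0)).eventually_ne (hf u (q 2)) n02] with t ht m01 m12 m02
    obtain ⟨v, G, hG⟩ := ht.2 u
    rw [hG, hG] at m01 m12 m02
    have hsep : (y t).Separates v (q 0) (q 1) (q 2) :=
      ⟨fun h => m01 (by rw [h]), fun h => m12 (by rw [h]), fun h => m02 (by rw [h])⟩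
    rw [hG, hG, hG, hG, crossRatio_smul, (y t).cross_eq hsep]
  simp only [coord_mk]
  constructor
  · filter_upwards [h1, hev] with t a1 a2
    rwa [a2]
  · rw [e]
    refine h2.congr' ?_
    filter_upwards [hev] with t a
    rw [a]

/-! ### Smooth curves and curves with two components -/

/-- The smooth curve with given positions of the labelled points. -/
def smoothCurve {S : Type*} (m : S → OnePoint ℂ) (hm : Function.Injective m)
    (hS : 3 ≤ Nat.card S) : StableCurve S where
  size := 1
  graph := ⊥
  isTree := ⟨⟨fun v w => by rw [Subsingleton.elim v w]⟩, by simp⟩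
  node h := absurd h (by simp)
  comp _ := 0
  mark := m
  node_inj h := absurd h (by simp)
  mark_inj _ h := hm h
  mark_ne_node _ _ h := absurd h (by simp)
  stable v := by
    have : {s : S | (0 : Fin 1) = v} = Set.univ := by
      ext s
      simp [Subsingleton.elim v 0]
    rw [this, Set.ncard_univ]
    omega

@[simp] theorem smoothCurve_pos {S : Type*} (m : S → OnePoint ℂ) (hm : Function.Injective m)
    (hS : 3 ≤ Nat.card S) (v) (s : S) : (smoothCurve m hm hS).pos v s = m s := by
  unfold StableCurve.pos
  rw [dif_pos]
  · rfl
  · exact Subsingleton.elim (α := Fin 1) _ _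

/-- The positions of labelled points and nodes on a curve with two components `0` and `1`, the
second of which carries the labels in `P`. -/
structure TwoComp {S : Type*} (P : Set S) where
  mark : S → OnePoint ℂ
  node : Fin 2 → OnePoint ℂ
  injOn : Set.InjOn mark P
  injOn_compl : Set.InjOn mark Pᶜ
  ne_node : ∀ s ∈ P, mark s ≠ node 1
  ne_node_compl : ∀ s ∉ P, mark s ≠ node 0
  two_le : 2 ≤ P.ncard
  two_le_compl : 2 ≤ Pᶜ.ncard

namespace TwoComp

open Classical in
/-- The curve with two components. -/
def curve {S : Type*} {P : Set S} (D : TwoComp P) : StableCurve S where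
  size := 2
  graph := ⊤
  isTree := by
    rw [SimpleGraph.isTree_iff_connected_and_card]
    refine ⟨SimpleGraph.connected_top, ?_⟩
    rw [Nat.card_eq_fintype_card, Nat.card_eq_fintype_card]
    rfl
  node {v _} _ := D.node v
  comp s := if s ∈ P then 1 else 0
  mark := D.mark
  node_inj {v w w'} h h' _ := by
    rw [SimpleGraph.top_adj] at h h'
    omega
  mark_inj {s s'} h h' := by
    by_cases hs : s ∈ P <;> by_cases hs' : s' ∈ P <;> simp [hs, hs'] at h
    · exact D.injOn hs hs' h'
    · exact D.injOn_compl hs hs' h'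
  mark_ne_node s w h := by
    by_cases hs : s ∈ P
    · simpa [hs] using D.ne_node s hs
    · simpa [hs] using D.ne_node_compl s hs
  stable v := by
    have h1 : {w | (⊤ : SimpleGraph (Fin 2)).Adj v w} = {1 - v} := by
      ext w
      simp only [SimpleGraph.top_adj, Set.mem_ofPred_eq, Set.mem_singleton_iff]
      revert v w
      decide
    rw [h1, Set.ncard_singleton]
    have h2 := D.two_le
    have h3 := D.two_le_compl
    fin_cases v
    · have : {s | (if s ∈ P then (1 : Fin 2) else 0) = 0} = Pᶜ := by
        ext s; by_cases hs : s ∈ P <;> simp [hs]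
      simp only [Fin.zero_eta]
      rw [this]
      omega
    · have : {s | (if s ∈ P then (1 : Fin 2) else 0) = 1} = P := by
        ext s; by_cases hs : s ∈ P <;> simp [hs]
      simp only [Fin.mk_one]
      rw [this]
      omega

variable {S : Type*} {P : Set S} (D : TwoComp P)

/-- The component that carries the labels outside of `P`. -/
def outer : Fin D.curve.size := (0 : Fin 2)

/-- The component that carries the labels in `P`. -/
def inner : Fin D.curve.size := (1 : Fin 2)

theorem comp_of_mem {s : S} (hs : s ∈ P) : D.curve.comp s = D.inner := by
  simp [curve, inner, hs]

theorem comp_of_notMem {s : S} (hs : s ∉ P) : D.curve.comp s = D.outer := by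
  simp [curve, outer, hs]

theorem outer_ne_inner : D.outer ≠ D.inner := by
  change (0 : Fin 2) ≠ 1
  decide

theorem pos_outer_of_mem {s : S} (hs : s ∈ P) : D.curve.pos D.outer s = D.node 0 := by
  unfold StableCurve.pos
  rw [dif_neg]
  · rfl
  · rw [D.comp_of_mem hs]
    exact D.outer_ne_inner

theorem pos_outer_of_notMem {s : S} (hs : s ∉ P) : D.curve.pos D.outer s = D.mark s := by
  unfold StableCurve.pos
  rw [dif_pos (D.comp_of_notMem hs).symm]
  rfl

theorem pos_inner_of_mem {s : S} (hs : s ∈ P) : D.curve.pos D.inner s = D.mark s := by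
  unfold StableCurve.pos
  rw [dif_pos (D.comp_of_mem hs).symm]
  rfl

theorem pos_inner_of_notMem {s : S} (hs : s ∉ P) : D.curve.pos D.inner s = D.node 1 := by
  unfold StableCurve.pos
  rw [dif_neg]
  · rfl
  · rw [D.comp_of_notMem hs]
    exact D.outer_ne_inner.symm

theorem eq_outer_or_inner (v : Fin D.curve.size) : v = D.outer ∨ v = D.inner := by
  change Fin 2 at v
  fin_cases v
  · exact Or.inl rfl
  · exact Or.inr rfl

theorem hasNode_iff {Q : Set S} : D.curve.HasNode Q ↔ Q = P ∨ Q = Pᶜ := by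
  have h0 : ∀ {w} (h : D.curve.graph.Adj D.outer w),
      {s | D.curve.pos D.outer s = D.curve.node h} = P := by
    intro w h
    ext s
    by_cases hs : s ∈ P
    · exact ⟨fun _ => hs, fun _ => D.pos_outer_of_mem hs⟩
    · refine ⟨fun e => ?_, fun e => absurd e hs⟩
      have e' : D.curve.pos D.outer s = D.node 0 := e
      rw [D.pos_outer_of_notMem hs] at e'
      exact absurd e' (D.ne_node_compl s hs)
  have h1 : ∀ {w} (h : D.curve.graph.Adj D.inner w),
      {s | D.curve.pos D.inner s = D.curve.node h} = Pᶜ := by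
    intro w h
    ext s
    by_cases hs : s ∈ P
    · refine ⟨fun e => ?_, fun e => absurd hs e⟩
      have e' : D.curve.pos D.inner s = D.node 1 := e
      rw [D.pos_inner_of_mem hs] at e'
      exact absurd e' (D.ne_node s hs)
    · exact ⟨fun _ => hs, fun _ => D.pos_inner_of_notMem hs⟩
  have hadj : D.curve.graph.Adj D.outer D.inner := by
    change (⊤ : SimpleGraph (Fin 2)).Adj 0 1
    simp
  constructor
  · rintro ⟨v, w, h, rfl⟩
    rcases D.eq_outer_or_inner v with rfl | rfl
    · exact Or.inl (h0 h)
    · exact Or.inr (h1 h)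
  · rintro (rfl | rfl)
    · exact ⟨_, _, hadj, (h0 hadj).symm⟩
    · exact ⟨_, _, hadj.symm, (h1 hadj.symm).symm⟩

end TwoComp

section

variable {S : Type*} [Fintype S] [DecidableEq S]

theorem TwoComp.mk_mem_boundaryDivisor {σ : StablePartition S} {P : Finset S}
    (hP : P ∈ σ.1.parts) (D : TwoComp (P : Set S)) :
    (Quot.mk _ D.curve : Mbar S) ∈ boundaryDivisor σ :=
  (mk_mem_boundaryDivisor_iff hP _).2 (D.hasNode_iff.2 (Or.inl rfl))

theorem TwoComp.eq_of_mk_mem_boundaryDivisor {σ τ : StablePartition S} {P : Finset S}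
    (hP : P ∈ σ.1.parts) (D : TwoComp (P : Set S))
    (h : (Quot.mk _ D.curve : Mbar S) ∈ boundaryDivisor τ) : σ = τ := by
  obtain ⟨Q, hQ⟩ := τ.exists_parts
  have hQτ : Q ∈ τ.1.parts := by simp [hQ]
  rw [mk_mem_boundaryDivisor_iff hQτ, D.hasNode_iff] at h
  rcases h with h | h
  · rw [Finset.coe_inj] at h
    subst h
    exact StablePartition.eq_of_mem hP hQτ
  · rw [← Finset.coe_compl, Finset.coe_inj] at h
    subst h
    exact StablePartition.eq_of_mem (σ.compl_mem hP) hQτ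

/-- A curve with two components carrying the two parts of a stable partition, in terms of
complex coordinates of the marks and of the outer node, the inner node being at infinity. -/
def twoCompOfInjective {σ : StablePartition S} {P : Finset S} (hP : P ∈ σ.1.parts)
    (z : Option S → ℂ) (hz : Set.InjOn (fun s => z (some s)) P)
    (hz' : Set.InjOn (fun s => z (some s)) (P : Set S)ᶜ) (h0 : ∀ s ∉ P, z (some s) ≠ z none) :
    TwoComp (P : Set S) where
  mark s := (z (some s) : OnePoint ℂ)
  node := ![(z none : OnePoint ℂ), ∞]
  injOn s hs s' hs' h := hz hs hs' (OnePoint.coe_injective h)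
  injOn_compl s hs s' hs' h := hz' hs hs' (OnePoint.coe_injective h)
  ne_node s _ := by simp
  ne_node_compl s hs h := h0 s hs (OnePoint.coe_injective h)
  two_le := by rw [Set.ncard_coe_finset]; exact σ.two_le_card hP
  two_le_compl := by
    rw [← Finset.coe_compl, Set.ncard_coe_finset]; exact σ.two_le_card (σ.compl_mem hP)

end

end ModuliZero

namespace ModuliZero

open Filter Topology

/-! ### Smoothing all nodes but one -/

namespace StableCurve

variable {S : Type*} (C : StableCurve S)

/-- Adjacent components on different sides of a node are the two components at the node. -/
theorem eq_of_adj_of_onSide {v w u u' : Fin C.size} (ha : C.graph.Adj u u')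
    (hu : C.OnSide v w u) (hu' : ¬ C.OnSide v w u') : u = w ∧ u' = v := by
  have hv : u' = v := by
    -- If neither component were `v`, each would be the first step from the other on the way to `v`,
    -- which is absurd for distances.
    by_contra hne
    have h1 : (C.path v u').snd ≠ (C.path v u).snd := by
      rw [hu.2]
      exact fun e => hu' ⟨Ne.symm hne, e⟩
    obtain ⟨-, h2⟩ := C.path_snd_eq hu.1 (Ne.symm hne) h1
    obtain ⟨-, h3⟩ := C.path_snd_eq (Ne.symm hne) hu.1 h1.symm
    rw [C.path_snd_of_adj ha] at h2
    rw [C.path_snd_of_adj ha.symm] at h3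
    have e1 := C.dist_snd_add_one hu.1.symm
    have e2 := C.dist_snd_add_one hne
    rw [← h2] at e1
    rw [← h3] at e2
    omega
  subst hv
  exact ⟨(C.path_snd_of_adj ha.symm).symm.trans hu.2, rfl⟩

/-- The polynomial in `t` that describes, in the coordinate of the component `u`, the position of
the label `s` after smoothing the nodes, by gluing in the coordinate of each component on the way
to `s` scaled by `t` (or left out if the coefficient `κ` vanishes). The number of steps is `k`. -/
def series (p : Fin C.size → S → ℂ) (κ : Fin C.size → Fin C.size → ℂ) :
    ℕ → Fin C.size → S → ℂ → ℂ
  | 0, u, s, _ => p u s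
  | k + 1, u, s, t => p u s + κ u (C.path u (C.comp s)).snd * t *
      series p κ k (C.path u (C.comp s)).snd s t

theorem continuous_series (p : Fin C.size → S → ℂ) (κ : Fin C.size → Fin C.size → ℂ) (k : ℕ)
    (u : Fin C.size) (s : S) : Continuous (C.series p κ k u s) := by
  induction k generalizing u with
  | zero => exact continuous_const
  | succ k ih =>
    have := ih (C.path u (C.comp s)).snd
    change Continuous fun t => p u s + κ u (C.path u (C.comp s)).snd * t *
      C.series p κ k (C.path u (C.comp s)).snd s t
    fun_prop

theorem series_zero (p : Fin C.size → S → ℂ) (κ : Fin C.size → Fin C.size → ℂ) (k : ℕ)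
    (u : Fin C.size) (s : S) : C.series p κ k u s 0 = p u s := by
  cases k <;> simp [series]

/-- The position of the label `s` in the coordinate of the component `u` after smoothing. -/
def smoothing (p : Fin C.size → S → ℂ) (κ : Fin C.size → Fin C.size → ℂ) (u : Fin C.size) (s : S) :
    ℂ → ℂ :=
  C.series p κ (C.graph.dist u (C.comp s)) u s

theorem tendsto_smoothing (p : Fin C.size → S → ℂ) (κ : Fin C.size → Fin C.size → ℂ)
    (u : Fin C.size) (s : S) : Tendsto (C.smoothing p κ u s) (𝓝[≠] 0) (𝓝 (p u s)) := by
  have := (C.continuous_series p κ (C.graph.dist u (C.comp s)) u s).tendsto 0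
  rw [series_zero] at this
  exact this.mono_left nhdsWithin_le_nhds

theorem smoothing_eq (p : Fin C.size → S → ℂ) (κ : Fin C.size → Fin C.size → ℂ)
    {u w : Fin C.size} {s : S} (h : C.OnSide u w (C.comp s)) (t : ℂ) :
    C.smoothing p κ u s t = p u s + κ u w * t * C.smoothing p κ w s t := by
  obtain ⟨h1, rfl⟩ := h
  unfold smoothing
  rw [← C.dist_snd_add_one h1]
  rfl

/-- The component next to `u` on the way to `v`. -/
def parent {u v : Fin C.size} (_ : u ≠ v) : Fin C.size := (C.path u v).snd

theorem adj_parent {u v : Fin C.size} (h : u ≠ v) : C.graph.Adj u (C.parent h) :=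
  SimpleGraph.Walk.adj_snd (C.path_not_nil h)

theorem parent_of_adj {u v : Fin C.size} (h : C.graph.Adj u v) : C.parent h.ne = v :=
  C.path_snd_of_adj h

section

variable {v₀ : Fin C.size} {g : Fin C.size → GL (Fin 2) ℂ}

/-- The coordinate of `u` has the direction of the root `v₀` at infinity, so the finite labels are
those beyond the node leading from the parent to `u`. -/
theorem smul_pos_ne_infty_iff
    (hg : ∀ u (hu : u ≠ v₀), g u • C.toward hu = ∞) {u : Fin C.size} (hu : u ≠ v₀) {s : S} :
    g u • C.pos u s ≠ ∞ ↔ s ∈ C.behind (C.adj_parent hu).symm := by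
  rw [mem_behind_symm_iff, ← hg u hu]
  exact ((MulAction.injective (g u)).eq_iff).not

/-- A label beyond `u` is seen from the parent in the direction of `u`, which is not the direction
of the root. -/
theorem smul_pos_parent_ne_infty (hroot : ∀ s, g v₀ • C.pos v₀ s ≠ ∞)
    (hg : ∀ u (hu : u ≠ v₀), g u • C.toward hu = ∞) {u : Fin C.size} (hu : u ≠ v₀) {s : S}
    (hs : g u • C.pos u s ≠ ∞) : g (C.parent hu) • C.pos (C.parent hu) s ≠ ∞ := by
  rw [C.smul_pos_ne_infty_iff hg hu] at hs
  by_cases hw : C.parent hu = v₀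
  · have := hroot s
    rw [← hw] at this
    exact this
  · rw [← hg _ hw]
    refine (MulAction.injective _).ne fun e => ?_
    have e1 : C.node (C.adj_parent hu).symm = C.node (C.adj_parent hw) := Eq.trans (Eq.symm hs) e
    have e2 : u = C.parent hw := C.node_inj _ _ e1
    have d1 := C.dist_snd_add_one hu
    have d2 := C.dist_snd_add_one hw
    change C.graph.dist (C.parent hu) v₀ + 1 = _ at d1
    change C.graph.dist (C.parent hw) v₀ + 1 = _ at d2
    rw [← e2] at d2
    omega

/-- The expansion of the smoothing around each component. -/
theorem exists_smoothing_expansion [Finite S] (hroot : ∀ s, g v₀ • C.pos v₀ s ≠ ∞)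
    (hg : ∀ u (hu : u ≠ v₀), g u • C.toward hu = ∞)
    {κ : Fin C.size → Fin C.size → ℂ} {r : Fin C.size}
    {A : Fin C.size → Prop}
    (hA : ∀ u, A u → u = r ∨ ∃ hu : u ≠ v₀, A (C.parent hu) ∧ κ (C.parent hu) u = 1)
    {u : Fin C.size} (hu : A u) :
    ∃ (c : ℂ → ℂ) (d : ℕ), ∀ s, g r • C.pos r s ≠ ∞ →
      (g u • C.pos u s ≠ ∞ → ∀ t, C.smoothing (fun u s => finPart (g u • C.pos u s)) κ r s t =
        c t + t ^ d * C.smoothing (fun u s => finPart (g u • C.pos u s)) κ u s t) ∧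
      (g u • C.pos u s = ∞ → Tendsto (fun t =>
        (C.smoothing (fun u s => finPart (g u • C.pos u s)) κ r s t - c t) / t ^ d)
          (𝓝[≠] 0) (Bornology.cobounded ℂ)) := by
  set p : Fin C.size → S → ℂ := fun u s => finPart (g u • C.pos u s) with hp
  obtain ⟨m, hm⟩ : ∃ m, C.graph.dist u v₀ = m := ⟨_, rfl⟩
  have hdiv : ∀ {f : ℂ → ℂ} {a : ℂ}, a ≠ 0 → Tendsto f (𝓝[≠] 0) (𝓝 a) →
      Tendsto (fun t => f t / t) (𝓝[≠] 0) (Bornology.cobounded ℂ) := by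
    intro f a ha hf
    rw [← tendsto_norm_atTop_iff_cobounded]
    have h1 : Tendsto (fun t : ℂ => ‖t⁻¹‖) (𝓝[≠] 0) atTop :=
      tendsto_norm_atTop_iff_cobounded.2 tendsto_inv₀_nhdsNE_zero
    refine (hf.norm.pos_mul_atTop (norm_pos_iff.2 ha) h1).congr fun t => ?_
    rw [← norm_mul, div_eq_mul_inv]
  have hdiv' : ∀ {f : ℂ → ℂ} (a : ℂ), Tendsto f (𝓝[≠] 0) (Bornology.cobounded ℂ) →
      Tendsto (fun t => (f t - a) / t) (𝓝[≠] 0) (Bornology.cobounded ℂ) := by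
    intro f a hf
    rw [← tendsto_norm_atTop_iff_cobounded] at hf ⊢
    have h1 : Tendsto (fun t => ‖f t‖ + -‖a‖) (𝓝[≠] 0) atTop :=
      tendsto_atTop_add_const_right _ _ hf
    have h2 : Tendsto (fun t : ℂ => ‖t⁻¹‖) (𝓝[≠] 0) atTop :=
      tendsto_norm_atTop_iff_cobounded.2 tendsto_inv₀_nhdsNE_zero
    refine tendsto_atTop_mono (fun t => ?_) (h1.atTop_mul_atTop₀ h2)
    rw [div_eq_mul_inv, norm_mul]
    refine mul_le_mul_of_nonneg_right ?_ (norm_nonneg _)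
    have := norm_sub_norm_le (f t) a
    linarith
  -- Induction on the distance from the root `v₀`. It may end early at the component `r`, where the
  -- expansion is trivial.
  induction m generalizing u with
  | zero =>
    rcases hA u hu with rfl | ⟨hne, -⟩
    · exact ⟨fun _ => 0, 0, fun s hs => ⟨fun _ t => by simp, fun h => absurd h hs⟩⟩
    · exact absurd (C.isTree.connected.dist_eq_zero_iff.1 hm) hne
  | succ m ih =>
    rcases hA u hu with rfl | ⟨hne, hpar, hκ⟩
    · exact ⟨fun _ => 0, 0, fun s hs => ⟨fun _ t => by simp, fun h => absurd h hs⟩⟩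
    have hd : C.graph.dist (C.parent hne) v₀ = m := by
      have : C.graph.dist (C.parent hne) v₀ + 1 = _ := C.dist_snd_add_one hne
      omega
    obtain ⟨c, d, hcd⟩ := ih hpar hd
    set w := C.parent hne with hw
    have hwu : C.graph.Adj w u := (C.adj_parent hne).symm
    let a : ℂ := finPart (g w • C.node hwu)
    -- For a label beyond `u`, gluing gives `a + t * (position on u)` on `w`, where `a` is the node.
    -- Substitution into the expansion at `w` moves the centre and raises the exponent by one.
    refine ⟨fun t => c t + t ^ d * a, d + 1, fun s hs => ⟨fun h t => ?_, fun h => ?_⟩⟩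
    · have hb := (C.smul_pos_ne_infty_iff hg hne).1 h
      rw [(hcd s hs).1 (C.smul_pos_parent_ne_infty hroot hg hne h) t,
        C.smoothing_eq p κ ((C.mem_behind_iff hwu).1 hb), hκ]
      have : p w s = a := by
        simp only [hp, a]
        rw [show C.pos w s = C.node hwu from hb]
      rw [this]
      ring
    · have hb : s ∉ C.behind hwu := fun e => (C.smul_pos_ne_infty_iff hg hne).2 e h
      -- A label not beyond `u` either already goes to infinity on the scale of `w`, and another
      -- division by `t` does not change this, or its limit on `w` is finite and differs from the
      -- node `a`, so that the difference divided by `t` diverges.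
      by_cases hws : g w • C.pos w s = ∞
      · refine (hdiv' a ((hcd s hs).2 hws)).congr' ?_
        filter_upwards [self_mem_nhdsWithin] with t ht
        have ht0 : t ≠ 0 := ht
        field_simp
        ring
      · have hnode : g w • C.node hwu ≠ ∞ := by
          obtain ⟨s', hs'⟩ : (C.behind hwu).Nonempty := by
            have := C.two_le_ncard_behind hwu
            exact Set.nonempty_of_ncard_ne_zero (by omega)
          have h1 := C.smul_pos_parent_ne_infty hroot hg hne
            ((C.smul_pos_ne_infty_iff hg hne).2 hs')
          rwa [show C.pos _ s' = C.node hwu from hs'] at h1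
        have hpa : p w s - a ≠ 0 := by
          intro e
          have e' : p w s = a := sub_eq_zero.1 e
          have e2 : g w • C.pos w s = g w • C.node hwu := by
            rw [← coe_finPart hws, ← coe_finPart hnode]
            exact congrArg _ e'
          exact hb (MulAction.injective _ e2)
        refine (hdiv hpa ((C.tendsto_smoothing p κ w s).sub_const a)).congr' ?_
        filter_upwards [self_mem_nhdsWithin] with t ht
        have ht0 : t ≠ 0 := ht
        rw [(hcd s hs).1 hws t]
        field_simp
        ring

theorem exists_hasLimit_smoothing [Finite S] (hroot : ∀ s, g v₀ • C.pos v₀ s ≠ ∞)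
    (hg : ∀ u (hu : u ≠ v₀), g u • C.toward hu = ∞)
    {κ : Fin C.size → Fin C.size → ℂ} {r : Fin C.size}
    {A : Fin C.size → Prop}
    (hA : ∀ u, A u → u = r ∨ ∃ hu : u ≠ v₀, A (C.parent hu) ∧ κ (C.parent hu) u = 1)
    {u : Fin C.size} (hu : A u) :
    ∃ (c : ℂ → ℂ) (d : ℕ), ∀ s, g r • C.pos r s ≠ ∞ → HasLimit (𝓝[≠] 0) (fun t =>
      (((C.smoothing (fun u s => finPart (g u • C.pos u s)) κ r s t - c t) / t ^ d : ℂ) :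
        OnePoint ℂ)) (g u • C.pos u s) := by
  obtain ⟨c, d, h⟩ := C.exists_smoothing_expansion hroot hg hA hu
  refine ⟨c, d, fun s hs => ?_⟩
  by_cases hus : g u • C.pos u s = ∞
  · rw [hus]
    exact HasLimit.of_cobounded ((h s hs).2 hus)
  · rw [← coe_finPart hus]
    refine HasLimit.of_tendsto ?_
    refine (C.tendsto_smoothing (fun u s => finPart (g u • C.pos u s)) κ u s).congr' ?_
    filter_upwards [self_mem_nhdsWithin] with t ht
    have ht0 : t ≠ 0 := ht
    rw [(h s hs).1 hus t]
    field_simp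
    ring

end

/-- The labels occupy only finitely many directions at the root, so some point is left to be sent to
infinity. On any other component the node toward the root is sent there. -/
theorem exists_normalization [Finite S] (v₀ : Fin C.size) : ∃ g : Fin C.size → GL (Fin 2) ℂ,
    (∀ s, g v₀ • C.pos v₀ s ≠ ∞) ∧ ∀ u (hu : u ≠ v₀), g u • C.toward hu = ∞ := by
  classical
  obtain ⟨p, hp⟩ : ∃ p : OnePoint ℂ, p ∉ Set.range (C.pos v₀) := by
    have hinf : Infinite (OnePoint ℂ) := Infinite.of_injective _ OnePoint.coe_injective
    exact (Set.finite_range (C.pos v₀)).exists_notMem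
  choose G hG using fun p : OnePoint ℂ => exists_smul_eq_infty p
  refine ⟨fun u => if hu : u = v₀ then G p else G (C.toward hu), fun s h => ?_, fun u hu => ?_⟩
  · simp only [dite_true] at h
    rw [← hG p] at h
    exact hp ⟨s, MulAction.injective _ h⟩
  · simp only [dif_neg hu]
    exact hG _

end StableCurve

section

variable {S : Type*} [Fintype S] [DecidableEq S]

/-- The curves with two components that carry the labels in `P` and its complement, all marks and
the outer node being finite, and the inner node infinite. -/
def twoCompSet {σ : StablePartition S} {P : Finset S} (hP : P ∈ σ.1.parts) : Set (Mbar S) :=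
  {x | ∃ z hz hz' h0, Quot.mk _ (twoCompOfInjective hP z hz hz' h0).curve = x}

/-- All nodes except the one that belongs to `σ` are smoothed simultaneously with one parameter `t`.
The result has two components carrying the parts of `σ`, and it degenerates to the given curve as
`t` tends to `0`. -/
theorem boundaryDivisor_subset_closure {σ : StablePartition S} {P : Finset S}
    (hP : P ∈ σ.1.parts) : boundaryDivisor σ ⊆ closure (twoCompSet hP) := by
  classical
  rintro ⟨C⟩ hC
  obtain ⟨v₀, w₀, h, hPb⟩ := (mk_mem_boundaryDivisor_iff hP C).1 hC
  change (P : Set S) = C.behind h at hPb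
  have hmem : ∀ s, s ∈ P ↔ s ∈ C.behind h := fun s => by rw [← hPb, Finset.mem_coe]
  obtain ⟨g, hroot, hg⟩ := C.exists_normalization v₀
  -- The gluing is omitted at the chosen node only. In the coordinate of `v₀` the labels of `P` then
  -- stay at this node for all `t`, so the two sides are smoothed independently.
  let κ : Fin C.size → Fin C.size → ℂ := fun u u' => if u = v₀ ∧ u' = w₀ then 0 else 1
  set Y := C.smoothing (fun u s => finPart (g u • C.pos u s)) κ with hY
  let z : ℂ → Option S → ℂ := fun t o => o.elim (finPart (g v₀ • C.node h))
    fun s => if s ∈ P then Y w₀ s t else Y v₀ s t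
  -- the positions on the two components
  let pA : ℂ → S → OnePoint ℂ := fun t s => (Y v₀ s t : OnePoint ℂ)
  let pB : ℂ → S → OnePoint ℂ := fun t s => if s ∈ P then (Y w₀ s t : OnePoint ℂ) else ∞
  have hYP : ∀ s ∈ P, ∀ t, Y v₀ s t = finPart (g v₀ • C.node h) := by
    intro s hs t
    have hb := (hmem s).1 hs
    rw [hY, C.smoothing_eq _ κ ((C.mem_behind_iff h).1 hb)]
    simp only [κ, and_self, if_true, zero_mul, add_zero]
    rw [show C.pos v₀ s = C.node h from hb]
  have hw₀ : w₀ ≠ v₀ := h.ne.symm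
  have hparw : C.parent hw₀ = v₀ := C.parent_of_adj h.symm
  -- Every component of `C` is a limit of affine rescalings of the outer or of the inner component,
  -- according to its side of the node.
  have hside : ∀ u, ∃ f : S → ℂ → OnePoint ℂ,
      (∀ s, HasLimit (𝓝[≠] 0) (f s) (g u • C.pos u s)) ∧
      ((¬ C.OnSide v₀ w₀ u ∧ ∀ t, t ≠ 0 → ∃ G : GL (Fin 2) ℂ, ∀ s, f s t = G • pA t s) ∨
       (C.OnSide v₀ w₀ u ∧ ∀ t, t ≠ 0 → ∃ G : GL (Fin 2) ℂ, ∀ s, f s t = G • pB t s)) := by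
    intro u
    by_cases hu : C.OnSide v₀ w₀ u
    · obtain ⟨c, d, hcd⟩ := C.exists_hasLimit_smoothing hroot hg (κ := κ) (r := w₀)
        (A := C.OnSide v₀ w₀) (fun u hu => by
          by_cases huw : u = w₀
          · exact Or.inl huw
          · refine Or.inr ⟨hu.1.symm, ?_, ?_⟩
            · by_contra hn
              exact huw (C.eq_of_adj_of_onSide (C.adj_parent hu.1.symm) hu hn).1
            · simp only [κ, huw, and_false, if_false]) hu
      refine ⟨fun s t => if s ∈ P then (((Y w₀ s t - c t) / t ^ d : ℂ) : OnePoint ℂ) else ∞,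
        fun s => ?_, Or.inr ⟨hu, fun t ht => ?_⟩⟩
      · by_cases hs : s ∈ P
        · simp only [hs, if_true]
          refine hcd s ?_
          rw [C.smul_pos_ne_infty_iff hg hw₀, StableCurve.mem_behind_iff, hparw,
            ← StableCurve.mem_behind_iff _ h]
          exact (hmem s).1 hs
        · simp only [hs, if_false]
          rw [C.pos_eq_toward h hu (fun e => hs ((hmem s).2 e)), hg]
          exact HasLimit.const _
      · obtain ⟨G, h1, h2⟩ := exists_smul_affine (c t) (pow_ne_zero d ht)
        refine ⟨G, fun s => ?_⟩
        by_cases hs : s ∈ P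
        · simp only [pB, hs, if_true, h2]
        · simp only [pB, hs, if_false, h1]
    · obtain ⟨c, d, hcd⟩ := C.exists_hasLimit_smoothing hroot hg (κ := κ) (r := v₀)
        (A := fun u => ¬ C.OnSide v₀ w₀ u) (fun u hu => by
          by_cases huv : u = v₀
          · exact Or.inl huv
          · refine Or.inr ⟨huv, fun hn => ?_, ?_⟩
            · exact huv (C.eq_of_adj_of_onSide (C.adj_parent huv).symm hn hu).2
            · have : u ≠ w₀ := by
                rintro rfl
                exact hu (C.onSide_self h)
              simp only [κ, this, and_false, if_false]) hu
      refine ⟨fun s t => (((Y v₀ s t - c t) / t ^ d : ℂ) : OnePoint ℂ),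
        fun s => hcd s (hroot s), Or.inl ⟨hu, fun t ht => ?_⟩⟩
      obtain ⟨G, h1, h2⟩ := exists_smul_affine (c t) (pow_ne_zero d ht)
      exact ⟨G, fun s => by simp only [pA, h2]⟩
  choose f hf hfG using hside
  have hne0 : ∀ᶠ t : ℂ in 𝓝[≠] 0, t ≠ 0 := self_mem_nhdsWithin
  have hsep : ∀ u i j, C.pos u i ≠ C.pos u j → ∀ᶠ t in 𝓝[≠] (0 : ℂ), f u i t ≠ f u j t :=
    fun u i j hij => (hf u i).eventually_ne (hf u j) ((MulAction.injective (g u)).ne hij)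
  have hpA : ∀ i j, i ≠ j → i ∉ P → ∀ᶠ t in 𝓝[≠] (0 : ℂ), Y v₀ i t ≠ Y v₀ j t := by
    intro i j hij hi
    -- The label `k` is chosen such that `i` and one of `j, k` lie outside of `P`. Those two look
    -- the same from beyond the node, so the component that separates `i, j, k` is on the outer
    -- side.
    obtain ⟨k, hik, hjk, hk⟩ : ∃ k, i ≠ k ∧ j ≠ k ∧ (j ∉ P ∨ k ∉ P) := by
      by_cases hj : j ∈ P
      · obtain ⟨k, hk, hki⟩ := Finset.exists_mem_ne (σ.two_le_card (σ.compl_mem hP)) i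
        rw [Finset.mem_compl] at hk
        exact ⟨k, hki.symm, fun e => hk (e ▸ hj), Or.inr hk⟩
      · obtain ⟨k, hk⟩ := Finset.card_pos.1 (lt_of_lt_of_le two_pos (σ.two_le_card hP))
        exact ⟨k, fun e => hi (e ▸ hk), fun e => hj (e ▸ hk), Or.inl hj⟩
    obtain ⟨u, hu⟩ := C.exists_separates hij hjk hik
    have hu' : ¬ C.OnSide v₀ w₀ u := by
      intro hs
      rcases hk with hk | hk
      · exact hu.1 (C.pos_eq_pos_of_notMem h hs (fun e => hi ((hmem _).2 e))
          (fun e => hk ((hmem _).2 e)))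
      · exact hu.2.2 (C.pos_eq_pos_of_notMem h hs (fun e => hi ((hmem _).2 e))
          (fun e => hk ((hmem _).2 e)))
    filter_upwards [hsep u i j hu.1, hne0] with t ht ht0 e
    rcases hfG u with ⟨-, hG⟩ | ⟨hs, -⟩
    · obtain ⟨G, hG⟩ := hG t ht0
      exact ht (by rw [hG, hG]; simp only [pA, e])
    · exact hu' hs
  have hpB : ∀ i j, i ≠ j → i ∈ P → j ∈ P → ∀ᶠ t in 𝓝[≠] (0 : ℂ), Y w₀ i t ≠ Y w₀ j t := by
    intro i j hij hi hj
    obtain ⟨k, hk⟩ := Finset.card_pos.1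
      (lt_of_lt_of_le two_pos (σ.two_le_card (σ.compl_mem hP)))
    rw [Finset.mem_compl] at hk
    obtain ⟨u, hu⟩ := C.exists_separates (k := k) hij (fun e => hk (e ▸ hj)) (fun e => hk (e ▸ hi))
    have hu' : C.OnSide v₀ w₀ u := by
      by_contra hs
      exact hu.1 (C.pos_eq_pos_of_mem h hs ((hmem _).1 hi) ((hmem _).1 hj))
    filter_upwards [hsep u i j hu.1, hne0] with t ht ht0 e
    rcases hfG u with ⟨hs, -⟩ | ⟨-, hG⟩
    · exact hs hu'
    · obtain ⟨G, hG⟩ := hG t ht0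
      exact ht (by rw [hG, hG]; simp only [pB, e, hi, hj, if_true])
  have hpA' : ∀ᶠ t in 𝓝[≠] (0 : ℂ), ∀ i j, i ≠ j → i ∉ P → Y v₀ i t ≠ Y v₀ j t := by
    simp only [eventually_all]
    exact hpA
  have hpB' : ∀ᶠ t in 𝓝[≠] (0 : ℂ), ∀ i j, i ≠ j → i ∈ P → j ∈ P → Y w₀ i t ≠ Y w₀ j t := by
    simp only [eventually_all]
    exact hpB
  refine mk_mem_closure_of_hasLimit g f hf ?_
  filter_upwards [hpA', hpB', hne0] with t htA htB ht0
  have zP : ∀ s ∈ P, z t (some s) = Y w₀ s t := fun s hs => by simp [z, hs]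
  have zP' : ∀ s ∉ P, z t (some s) = Y v₀ s t := fun s hs => by simp [z, hs]
  have hz : Set.InjOn (fun s => z t (some s)) P := by
    intro i hi j hj e
    by_contra hij
    refine htB i j hij hi hj ?_
    rw [← zP i hi, ← zP j hj]
    exact e
  have hz' : Set.InjOn (fun s => z t (some s)) (P : Set S)ᶜ := by
    intro i hi j hj e
    by_contra hij
    refine htA i j hij hi ?_
    rw [← zP' i hi, ← zP' j hj]
    exact e
  have h0 : ∀ s ∉ P, z t (some s) ≠ z t none := by
    intro i hi
    obtain ⟨k, hk⟩ := Finset.card_pos.1 (lt_of_lt_of_le two_pos (σ.two_le_card hP))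
    have := htA i k (fun e => hi (e ▸ hk)) hi
    rw [hYP k hk] at this
    rwa [zP' i hi]
  refine ⟨(twoCompOfInjective hP (z t) hz hz' h0).curve, ⟨z t, hz, hz', h0, rfl⟩, fun u => ?_⟩
  set D := twoCompOfInjective hP (z t) hz hz' h0 with hD
  rcases hfG u with ⟨-, hG⟩ | ⟨-, hG⟩
  · obtain ⟨G, hG⟩ := hG t ht0
    refine ⟨D.outer, G, fun s => ?_⟩
    rw [hG]
    congr 1
    by_cases hs : s ∈ P
    · rw [D.pos_outer_of_mem hs]
      simp only [pA, hYP s hs]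
      rfl
    · rw [D.pos_outer_of_notMem hs]
      change _ = ((z t (some s) : ℂ) : OnePoint ℂ)
      rw [zP' s hs]
  · obtain ⟨G, hG⟩ := hG t ht0
    refine ⟨D.inner, G, fun s => ?_⟩
    rw [hG]
    congr 1
    by_cases hs : s ∈ P
    · rw [D.pos_inner_of_mem hs]
      change _ = ((z t (some s) : ℂ) : OnePoint ℂ)
      simp only [pB, hs, if_true, zP s hs]
    · rw [D.pos_inner_of_notMem hs]
      simp only [pB, hs, if_false]
      rfl

theorem closure_twoCompSet {σ : StablePartition S} {P : Finset S} (hP : P ∈ σ.1.parts) :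
    closure (twoCompSet hP) = boundaryDivisor σ := by
  refine Set.Subset.antisymm ?_ (boundaryDivisor_subset_closure hP)
  refine closure_minimal ?_ (isClosed_boundaryDivisor σ)
  rintro _ ⟨z, hz, hz', h0, rfl⟩
  exact TwoComp.mk_mem_boundaryDivisor hP _

end

end ModuliZero

namespace ModuliZero

open Filter Topology

/-! ### Density of the open stratum -/

theorem smoothCurve_mem_openStratum {S : Type*} {m : S → OnePoint ℂ} (hm : Function.Injective m)
    (hS : 3 ≤ Nat.card S) : Quot.mk _ (smoothCurve m hm hS) ∈ openStratum S := by
  intro q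
  obtain ⟨v, hv⟩ := (smoothCurve m hm hS).exists_separates (i := q 0) (j := q 1) (k := q 2)
      (by simp) (by simp) (by simp)
  rw [coord_mk, Ne, StableCurve.cross_eq_infty_iff _ hv, smoothCurve_pos, smoothCurve_pos]
  exact fun h => absurd (q.injective (hm h)) (by decide)

theorem coord_smoothCurve {S : Type*} {m : S → OnePoint ℂ} (hm : Function.Injective m)
    (hS : 3 ≤ Nat.card S) (q : Fin 4 ↪ S) : coord q (Quot.mk _ (smoothCurve m hm hS)) =
      crossRatio (m (q 0)) (m (q 1)) (m (q 2)) (m (q 3)) := by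
  obtain ⟨v, hv⟩ := (smoothCurve m hm hS).exists_separates (i := q 0) (j := q 1) (k := q 2)
      (by simp) (by simp) (by simp)
  rw [coord_mk, StableCurve.cross_eq _ hv]
  simp only [smoothCurve_pos]

section

variable {S : Type*} [Fintype S] [DecidableEq S]

/-- The last node is smoothed by shrinking the inner component by the factor `t` and inserting it at
the outer node. Magnified around the node, the inner labels are recovered and the outer ones go to
infinity. -/
theorem twoCompSet_subset_closure {σ : StablePartition S} {P : Finset S} (hP : P ∈ σ.1.parts) :
    twoCompSet hP ⊆ closure (openStratum S) := by
  classical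
  rintro _ ⟨z, hz, hz', h0, rfl⟩
  have hS : 3 ≤ Nat.card S := by
    have h1 := σ.two_le_card hP
    have h2 := σ.two_le_card (σ.compl_mem hP)
    rw [Finset.card_compl] at h2
    rw [Nat.card_eq_fintype_card]
    omega
  set D := twoCompOfInjective hP z hz hz' h0 with hD
  let y : ℂ → S → ℂ := fun t s => if s ∈ P then z none + t * z (some s) else z (some s)
  have hne0 : ∀ᶠ t : ℂ in 𝓝[≠] 0, t ≠ 0 := self_mem_nhdsWithin
  have hlim : ∀ s, Tendsto (fun t => z none + t * z (some s)) (𝓝[≠] 0) (𝓝 (z none)) := by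
    intro s
    have : Continuous fun t : ℂ => z none + t * z (some s) := by fun_prop
    have := this.tendsto 0
    rw [zero_mul, add_zero] at this
    exact this.mono_left nhdsWithin_le_nhds
  have hinj : ∀ᶠ t in 𝓝[≠] (0 : ℂ), Function.Injective (y t) := by
    have hmix : ∀ᶠ t in 𝓝[≠] (0 : ℂ), ∀ i ∉ P, ∀ j, z none + t * z (some j) ≠ z (some i) := by
      simp only [eventually_all]
      exact fun i hi j => (hlim j).eventually_ne (h0 i hi).symm
    filter_upwards [hmix, hne0] with t ht ht0 i j hij
    by_cases hi : i ∈ P <;> by_cases hj : j ∈ P <;> simp only [y, hi, hj, if_true, if_false] at hij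
    · exact hz hi hj (mul_left_cancel₀ ht0 (add_left_cancel hij))
    · exact absurd hij (ht j hj i)
    · exact absurd hij.symm (ht i hi j)
    · exact hz' hi hj hij
  let f : Fin D.curve.size → S → ℂ → OnePoint ℂ := fun u s t =>
    if u = D.outer then (y t s : OnePoint ℂ) else (((y t s - z none) / t : ℂ) : OnePoint ℂ)
  refine mk_mem_closure_of_hasLimit (l := 𝓝[≠] (0 : ℂ)) (fun _ => 1) f (fun u s => ?_) ?_
  · rw [one_smul]
    rcases D.eq_outer_or_inner u with rfl | rfl
    · simp only [f, if_true]
      by_cases hs : s ∈ P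
      · rw [D.pos_outer_of_mem hs]
        simp only [y, hs, if_true]
        exact HasLimit.of_tendsto (hlim s)
      · rw [D.pos_outer_of_notMem hs]
        simp only [y, hs, if_false]
        exact HasLimit.const _
    · simp only [f, D.outer_ne_inner.symm, if_false]
      by_cases hs : s ∈ P
      · rw [D.pos_inner_of_mem hs]
        refine (HasLimit.const (l := 𝓝[≠] (0 : ℂ)) (z (some s) : OnePoint ℂ)).congr' ?_
        filter_upwards [hne0] with t ht
        simp only [y, hs, if_true]
        rw [add_sub_cancel_left, mul_div_cancel_left₀ _ ht]
      · rw [D.pos_inner_of_notMem hs]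
        simp only [y, hs, if_false]
        refine HasLimit.of_cobounded ?_
        rw [← tendsto_norm_atTop_iff_cobounded]
        have h1 : Tendsto (fun t : ℂ => ‖t⁻¹‖) (𝓝[≠] 0) atTop :=
          tendsto_norm_atTop_iff_cobounded.2 tendsto_inv₀_nhdsNE_zero
        refine (h1.const_mul_atTop (norm_pos_iff.2 (sub_ne_zero.2 (h0 s hs)))).congr fun t => ?_
        rw [← norm_mul, div_eq_mul_inv]
  · filter_upwards [hinj, hne0] with t ht ht0
    have hm : Function.Injective (fun s => (y t s : OnePoint ℂ)) := OnePoint.coe_injective.comp ht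
    refine ⟨smoothCurve _ hm hS, smoothCurve_mem_openStratum hm hS, fun u => ?_⟩
    rcases D.eq_outer_or_inner u with rfl | rfl
    · refine ⟨(smoothCurve _ hm hS).isTree.connected.nonempty.some, 1, fun s => ?_⟩
      rw [one_smul, smoothCurve_pos]
      simp only [f, if_true]
    · obtain ⟨G, -, hG⟩ := exists_smul_affine (z none) ht0
      refine ⟨(smoothCurve _ hm hS).isTree.connected.nonempty.some, G, fun s => ?_⟩
      rw [smoothCurve_pos, hG]
      simp only [f, D.outer_ne_inner.symm, if_false]

theorem dense_openStratum : Dense (openStratum S) := by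
  intro x
  by_cases hx : x ∈ openStratum S
  · exact subset_closure hx
  · obtain ⟨σ, hσ⟩ := exists_mem_boundaryDivisor hx
    obtain ⟨P, hP⟩ := σ.exists_parts
    have hPσ : P ∈ σ.1.parts := by simp [hP]
    have := boundaryDivisor_subset_closure hPσ hσ
    exact closure_minimal (twoCompSet_subset_closure hPσ) isClosed_closure this

end

/-! ### Values of rational functions -/

section HasValue

variable {ι : Type*}

/-- The graph of the evaluation at the point `z` of rational functions that are defined at `z`. -/
def valueGraph (z : ι → ℂ) : Subalgebra ℂ (FractionRing (MvPolynomial ι ℂ) × ℂ) where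
  carrier := {f | ∃ A B : MvPolynomial ι ℂ, MvPolynomial.eval z B ≠ 0 ∧
    f.1 = algebraMap _ _ A / algebraMap _ _ B ∧ f.2 = MvPolynomial.eval z A / MvPolynomial.eval z B}
  mul_mem' := by
    rintro ⟨f, c⟩ ⟨f', c'⟩ ⟨A, B, h0, h1, h2⟩ ⟨A', B', h0', h1', h2'⟩
    refine ⟨A * A', B * B', by simp [h0, h0'], ?_, ?_⟩
    · simp only [Prod.mk_mul_mk] at h1 h1' ⊢
      rw [h1, h1', map_mul, map_mul, div_mul_div_comm]
    · simp only [Prod.mk_mul_mk] at h2 h2' ⊢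
      rw [h2, h2', map_mul, map_mul, div_mul_div_comm]
  add_mem' := by
    rintro ⟨f, c⟩ ⟨f', c'⟩ ⟨A, B, h0, h1, h2⟩ ⟨A', B', h0', h1', h2'⟩
    have hB : algebraMap (MvPolynomial ι ℂ) (FractionRing (MvPolynomial ι ℂ)) B ≠ 0 := by
      simp only [ne_eq, FaithfulSMul.algebraMap_eq_zero_iff]
      rintro rfl
      simp at h0
    have hB' : algebraMap (MvPolynomial ι ℂ) (FractionRing (MvPolynomial ι ℂ)) B' ≠ 0 := by
      simp only [ne_eq, FaithfulSMul.algebraMap_eq_zero_iff]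
      rintro rfl
      simp at h0'
    refine ⟨A * B' + B * A', B * B', by simp [h0, h0'], ?_, ?_⟩
    · simp only [Prod.mk_add_mk] at h1 h1' ⊢
      rw [h1, h1', map_add, map_mul, map_mul, map_mul, div_add_div _ _ hB hB']
    · simp only [Prod.mk_add_mk] at h2 h2' ⊢
      rw [h2, h2', map_add, map_mul, map_mul, map_mul, div_add_div _ _ h0 h0']
  algebraMap_mem' c := by
    refine ⟨MvPolynomial.C c, 1, by simp, ?_, by simp⟩
    simp only [map_one, div_one, Prod.algebraMap_apply]
    rw [IsScalarTower.algebraMap_apply ℂ (MvPolynomial ι ℂ)]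
    rfl

theorem mem_valueGraph {z : ι → ℂ} {f : FractionRing (MvPolynomial ι ℂ)} {c : ℂ} :
    (f, c) ∈ valueGraph z ↔ ∃ A B : MvPolynomial ι ℂ, MvPolynomial.eval z B ≠ 0 ∧
      f = algebraMap _ _ A / algebraMap _ _ B ∧
      c = MvPolynomial.eval z A / MvPolynomial.eval z B := Iff.rfl

theorem div_mem_valueGraph {z : ι → ℂ} {A B : MvPolynomial ι ℂ}
    (hB : MvPolynomial.eval z B ≠ 0) :
    ((algebraMap _ _ A / algebraMap _ _ B : FractionRing (MvPolynomial ι ℂ)),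
      MvPolynomial.eval z A / MvPolynomial.eval z B) ∈ valueGraph z :=
  ⟨A, B, hB, rfl, rfl⟩

/-- Two representations of one fraction satisfy a polynomial identity after cross-multiplication,
and this can be evaluated at `z`. So values do not depend on the representation. -/
theorem valueGraph_unique {z : ι → ℂ} {f : FractionRing (MvPolynomial ι ℂ)} {c c' : ℂ}
    (h : (f, c) ∈ valueGraph z) (h' : (f, c') ∈ valueGraph z) : c = c' := by
  obtain ⟨A, B, h0, h1, h2⟩ := mem_valueGraph.1 h
  obtain ⟨A', B', h0', h1', h2'⟩ := mem_valueGraph.1 h'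
  have hB : algebraMap (MvPolynomial ι ℂ) (FractionRing (MvPolynomial ι ℂ)) B ≠ 0 := by
    simp only [ne_eq, FaithfulSMul.algebraMap_eq_zero_iff]
    rintro rfl
    simp at h0
  have hB' : algebraMap (MvPolynomial ι ℂ) (FractionRing (MvPolynomial ι ℂ)) B' ≠ 0 := by
    simp only [ne_eq, FaithfulSMul.algebraMap_eq_zero_iff]
    rintro rfl
    simp at h0'
  rw [h1, div_eq_div_iff hB hB', ← map_mul, ← map_mul] at h1'
  have := congrArg (MvPolynomial.eval z) (FaithfulSMul.algebraMap_injective _ _ h1')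
  rw [map_mul, map_mul] at this
  rw [h2, h2', div_eq_div_iff h0 h0', this]

/-- Expansion into monomials, so that only the variables that occur in `F` need to be defined at
`z`. -/
theorem aeval_mem_valueGraph {κ : Type*} {z : ι → ℂ} {f : κ → FractionRing (MvPolynomial ι ℂ)}
    {c : κ → ℂ} (F : MvPolynomial κ ℂ) (h : ∀ k ∈ F.vars, (f k, c k) ∈ valueGraph z) :
    (MvPolynomial.aeval f F, MvPolynomial.eval c F) ∈ valueGraph z := by
  have e : (MvPolynomial.aeval f F, MvPolynomial.eval c F) =
      ∑ m ∈ F.support, algebraMap ℂ (FractionRing (MvPolynomial ι ℂ) × ℂ) (F.coeff m) *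
        ∏ k ∈ m.support, (f k, c k) ^ m k := by
    refine Prod.ext ?_ ?_
    · rw [Prod.fst_sum]
      simp only [Prod.fst_mul, Prod.algebraMap_apply, Prod.fst_prod, Prod.pow_fst]
      rw [MvPolynomial.aeval_def, MvPolynomial.eval₂_eq]
    · rw [Prod.snd_sum]
      simp only [Prod.snd_mul, Prod.algebraMap_apply, Prod.snd_prod, Prod.pow_snd]
      rw [MvPolynomial.eval_eq]
      rfl
  rw [e]
  refine Subalgebra.sum_mem _ fun m hm => Subalgebra.mul_mem _ (Subalgebra.algebraMap_mem _ _)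
    (Subalgebra.prod_mem _ fun k hk => Subalgebra.pow_mem _ (h k ?_) _)
  exact (MvPolynomial.mem_vars_iff_mem_support k).2 ⟨m, hm, hk⟩

/-- A nonzero polynomial that does not vanish only at injective tuples avoiding a finite set. -/
theorem exists_polynomial_injective [Finite ι] (B : Finset ℂ) : ∃ N : MvPolynomial ι ℂ, N ≠ 0 ∧
    ∀ z : ι → ℂ, MvPolynomial.eval z N ≠ 0 → Function.Injective z ∧ ∀ i, z i ∉ B := by
  classical
  cases nonempty_fintype ι
  refine ⟨(∏ i : ι, ∏ j ∈ Finset.univ.erase i, (MvPolynomial.X i - MvPolynomial.X j)) *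
    ∏ i : ι, ∏ c ∈ B, (MvPolynomial.X i - MvPolynomial.C c), ?_, fun z hz => ?_⟩
  · refine mul_ne_zero (Finset.prod_ne_zero_iff.2 fun i _ => Finset.prod_ne_zero_iff.2 fun j hj => ?_)
      (Finset.prod_ne_zero_iff.2 fun i _ => Finset.prod_ne_zero_iff.2 fun c _ => ?_)
    · rw [sub_ne_zero]
      exact fun h => (Finset.ne_of_mem_erase hj) (MvPolynomial.X_injective h).symm
    · intro h
      have := congrArg (MvPolynomial.eval fun _ => c + 1) h
      simp at this
  · simp only [map_mul, map_prod, map_sub, MvPolynomial.eval_X, MvPolynomial.eval_C,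
      mul_ne_zero_iff, Finset.prod_ne_zero_iff, sub_ne_zero] at hz
    refine ⟨fun i j hij => ?_, fun i hi => hz.2 i (Finset.mem_univ i) _ hi rfl⟩
    by_contra hne
    exact hz.1 i (Finset.mem_univ i) j (Finset.mem_erase.2 ⟨Ne.symm hne, Finset.mem_univ j⟩) hij

theorem exists_eval_ne_zero {F : MvPolynomial ι ℂ} (h : F ≠ 0) : ∃ z, MvPolynomial.eval z F ≠ 0 := by
  by_contra hn
  push Not at hn
  exact h (MvPolynomial.funext fun z => by simpa using hn z)

end HasValue

/-- The point of the projective line with homogeneous coordinates `n : d`. -/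
def ratioPoint (n d : ℂ) : OnePoint ℂ :=
  open Classical in if d = 0 then ∞ else ((n / d : ℂ) : OnePoint ℂ)

theorem ratioPoint_ne_infty_iff {n d : ℂ} : ratioPoint n d ≠ ∞ ↔ d ≠ 0 := by
  by_cases h : d = 0 <;> simp [ratioPoint, h]

theorem finPart_ratioPoint (n d : ℂ) : finPart (ratioPoint n d) = n / d := by
  by_cases h : d = 0 <;> simp [ratioPoint, h]

theorem crossRatio_eq_ratioPoint (a b c d : OnePoint ℂ) : crossRatio a b c d =
    ratioPoint (bracket d a * bracket b c) (bracket d c * bracket b a) := rfl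

/-- A set that is parametrized, up to a proper Zariski closed set of parameters, by an affine space
is irreducible. -/
theorem isIrreducible_of_parametrization {S ι : Type*} {A : Set (Mbar S)} {N : MvPolynomial ι ℂ}
    (hN : N ≠ 0) (n d : (Fin 4 ↪ S) → MvPolynomial ι ℂ)
    (h1 : ∀ x ∈ A, ∃ z, ∀ q, coord q x =
      ratioPoint (MvPolynomial.eval z (n q)) (MvPolynomial.eval z (d q)))
    (h2 : ∀ z, MvPolynomial.eval z N ≠ 0 → ∃ x ∈ A, ∀ q, coord q x =
      ratioPoint (MvPolynomial.eval z (n q)) (MvPolynomial.eval z (d q))) :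
    IsIrreducible A := by
  let f : (Fin 4 ↪ S) → FractionRing (MvPolynomial ι ℂ) := fun q =>
    algebraMap _ _ (n q) / algebraMap _ _ (d q)
  -- An open set that meets `A` contains the points of all parameters outside of a hypersurface. Its
  -- equation `H` is made of the numerator and the denominator of a defining function, pulled back
  -- to the parameter space, and of the denominators of the cross-ratios involved. Two such
  -- conditions and `N ≠ 0` can be satisfied together since polynomials form a domain.
  have key : ∀ U : Set (Mbar S), IsOpen U → (A ∩ U).Nonempty → ∃ H : MvPolynomial ι ℂ, H ≠ 0 ∧
      ∀ z, MvPolynomial.eval z H ≠ 0 → ∀ x, (∀ q, coord q x =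
        ratioPoint (MvPolynomial.eval z (n q)) (MvPolynomial.eval z (d q))) → x ∈ U := by
    rintro U hU ⟨x, hxA, hxU⟩
    obtain ⟨_, ⟨I, F, hI, rfl⟩, hx, hsub⟩ :=
      isTopologicalBasis_basicOpen.exists_subset_of_mem_open hxU hU
    have hval : ∀ (z : ι → ℂ) (x : Mbar S), (∀ q, coord q x =
        ratioPoint (MvPolynomial.eval z (n q)) (MvPolynomial.eval z (d q))) →
        (∀ q ∈ I, MvPolynomial.eval z (d q) ≠ 0) →
        (MvPolynomial.aeval f F, value F x) ∈ valueGraph z := by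
      intro z x hx hd
      refine aeval_mem_valueGraph F fun q hq => ?_
      rw [hx q, finPart_ratioPoint]
      exact div_mem_valueGraph (hd q (hI hq))
    obtain ⟨z, hz⟩ := h1 x hxA
    have hd : ∀ q ∈ I, MvPolynomial.eval z (d q) ≠ 0 := fun q hq => by
      rw [← ratioPoint_ne_infty_iff, ← hz q]
      exact hx.1 q hq
    obtain ⟨a, c, hc, e1, e2⟩ := mem_valueGraph.1 (hval z x hz hd)
    have ha : MvPolynomial.eval z a ≠ 0 := fun h => hx.2 (by rw [e2, h, zero_div])
    refine ⟨a * c * ∏ q ∈ I, d q, fun h => ?_, fun z' hz' x' hx' => hsub ?_⟩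
    · have := congrArg (MvPolynomial.eval z) h
      simp only [map_mul, map_prod, map_zero, mul_eq_zero, ha, hc, false_or,
        Finset.prod_eq_zero_iff] at this
      obtain ⟨q, hq, h0⟩ := this
      exact hd q hq h0
    · simp only [map_mul, map_prod, mul_ne_zero_iff, Finset.prod_ne_zero_iff] at hz'
      refine ⟨fun q hq => ?_, ?_⟩
      · rw [hx', ratioPoint_ne_infty_iff]
        exact hz'.2 q hq
      · have h3 := hval z' x' hx' hz'.2
        have h4 : (MvPolynomial.aeval f F, MvPolynomial.eval z' a / MvPolynomial.eval z' c) ∈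
            valueGraph z' := ⟨a, c, hz'.1.2, e1, rfl⟩
        rw [valueGraph_unique h3 h4]
        exact div_ne_zero hz'.1.1 hz'.1.2
  refine ⟨?_, fun U V hU hV hAU hAV => ?_⟩
  · obtain ⟨z, hz⟩ := exists_eval_ne_zero hN
    obtain ⟨x, hx, -⟩ := h2 z hz
    exact ⟨x, hx⟩
  · obtain ⟨H, hH, h3⟩ := key U hU hAU
    obtain ⟨H', hH', h3'⟩ := key V hV hAV
    obtain ⟨z, hz⟩ := exists_eval_ne_zero (mul_ne_zero hN (mul_ne_zero hH hH'))
    simp only [map_mul, mul_ne_zero_iff] at hz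
    obtain ⟨x, hx, hxz⟩ := h2 z hz.1
    exact ⟨x, hx, h3 z hz.2.1 x hxz, h3' z hz.2.2 x hxz⟩

/-! ### The generic configuration and its specializations -/

section Generic

variable {S : Type*} (b : Fin 3 ↪ S)

open Classical in
/-- Homogeneous coordinates of the generic configuration. -/
def genericHomog (s : S) : MvPolynomial (Free b) ℂ × MvPolynomial (Free b) ℂ :=
  if h : s ∈ Set.range b then (if s = b 0 then (0, 1) else if s = b 1 then (1, 1) else (1, 0))
  else (MvPolynomial.X ⟨s, h⟩, 1)

open Classical in
/-- The configuration of points in which the labels `0, 1, ∞` are at `0, 1, ∞`, and the others have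
the coordinates given by `z`. -/
def configuration {F : Type*} [Field F] (z : Free b → F) (s : S) : OnePoint F :=
  if h : s ∈ Set.range b then (if s = b 0 then ((0 : F) : OnePoint F)
    else if s = b 1 then ((1 : F) : OnePoint F) else ∞)
  else (z ⟨s, h⟩ : OnePoint F)

variable {b}

theorem generic_eq_configuration : generic b =
    configuration b (fun s : Free b =>
      algebraMap (MvPolynomial (Free b) ℂ) (FunctionField b) (MvPolynomial.X s)) := rfl

section

variable {F : Type*} [Field F] (z : Free b → F)

@[simp] theorem configuration_zero : configuration b z (b 0) = ((0 : F) : OnePoint F) := by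
  simp [configuration]

@[simp] theorem configuration_one : configuration b z (b 1) = ((1 : F) : OnePoint F) := by
  simp [configuration]

@[simp] theorem configuration_two : configuration b z (b 2) = ∞ := by
  simp [configuration]

@[simp] theorem configuration_free (s : Free b) :
    configuration b z s.1 = (z s : OnePoint F) := by
  unfold configuration
  rw [dif_neg s.2]
  rfl

theorem configuration_injective (hz : Function.Injective z) (h : ∀ s, z s ≠ 0 ∧ z s ≠ 1) :
    Function.Injective (configuration b z) := by
  have cases : ∀ s : S, (∃ i, s = b i) ∨ ∃ t : Free b, s = t.1 := by
    intro s
    by_cases hs : s ∈ Set.range b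
    · obtain ⟨i, rfl⟩ := hs
      exact Or.inl ⟨i, rfl⟩
    · exact Or.inr ⟨⟨s, hs⟩, rfl⟩
  have hbf : ∀ i (t : Free b), configuration b z (b i) ≠ configuration b z t.1 := by
    intro i t
    rw [configuration_free]
    fin_cases i
    · simpa using (h t).1.symm
    · simpa using (h t).2.symm
    · simp
  intro s s' e
  rcases cases s with ⟨i, rfl⟩ | ⟨t, rfl⟩ <;> rcases cases s' with ⟨j, rfl⟩ | ⟨t', rfl⟩
  · fin_cases i <;> fin_cases j <;> simp at e ⊢
  · exact absurd e (hbf i t')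
  · exact absurd e.symm (hbf j t)
  · rw [configuration_free, configuration_free] at e
    rw [hz (OnePoint.coe_injective e)]

theorem homog_configuration (φ : MvPolynomial (Free b) ℂ →+* F) (s : S) :
    homog (configuration b (fun s => φ (MvPolynomial.X s)) s) =
      (φ (genericHomog b s).1, φ (genericHomog b s).2) := by
  unfold configuration genericHomog
  split_ifs <;> simp

end

variable (b) in
/-- The numerator of a cross-ratio of the generic configuration. -/
def crossNum (q : Fin 4 ↪ S) : MvPolynomial (Free b) ℂ :=
  let m (s s' : S) := (genericHomog b s).1 * (genericHomog b s').2 -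
    (genericHomog b s).2 * (genericHomog b s').1
  m (q 3) (q 0) * m (q 1) (q 2)

variable (b) in
/-- The denominator of a cross-ratio of the generic configuration. -/
def crossDen (q : Fin 4 ↪ S) : MvPolynomial (Free b) ℂ :=
  let m (s s' : S) := (genericHomog b s).1 * (genericHomog b s').2 -
    (genericHomog b s).2 * (genericHomog b s').1
  m (q 3) (q 2) * m (q 1) (q 0)

theorem finPart_crossRatio {F : Type*} [Field F] (a b c d : OnePoint F) :
    finPart (crossRatio a b c d) =
      bracket d a * bracket b c / (bracket d c * bracket b a) := by
  unfold crossRatio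
  split_ifs with h
  · rw [h, div_zero, finPart_infty]
  · rw [finPart_coe]

theorem crossFun_eq_div (q : Fin 4 ↪ S) : crossFun b q =
    algebraMap _ _ (crossNum b q) / algebraMap _ _ (crossDen b q) := by
  unfold crossFun crossNum crossDen
  rw [finPart_crossRatio]
  simp only [bracket, generic_eq_configuration, homog_configuration, ← map_mul, ← map_sub]

theorem crossRatio_configuration (z : Free b → ℂ) (q : Fin 4 ↪ S) :
    crossRatio (configuration b z (q 0)) (configuration b z (q 1)) (configuration b z (q 2))
      (configuration b z (q 3)) =
    ratioPoint (MvPolynomial.eval z (crossNum b q)) (MvPolynomial.eval z (crossDen b q)) := by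
  have e : configuration b z =
      configuration b (fun s => MvPolynomial.eval z (MvPolynomial.X s)) := by simp
  rw [crossRatio_eq_ratioPoint, e]
  unfold crossNum crossDen
  simp only [bracket, homog_configuration, ← map_mul, ← map_sub]

/-- Some component sees all labels in different directions; its coordinate is normalized by `b 0, b
1, b 2`. -/
theorem exists_configuration {C : StableCurve S} (hC : Quot.mk _ C ∈ openStratum S)
    (b : Fin 3 ↪ S) : ∃ z : Free b → ℂ, Function.Injective (configuration b z) ∧
      ∀ q, C.cross q = crossRatio (configuration b z (q 0)) (configuration b z (q 1))
        (configuration b z (q 2)) (configuration b z (q 3)) := by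
  obtain ⟨v, hv⟩ := exists_pos_injective hC b
  obtain ⟨g, hg⟩ := exists_smul_eq_crossRatio (a := C.pos v (b 0)) (b := C.pos v (b 1))
    (c := C.pos v (b 2)) (hv.ne (by simp)) (hv.ne (by simp)) (hv.ne (by simp))
  have e0 : g • C.pos v (b 0) = ((0 : ℂ) : OnePoint ℂ) := by
    rw [hg, crossRatio_of_ne (hv.ne (by simp)) (hv.ne (by simp)), bracket_eq_zero_iff.2 rfl]
    simp
  have e1 : g • C.pos v (b 1) = ((1 : ℂ) : OnePoint ℂ) := by
    rw [hg, crossRatio_of_ne (hv.ne (by simp)) (hv.ne (by simp)), mul_comm, div_self]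
    exact mul_ne_zero (fun h => hv.ne (by simp) (bracket_eq_zero_iff.1 h))
      (fun h => hv.ne (by simp) (bracket_eq_zero_iff.1 h))
  have e2 : g • C.pos v (b 2) = ∞ := by
    rw [hg, crossRatio_eq_infty_iff (hv.ne (by simp))]
  have hginj := (MulAction.injective (β := OnePoint ℂ) g)
  have e : ∀ s, g • C.pos v s = configuration b (fun s => finPart (g • C.pos v s.1)) s := by
    intro s
    by_cases hs : s ∈ Set.range b
    · obtain ⟨i, rfl⟩ := hs
      fin_cases i
      · simpa using e0
      · simpa using e1
      · simpa using e2
    · rw [configuration_free _ (⟨s, hs⟩ : Free b), coe_finPart]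
      rw [← e2]
      exact hginj.ne (hv.ne fun h => hs ⟨2, h.symm⟩)
  refine ⟨fun s => finPart (g • C.pos v s.1), fun s s' h => ?_, fun q => ?_⟩
  · rw [← e, ← e] at h
    exact hv (hginj h)
  · rw [← e, ← e, ← e, ← e, crossRatio_smul, C.cross_eq]
    exact ⟨hv.ne (by simp), hv.ne (by simp), hv.ne (by simp)⟩

theorem three_le_card [Finite S] (b : Fin 3 ↪ S) : 3 ≤ Nat.card S := by
  simpa using Nat.card_le_card_of_injective b b.injective

theorem isIrreducible_openStratum [Finite S] (b : Fin 3 ↪ S) : IsIrreducible (openStratum S) := by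
  have : Finite (Free b) := Subtype.finite
  obtain ⟨N, hN, hinj⟩ := exists_polynomial_injective (ι := Free b) {0, 1}
  refine isIrreducible_of_parametrization hN (crossNum b) (crossDen b) ?_ fun z hz => ?_
  · rintro ⟨C⟩ hC
    obtain ⟨z, -, hz⟩ := exists_configuration hC b
    exact ⟨z, fun q => (hz q).trans (crossRatio_configuration z q)⟩
  · obtain ⟨h1, h2⟩ := hinj z hz
    have hm : Function.Injective (configuration b z) :=
      configuration_injective z h1 fun s => by simpa using h2 s
    refine ⟨_, smoothCurve_mem_openStratum hm (three_le_card b), fun q => ?_⟩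
    rw [coord_smoothCurve, crossRatio_configuration]

/-- A polynomial in the cross-ratios that vanishes as a rational function has the value zero where
it is defined. -/
theorem value_eq_zero [Fintype S] [DecidableEq S] {F : MvPolynomial (Fin 4 ↪ S) ℂ} {x : Mbar S}
    (h : MvPolynomial.aeval (crossFun b) F = 0) (hx : DefinedAt F x) : value F x = 0 := by
  by_contra hne
  -- The locus where `F` is defined and nonzero is open, so it would contain a point of the open
  -- stratum. There the value is the evaluation of the rational function at a configuration, hence
  -- zero.
  obtain ⟨y, hyU, hy⟩ := dense_openStratum.inter_open_nonempty _
    (isOpen_basicOpen (P := F) subset_rfl) ⟨x, hx, hne⟩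
  obtain ⟨C⟩ := y
  obtain ⟨z, -, hz⟩ := exists_configuration hy b
  have hmem : (MvPolynomial.aeval (crossFun b) F, value F (Quot.mk _ C)) ∈ valueGraph z := by
    refine aeval_mem_valueGraph F fun q _ => ?_
    have e : coord q (Quot.mk _ C : Mbar S) = _ := (hz q).trans (crossRatio_configuration z q)
    have hq := hy q
    rw [e, ratioPoint_ne_infty_iff] at hq
    rw [crossFun_eq_div, e, finPart_ratioPoint]
    exact div_mem_valueGraph hq
  rw [h] at hmem
  exact hyU.2 (valueGraph_unique hmem (valueGraph z).zero_mem)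

theorem aeval_ne_zero_of_value_ne_zero [Fintype S] [DecidableEq S]
    {F : MvPolynomial (Fin 4 ↪ S) ℂ} {x : Mbar S} (hx : DefinedAt F x) (h : value F x ≠ 0) :
    MvPolynomial.aeval (crossFun b) F ≠ 0 :=
  fun e => h (value_eq_zero e hx)

end Generic

/-! ### Irreducibility of the boundary divisors -/

namespace TwoComp

variable {S : Type*} {P : Set S} (D : TwoComp P)

theorem mem_of_pos_outer_eq {i j : S} (hij : i ≠ j)
    (h : D.curve.pos D.outer i = D.curve.pos D.outer j) : i ∈ P ∧ j ∈ P := by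
  by_cases hi : i ∈ P <;> by_cases hj : j ∈ P
  · exact ⟨hi, hj⟩
  · rw [D.pos_outer_of_mem hi, D.pos_outer_of_notMem hj] at h
    exact absurd h.symm (D.ne_node_compl j hj)
  · rw [D.pos_outer_of_mem hj, D.pos_outer_of_notMem hi] at h
    exact absurd h (D.ne_node_compl i hi)
  · rw [D.pos_outer_of_notMem hi, D.pos_outer_of_notMem hj] at h
    exact absurd (D.injOn_compl hi hj h) hij

theorem notMem_of_pos_inner_eq {i j : S} (hij : i ≠ j)
    (h : D.curve.pos D.inner i = D.curve.pos D.inner j) : i ∉ P ∧ j ∉ P := by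
  by_cases hi : i ∈ P <;> by_cases hj : j ∈ P
  · rw [D.pos_inner_of_mem hi, D.pos_inner_of_mem hj] at h
    exact absurd (D.injOn hi hj h) hij
  · rw [D.pos_inner_of_mem hi, D.pos_inner_of_notMem hj] at h
    exact absurd h (D.ne_node i hi)
  · rw [D.pos_inner_of_mem hj, D.pos_inner_of_notMem hi] at h
    exact absurd h.symm (D.ne_node j hj)
  · exact ⟨hi, hj⟩

theorem separates_outer {i j k : S} (hij : i ≠ j) (hjk : j ≠ k) (hik : i ≠ k)
    (h : ¬ (i ∈ P ∧ j ∈ P) ∧ ¬ (j ∈ P ∧ k ∈ P) ∧ ¬ (i ∈ P ∧ k ∈ P)) :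
    D.curve.Separates D.outer i j k :=
  ⟨fun e => h.1 (D.mem_of_pos_outer_eq hij e), fun e => h.2.1 (D.mem_of_pos_outer_eq hjk e),
    fun e => h.2.2 (D.mem_of_pos_outer_eq hik e)⟩

theorem separates_inner {i j k : S} (hij : i ≠ j) (hjk : j ≠ k) (hik : i ≠ k)
    (h : ¬ (i ∉ P ∧ j ∉ P) ∧ ¬ (j ∉ P ∧ k ∉ P) ∧ ¬ (i ∉ P ∧ k ∉ P)) :
    D.curve.Separates D.inner i j k :=
  ⟨fun e => h.1 (D.notMem_of_pos_inner_eq hij e), fun e => h.2.1 (D.notMem_of_pos_inner_eq hjk e),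
    fun e => h.2.2 (D.notMem_of_pos_inner_eq hik e)⟩

end TwoComp

section

variable {S : Type*} [Fintype S] [DecidableEq S]

theorem isIrreducible_twoCompSet {σ : StablePartition S} {P : Finset S} (hP : P ∈ σ.1.parts) :
    IsIrreducible (twoCompSet hP) := by
  classical
  obtain ⟨N, hN, hinj⟩ := exists_polynomial_injective (ι := Option S) ∅
  let ho : S → MvPolynomial (Option S) ℂ × MvPolynomial (Option S) ℂ := fun s =>
    if s ∈ P then (MvPolynomial.X none, 1) else (MvPolynomial.X (some s), 1)
  let hi : S → MvPolynomial (Option S) ℂ × MvPolynomial (Option S) ℂ := fun s =>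
    if s ∈ P then (MvPolynomial.X (some s), 1) else (1, 0)
  -- If at most one of the first three labels is in `P`, the outer component separates them,
  -- otherwise the inner one. This depends on `q` alone, so each cross-ratio is given by the same
  -- polynomials for all curves in the set.
  let A : (Fin 4 ↪ S) → Prop := fun q =>
    ¬ (q 0 ∈ P ∧ q 1 ∈ P) ∧ ¬ (q 1 ∈ P ∧ q 2 ∈ P) ∧ ¬ (q 0 ∈ P ∧ q 2 ∈ P)
  let hh : (Fin 4 ↪ S) → S → MvPolynomial (Option S) ℂ × MvPolynomial (Option S) ℂ := fun q =>
    if A q then ho else hi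
  let m (q : Fin 4 ↪ S) (i j : Fin 4) : MvPolynomial (Option S) ℂ :=
    (hh q (q i)).1 * (hh q (q j)).2 - (hh q (q i)).2 * (hh q (q j)).1
  have key : ∀ z hz hz' h0 q, coord q (Quot.mk _ (twoCompOfInjective hP z hz hz' h0).curve) =
      ratioPoint (MvPolynomial.eval z (m q 3 0 * m q 1 2))
        (MvPolynomial.eval z (m q 3 2 * m q 1 0)) := by
    intro z hz hz' h0 q
    set D := twoCompOfInjective hP z hz hz' h0 with hD
    obtain ⟨v, hv, hpos⟩ : ∃ v, D.curve.Separates v (q 0) (q 1) (q 2) ∧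
        ∀ s, homog (D.curve.pos v s) =
          (MvPolynomial.eval z (hh q s).1, MvPolynomial.eval z (hh q s).2) := by
      by_cases hA : A q
      · refine ⟨D.outer, D.separates_outer (by simp) (by simp) (by simp) hA, fun s => ?_⟩
        simp only [hh, hA, if_true, ho]
        by_cases hs : s ∈ P
        · rw [D.pos_outer_of_mem hs]
          simp only [hs, if_true, MvPolynomial.eval_X, map_one]
          rfl
        · rw [D.pos_outer_of_notMem hs]
          simp only [hs, if_false, MvPolynomial.eval_X, map_one]
          rfl
      · refine ⟨D.inner, D.separates_inner (by simp) (by simp) (by simp) ?_, fun s => ?_⟩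
        · simp only [A, Finset.mem_coe] at hA ⊢
          tauto
        simp only [hh, hA, if_false, hi]
        by_cases hs : s ∈ P
        · rw [D.pos_inner_of_mem hs]
          simp only [hs, if_true, MvPolynomial.eval_X, map_one]
          rfl
        · rw [D.pos_inner_of_notMem hs]
          simp only [hs, if_false, map_zero, map_one]
          rfl
    rw [coord_mk, D.curve.cross_eq hv, crossRatio_eq_ratioPoint]
    simp only [bracket, hpos, m, map_mul, map_sub]
  refine isIrreducible_of_parametrization hN (fun q => m q 3 0 * m q 1 2)
    (fun q => m q 3 2 * m q 1 0) ?_ fun z hz => ?_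
  · rintro _ ⟨z, hz, hz', h0, rfl⟩
    exact ⟨z, key z hz hz' h0⟩
  · have h1 := (hinj z hz).1
    have h2 : Function.Injective fun s => z (some s) := h1.comp (Option.some_injective S)
    exact ⟨_, ⟨z, h2.injOn, h2.injOn, fun s _ => h1.ne (by simp), rfl⟩,
      key z h2.injOn h2.injOn fun s _ => h1.ne (by simp)⟩

theorem isIrreducible_boundaryDivisor (σ : StablePartition S) :
    IsIrreducible (boundaryDivisor σ) := by
  obtain ⟨P, hP⟩ := σ.exists_parts
  have hPσ : P ∈ σ.1.parts := by simp [hP]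
  rw [← closure_twoCompSet hPσ]
  exact (isIrreducible_twoCompSet hPσ).closure

/-- A curve with two components has a single node and hence lies in a single boundary divisor. -/
theorem eq_of_boundaryDivisor_subset {σ τ : StablePartition S}
    (h : boundaryDivisor σ ⊆ boundaryDivisor τ) : σ = τ := by
  obtain ⟨P, hP⟩ := σ.exists_parts
  have hPσ : P ∈ σ.1.parts := by simp [hP]
  obtain ⟨_, z, hz, hz', h0, rfl⟩ := (isIrreducible_twoCompSet hPσ).1
  exact TwoComp.eq_of_mk_mem_boundaryDivisor hPσ (twoCompOfInjective hPσ z hz hz' h0)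
    (h (TwoComp.mk_mem_boundaryDivisor hPσ _))

theorem boundaryDivisor_injective : Function.Injective (boundaryDivisor (S := S)) :=
  fun _ _ h => eq_of_boundaryDivisor_subset h.subset

theorem isIrreducible_univ (b : Fin 3 ↪ S) : IsIrreducible (Set.univ : Set (Mbar S)) := by
  rw [← dense_openStratum.closure_eq]
  exact (isIrreducible_openStratum b).closure

end

end ModuliZero

namespace ModuliZero

/-! ### Charts at boundary divisors -/

/-! ### Restriction of polynomials to a coordinate hyperplane -/

section Polynomials

variable {ι : Type*}

theorem X_dvd_of_aeval_eq_zero [DecidableEq ι] {i : ι} {G : MvPolynomial ι ℂ}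
    (h : MvPolynomial.aeval (fun j => if j = i then (0 : MvPolynomial ι ℂ) else MvPolynomial.X j) G
      = 0) : MvPolynomial.X i ∣ G := by
  have key : ∀ G : MvPolynomial ι ℂ, MvPolynomial.X i ∣ G -
      MvPolynomial.aeval (fun j => if j = i then (0 : MvPolynomial ι ℂ) else MvPolynomial.X j) G := by
    intro G
    induction G using MvPolynomial.induction_on with
    | C c => simp
    | add p q hp hq =>
      rw [map_add, add_sub_add_comm]
      exact dvd_add hp hq
    | mul_X p j hp =>
      rw [map_mul, MvPolynomial.aeval_X]
      by_cases hj : j = i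
      · subst hj
        simp
      · simp only [hj, if_false]
        rw [← sub_mul]
        exact hp.mul_right _
  have := key G
  rwa [h, sub_zero] at this

/-- A polynomial that is not divisible by the coordinate `i` does not vanish at a general point of
the coordinate hyperplane. -/
theorem exists_eval_ne_zero_of_not_dvd [Finite ι] {i : ι} {G : MvPolynomial ι ℂ}
    (h : ¬ MvPolynomial.X i ∣ G) : ∃ z : ι → ℂ, Function.Injective z ∧ z i = 0 ∧ (∀ j, z j ≠ 1) ∧
      MvPolynomial.eval z G ≠ 0 := by
  classical
  set G' := MvPolynomial.aeval
    (fun j => if j = i then (0 : MvPolynomial ι ℂ) else MvPolynomial.X j) G with hG'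
  have hne : G' ≠ 0 := fun e => h (X_dvd_of_aeval_eq_zero e)
  obtain ⟨N, hN, hinj⟩ := exists_polynomial_injective (ι := ι) {0, 1}
  obtain ⟨z, hz⟩ := exists_eval_ne_zero (mul_ne_zero hN hne)
  rw [map_mul, mul_ne_zero_iff] at hz
  obtain ⟨h1, h2⟩ := hinj z hz.1
  have h2' : ∀ j, z j ≠ 0 ∧ z j ≠ 1 := fun j => by simpa using h2 j
  -- A general point is projected to the hyperplane. Its coordinates stay distinct because the
  -- others avoid `0`.
  refine ⟨Function.update z i 0, fun j k hjk => ?_, by simp, fun j => ?_, ?_⟩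
  · by_cases hj : j = i <;> by_cases hk : k = i
    · rw [hj, hk]
    · rw [hj] at hjk
      simp only [Function.update_self, Function.update_of_ne hk] at hjk
      exact absurd hjk.symm (h2' k).1
    · rw [hk] at hjk
      simp only [Function.update_self, Function.update_of_ne hj] at hjk
      exact absurd hjk (h2' j).1
    · simp only [Function.update_of_ne hj, Function.update_of_ne hk] at hjk
      exact h1 hjk
  · by_cases hj : j = i
    · subst hj
      simp
    · simpa [Function.update_of_ne hj] using (h2' j).2
  · have e : MvPolynomial.eval (Function.update z i 0) G = MvPolynomial.eval z G' := by
      have : MvPolynomial.eval (Function.update z i 0) = (MvPolynomial.eval z).comp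
          (MvPolynomial.aeval (fun j => if j = i then (0 : MvPolynomial ι ℂ)
            else MvPolynomial.X j)).toRingHom := by
        refine MvPolynomial.ringHom_ext (fun a => by simp) fun j => ?_
        by_cases hj : j = i
        · subst hj
          simp
        · simp [hj]
      rw [this]
      rfl
    rw [e]
    exact hz.2

end Polynomials

section Chart

variable {S : Type*} [Fintype S] [DecidableEq S]

/-- The boundary divisor as an irreducible closed subset. -/
def boundaryIrreducible (σ : StablePartition S) : TopologicalSpace.IrreducibleCloseds (Mbar S) :=
  ⟨boundaryDivisor σ, isIrreducible_boundaryDivisor σ, isClosed_boundaryDivisor σ⟩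

/-- An irreducible closed subset that does not meet the open stratum lies in a boundary divisor. -/
theorem exists_subset_boundaryDivisor {Z : Set (Mbar S)} (hZ : IsIrreducible Z)
    (h : ¬ (Z ∩ openStratum S).Nonempty) :
    ∃ σ : StablePartition S, Z ⊆ boundaryDivisor σ := by
  have hsub : Z ⊆ ⋃ σ : StablePartition S, boundaryDivisor σ := by
    intro x hx
    by_cases hxo : x ∈ openStratum S
    · exact absurd ⟨x, hx, hxo⟩ h
    · exact Set.mem_iUnion.2 (exists_mem_boundaryDivisor hxo)
  have := (isIrreducible_iff_sUnion_isClosed.1 hZ)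
    (Set.finite_range (boundaryDivisor (S := S))).toFinset ?_ ?_
  · obtain ⟨D, hD, h⟩ := this
    obtain ⟨σ, rfl⟩ := (Set.Finite.mem_toFinset _).1 hD
    exact ⟨σ, h⟩
  · intro D hD
    obtain ⟨σ, rfl⟩ := (Set.Finite.mem_toFinset _).1 hD
    exact isClosed_boundaryDivisor σ
  · simpa using hsub

/-- Local coordinates at a general point of the boundary divisor of `σ`: polynomials in the
cross-ratios that take arbitrary values at points of the divisor, except for the coordinate `s₀`,
which is an equation of the divisor. -/
structure Chart (b : Fin 3 ↪ S) (σ : StablePartition S) where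
  poly : Free b → MvPolynomial (Fin 4 ↪ S) ℂ
  s₀ : Free b
  exists_point : ∀ z : Free b → ℂ, Function.Injective z → z s₀ = 0 → (∀ s, z s ≠ 1) →
    ∃ x ∈ boundaryDivisor σ, ∀ s, DefinedAt (poly s) x ∧ value (poly s) x = z s
  value_boundary : ∀ x ∈ boundaryDivisor σ, DefinedAt (poly s₀) x → value (poly s₀) x = 0
  value_open : ∀ x ∈ openStratum S, value (poly s₀) x ≠ 0
  adjoin_eq_top : IntermediateField.adjoin ℂ
    (Set.range fun s => MvPolynomial.aeval (crossFun b) (poly s)) = ⊤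

theorem definedAt_of_mem_openStratum {S : Type*} {x : Mbar S} (hx : x ∈ openStratum S)
    (F : MvPolynomial (Fin 4 ↪ S) ℂ) : DefinedAt F x := fun q _ => hx q

theorem isOpen_definedAt {S : Type*} (F : MvPolynomial (Fin 4 ↪ S) ℂ) :
    IsOpen {x : Mbar S | DefinedAt F x} := by
  have : {x : Mbar S | DefinedAt F x} = ⋂ q ∈ F.vars, {x | coord q x ≠ ∞} := by
    ext x
    simp [DefinedAt]
  rw [this]
  exact isOpen_biInter_finset fun q _ => isOpen_coord_ne_infty q

/-! ### The local ring along a boundary divisor as a discrete valuation ring -/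

namespace Chart

variable {b : Fin 3 ↪ S} {σ : StablePartition S} (c : Chart b σ)

/-- The local coordinates as rational functions. -/
def fn (s : Free b) : FunctionField b := MvPolynomial.aeval (crossFun b) (c.poly s)

/-- A polynomial in the local coordinates as a polynomial in the cross-ratios. -/
def subst (G : MvPolynomial (Free b) ℂ) : MvPolynomial (Fin 4 ↪ S) ℂ :=
  MvPolynomial.bind₁ c.poly G

theorem aeval_subst (G : MvPolynomial (Free b) ℂ) :
    MvPolynomial.aeval (crossFun b) (c.subst G) = MvPolynomial.aeval c.fn G := by
  unfold subst
  rw [MvPolynomial.aeval_bind₁]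
  rfl

theorem definedAt_subst {x : Mbar S} (h : ∀ s, DefinedAt (c.poly s) x)
    (G : MvPolynomial (Free b) ℂ) : DefinedAt (c.subst G) x := by
  classical
  intro q hq
  have := MvPolynomial.vars_bind₁ c.poly G hq
  rw [Finset.mem_biUnion] at this
  obtain ⟨s, -, hs⟩ := this
  exact h s q hs

theorem value_subst {x : Mbar S} {z : Free b → ℂ} (h : ∀ s, value (c.poly s) x = z s)
    (G : MvPolynomial (Free b) ℂ) : value (c.subst G) x = MvPolynomial.eval z G := by
  unfold subst
  have : z = fun s => value (c.poly s) x := (funext h).symm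
  subst this
  unfold value
  rw [MvPolynomial.eval, MvPolynomial.eval₂Hom_bind₁]
  rfl

/-- The local ring along the divisor. -/
abbrev ring : Subalgebra ℂ (FunctionField b) := localRing b (boundaryIrreducible σ)

/-- Such a polynomial is nonzero at a general point of the hyperplane, and the chart realizes this
point on the divisor. This makes all polynomials in the local coordinates regular along the divisor,
and those not divisible by the equation units. -/
theorem exists_value_ne_zero {G : MvPolynomial (Free b) ℂ} (h : ¬ MvPolynomial.X c.s₀ ∣ G) :
    ∃ x ∈ boundaryDivisor σ, (∀ G, DefinedAt (c.subst G) x) ∧ value (c.subst G) x ≠ 0 := by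
  have : Finite (Free b) := Subtype.finite
  obtain ⟨z, h1, h2, h3, h4⟩ := exists_eval_ne_zero_of_not_dvd h
  obtain ⟨x, hx, hxz⟩ := c.exists_point z h1 h2 h3
  refine ⟨x, hx, c.definedAt_subst fun s => (hxz s).1, ?_⟩
  rwa [c.value_subst fun s => (hxz s).2]

theorem aeval_ne_zero {G : MvPolynomial (Free b) ℂ} (h : ¬ MvPolynomial.X c.s₀ ∣ G) :
    MvPolynomial.aeval c.fn G ≠ 0 := by
  obtain ⟨x, hx, hd, hv⟩ := c.exists_value_ne_zero h
  rw [← c.aeval_subst]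
  exact aeval_ne_zero_of_value_ne_zero (hd G) hv

theorem not_X_dvd_one : ¬ MvPolynomial.X c.s₀ ∣ (1 : MvPolynomial (Free b) ℂ) :=
  (MvPolynomial.X_prime).not_dvd_one

theorem aeval_mem_ring (G : MvPolynomial (Free b) ℂ) : MvPolynomial.aeval c.fn G ∈ ring (b := b) (σ := σ) := by
  obtain ⟨x, hx, hd, hv⟩ := c.exists_value_ne_zero c.not_X_dvd_one
  refine ⟨x, hx, c.subst G, c.subst 1, hd G, hd 1, hv, ?_, ?_⟩
  · rw [c.aeval_subst]
    simp
  · rw [c.aeval_subst, c.aeval_subst]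
    simp

theorem fn_mem_ring (s : Free b) : c.fn s ∈ ring (b := b) (σ := σ) := by
  simpa using c.aeval_mem_ring (MvPolynomial.X s)

theorem inv_aeval_mem_ring {G : MvPolynomial (Free b) ℂ} (h : ¬ MvPolynomial.X c.s₀ ∣ G) :
    (MvPolynomial.aeval c.fn G)⁻¹ ∈ ring (b := b) (σ := σ) := by
  obtain ⟨x, hx, hd, hv⟩ := c.exists_value_ne_zero h
  refine ⟨x, hx, c.subst 1, c.subst G, hd 1, hd G, hv, ?_, ?_⟩
  · rw [c.aeval_subst]
    exact c.aeval_ne_zero h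
  · rw [c.aeval_subst, c.aeval_subst]
    simp

/-- The equation of the divisor. -/
def unif : FunctionField b := c.fn c.s₀

theorem unif_ne_zero : c.unif ≠ 0 := by
  obtain ⟨x, hx⟩ := (isIrreducible_openStratum b).1
  exact aeval_ne_zero_of_value_ne_zero (definedAt_of_mem_openStratum hx _) (c.value_open x hx)

/-- From `unif⁻¹ = F / G` follows `G = unif * F`. At a point of the divisor where `F`, `G` and the
equation are all defined, and irreducibility provides one, this forces `G` to vanish. -/
theorem inv_unif_notMem_ring : c.unif⁻¹ ∉ ring (b := b) (σ := σ) := by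
  intro h
  obtain ⟨x, hxZ, hx⟩ := h
  obtain ⟨x', hx', hd, -⟩ := c.exists_value_ne_zero c.not_X_dvd_one
  have hd' : DefinedAt (c.poly c.s₀) x' := by
    have := hd (MvPolynomial.X c.s₀)
    rwa [subst, MvPolynomial.bind₁_X_right] at this
  obtain ⟨y, hyσ, hy1, hy2⟩ := (isIrreducible_boundaryDivisor σ).2 _ _
    (isOpen_regularAt c.unif⁻¹) (isOpen_definedAt (c.poly c.s₀)) ⟨x, hxZ, hx⟩ ⟨x', hx', hd'⟩
  obtain ⟨F, G, hF, hG, h0, h1, h2⟩ := hy1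
  have e : MvPolynomial.aeval (crossFun b) (G + MvPolynomial.C (-1) * (c.poly c.s₀ * F)) = 0 := by
    have h3 : MvPolynomial.aeval (crossFun b) (c.poly c.s₀) = c.unif := rfl
    simp only [map_add, map_mul, h3, map_neg, map_one]
    rw [eq_div_iff h1] at h2
    rw [← h2, mul_inv_cancel_left₀ c.unif_ne_zero]
    ring
  have := value_eq_zero e (hG.add ((DefinedAt.C _ _).mul (DefinedAt.mul hy2 hF)))
  have h3 : value (c.poly c.s₀) y = 0 := c.value_boundary y hyσ hy2
  unfold value at this h3 h0
  simp only [map_add, map_mul, h3] at this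
  simp at this
  exact h0 this

/-- A rational function is a power of the equation of the divisor times a quotient of polynomials
in the local coordinates that are not divisible by it. -/
theorem exists_factorization {f : FunctionField b} (hf : f ≠ 0) :
    ∃ (k : ℤ) (A B : MvPolynomial (Free b) ℂ), ¬ MvPolynomial.X c.s₀ ∣ A ∧
      ¬ MvPolynomial.X c.s₀ ∣ B ∧
      f = c.unif ^ k * (MvPolynomial.aeval c.fn A / MvPolynomial.aeval c.fn B) := by
  have hmem : f ∈ IntermediateField.adjoin ℂ (Set.range c.fn) := by
    have := c.adjoin_eq_top
    change IntermediateField.adjoin ℂ (Set.range c.fn) = ⊤ at this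
    rw [this]
    trivial
  obtain ⟨A, B, rfl⟩ := (IntermediateField.mem_adjoin_range_iff ℂ c.fn f).1 hmem
  have hA : A ≠ 0 := by rintro rfl; simp at hf
  have hB : B ≠ 0 := by rintro rfl; simp at hf
  obtain ⟨i, A', hA', rfl⟩ := WfDvdMonoid.max_power_factor hA
    (MvPolynomial.X_prime (i := c.s₀)).irreducible
  obtain ⟨j, B', hB', rfl⟩ := WfDvdMonoid.max_power_factor hB
    (MvPolynomial.X_prime (i := c.s₀)).irreducible
  refine ⟨(i : ℤ) - j, A', B', hA', hB', ?_⟩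
  have e : MvPolynomial.aeval c.fn (MvPolynomial.X c.s₀ : MvPolynomial (Free b) ℂ) = c.unif := by
    rw [MvPolynomial.aeval_X]
    rfl
  rw [map_mul, map_mul, map_pow, map_pow, e, zpow_sub₀ c.unif_ne_zero, zpow_natCast, zpow_natCast,
    mul_div_mul_comm]

theorem nonneg_of_mem_ring {k : ℤ} {A B : MvPolynomial (Free b) ℂ}
    (hA : ¬ MvPolynomial.X c.s₀ ∣ A)
    (h : c.unif ^ k * (MvPolynomial.aeval c.fn A / MvPolynomial.aeval c.fn B) ∈
      ring (b := b) (σ := σ)) (hB : MvPolynomial.aeval c.fn B ≠ 0) : 0 ≤ k := by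
  by_contra hk
  push Not at hk
  -- Multiplication by `unif ^ m * B / A`, which lies in the ring, would leave `unif⁻¹`.
  obtain ⟨m, hm⟩ : ∃ m : ℕ, k = -1 - m := ⟨(-1 - k).toNat, by omega⟩
  refine c.inv_unif_notMem_ring ?_
  have h1 := Subalgebra.mul_mem _ h (Subalgebra.mul_mem _ (Subalgebra.pow_mem _
    (c.fn_mem_ring c.s₀) m) (Subalgebra.mul_mem _ (c.aeval_mem_ring B) (c.inv_aeval_mem_ring hA)))
  convert h1 using 1
  have h2 := c.aeval_ne_zero hA
  have h3 := c.unif_ne_zero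
  have e : c.fn c.s₀ = c.unif := rfl
  rw [hm, e, zpow_sub₀ h3, zpow_natCast, zpow_neg_one]
  field_simp

/-- The elements of the local ring are the quotients of polynomials in the local coordinates with
denominator not divisible by the equation of the divisor. -/
theorem exists_eq_div {f : FunctionField b} (hf : f ∈ ring (b := b) (σ := σ)) :
    ∃ A B : MvPolynomial (Free b) ℂ, ¬ MvPolynomial.X c.s₀ ∣ B ∧
      f = MvPolynomial.aeval c.fn A / MvPolynomial.aeval c.fn B := by
  by_cases h0 : f = 0
  · exact ⟨0, 1, c.not_X_dvd_one, by simp [h0]⟩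
  obtain ⟨k, A, B, hA, hB, rfl⟩ := c.exists_factorization h0
  obtain ⟨m, rfl⟩ := Int.eq_ofNat_of_zero_le (c.nonneg_of_mem_ring hA hf (c.aeval_ne_zero hB))
  refine ⟨MvPolynomial.X c.s₀ ^ m * A, B, hB, ?_⟩
  rw [map_mul, map_pow, MvPolynomial.aeval_X, mul_div_assoc]
  rfl

/-- The maximal ideal of the local ring is generated by the equation of the divisor. -/
theorem exists_eq_unif_mul {f : ring (b := b) (σ := σ)}
    (hf : f ∈ IsLocalRing.maximalIdeal (ring (b := b) (σ := σ))) :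
    ∃ g ∈ ring (b := b) (σ := σ), (f : FunctionField b) = c.unif * g := by
  by_cases h0 : (f : FunctionField b) = 0
  · exact ⟨0, Subalgebra.zero_mem _, by simp [h0]⟩
  obtain ⟨k, A, B, hA, hB, e⟩ := c.exists_factorization h0
  have hk0 : 0 ≤ k := c.nonneg_of_mem_ring hA (e ▸ f.2) (c.aeval_ne_zero hB)
  have hk : k ≠ 0 := by
    rintro rfl
    rw [zpow_zero, one_mul] at e
    rw [IsLocalRing.mem_maximalIdeal] at hf
    refine hf (IsUnit.of_mul_eq_one (⟨MvPolynomial.aeval c.fn B / MvPolynomial.aeval c.fn A, ?_⟩ :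
      ring (b := b) (σ := σ)) (Subtype.ext ?_))
    · rw [div_eq_mul_inv]
      exact Subalgebra.mul_mem _ (c.aeval_mem_ring B) (c.inv_aeval_mem_ring hA)
    · change (f : FunctionField b) * _ = 1
      rw [e, div_mul_div_cancel₀ (c.aeval_ne_zero hB), div_self (c.aeval_ne_zero hA)]
  obtain ⟨m, rfl⟩ : ∃ m : ℕ, k = 1 + m := ⟨(k - 1).toNat, by omega⟩
  refine ⟨c.unif ^ m * (MvPolynomial.aeval c.fn A / MvPolynomial.aeval c.fn B), ?_, ?_⟩
  · rw [div_eq_mul_inv]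
    exact Subalgebra.mul_mem _ (Subalgebra.pow_mem _ (c.fn_mem_ring _) m)
      (Subalgebra.mul_mem _ (c.aeval_mem_ring A) (c.inv_aeval_mem_ring hB))
  · rw [e, zpow_add₀ c.unif_ne_zero, zpow_one, zpow_natCast, mul_assoc]

/-- A larger `Z` meets the open stratum, for otherwise it would lie in some boundary divisor,
necessarily the same one. If `Z` were proper, some nonzero `F` would vanish on its part in the open
stratum. Write `F = unif ^ k * A / B`. Since `A * B` is nonzero somewhere on the divisor, it is
nonzero at some point of `Z` in the open stratum. There `unif` is nonzero as well, so `F` is, a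
contradiction. -/
theorem eq_univ_of_lt (c : Chart b σ) {Z : TopologicalSpace.IrreducibleCloseds (Mbar S)}
    (hZ : boundaryIrreducible σ < Z) : (Z : Set (Mbar S)) = Set.univ := by
  by_contra hne
  -- the general point of `Z` lies in the open stratum
  have hZo : ((Z : Set (Mbar S)) ∩ openStratum S).Nonempty := by
    by_contra hn
    obtain ⟨τ, hτ⟩ := exists_subset_boundaryDivisor Z.isIrreducible hn
    have hle : boundaryDivisor σ ⊆ Z := hZ.le
    have := eq_of_boundaryDivisor_subset (hle.trans hτ)
    subst this
    exact hZ.not_ge hτ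
  -- a function that vanishes on `Z`
  obtain ⟨x, hx, hxZ⟩ : ∃ x ∈ openStratum S, x ∉ (Z : Set (Mbar S)) := by
    by_contra hn
    push Not at hn
    exact hne (Set.univ_subset_iff.1 ((dense_openStratum (S := S)).closure_eq ▸
      closure_minimal hn Z.isClosed))
  obtain ⟨_, ⟨I, F, hI, rfl⟩, hxF, hF⟩ := isTopologicalBasis_basicOpen.exists_subset_of_mem_open
    (show x ∈ (Z : Set (Mbar S))ᶜ from hxZ) Z.isClosed.isOpen_compl
  have hFZ : ∀ y ∈ (Z : Set (Mbar S)), y ∈ openStratum S → value F y = 0 := by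
    intro y hy hyo
    by_contra h
    exact hF ⟨fun q _ => hyo q, h⟩ hy
  have hF0 : MvPolynomial.aeval (crossFun b) F ≠ 0 :=
    aeval_ne_zero_of_value_ne_zero (definedAt_of_mem_openStratum hx F) hxF.2
  obtain ⟨k, A, B, hA, hB, e⟩ := c.exists_factorization hF0
  have hAB : ¬ MvPolynomial.X c.s₀ ∣ A * B := fun h => by
    rcases MvPolynomial.X_prime.dvd_or_dvd h with h | h
    exacts [hA h, hB h]
  obtain ⟨d, hdσ, hd, hdv⟩ := c.exists_value_ne_zero hAB
  obtain ⟨y, hyZ, hyo, hyU⟩ := Z.isIrreducible.2 _ _ isOpen_openStratum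
    (isOpen_basicOpen (P := c.subst (A * B)) subset_rfl) hZo ⟨d, hZ.le hdσ, hd _, hdv⟩
  have hv : value (c.subst A) y ≠ 0 ∧ value (c.subst B) y ≠ 0 := by
    have := hyU.2
    rwa [subst, map_mul, value_mul, mul_ne_zero_iff] at this
  have hu := c.value_open y hyo
  have hB0 := c.aeval_ne_zero hB
  have hu0 := c.unif_ne_zero
  have hFy := hFZ y hyZ hyo
  -- Values are available only for polynomials, so the power of `unif` is moved to the side where
  -- its exponent is nonnegative.
  rcases Int.le_total 0 k with hk | hk
  · obtain ⟨m, rfl⟩ := Int.eq_ofNat_of_zero_le hk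
    have h3 : MvPolynomial.aeval (crossFun b)
        (F * c.subst B - c.poly c.s₀ ^ m * c.subst A) = 0 := by
      rw [map_sub, map_mul, map_mul, map_pow, c.aeval_subst, c.aeval_subst, e]
      change c.unif ^ (m : ℤ) * _ * _ - c.unif ^ m * _ = 0
      rw [zpow_natCast]
      field_simp
      ring
    have h4 := value_eq_zero h3 (definedAt_of_mem_openStratum hyo _)
    unfold value at h4 hv hu hFy
    simp only [map_sub, map_mul, map_pow, hFy, zero_mul, zero_sub, neg_eq_zero] at h4
    exact mul_ne_zero (pow_ne_zero m hu) hv.1 h4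
  · obtain ⟨m, hm⟩ := Int.eq_ofNat_of_zero_le (Int.neg_nonneg_of_nonpos hk)
    have h3 : MvPolynomial.aeval (crossFun b)
        (F * c.subst B * c.poly c.s₀ ^ m - c.subst A) = 0 := by
      rw [map_sub, map_mul, map_mul, map_pow, c.aeval_subst, c.aeval_subst, e]
      change c.unif ^ k * _ * _ * c.unif ^ m - _ = 0
      rw [show k = -(m : ℤ) by omega, zpow_neg, zpow_natCast]
      field_simp
      ring
    have h4 := value_eq_zero h3 (definedAt_of_mem_openStratum hyo _)
    unfold value at h4 hv hFy
    simp only [map_sub, map_mul, hFy, zero_mul, zero_sub, neg_eq_zero] at h4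
    exact hv.1 h4

theorem boundaryIrreducible_lt (b : Fin 3 ↪ S) (σ : StablePartition S) : boundaryIrreducible σ <
    ⟨Set.univ, isIrreducible_univ b, isClosed_univ⟩ := by
  refine lt_of_le_of_ne (fun x _ => trivial) fun h => ?_
  obtain ⟨x, hx⟩ := (isIrreducible_openStratum b).1
  have : x ∈ boundaryIrreducible σ := by
    rw [h]
    trivial
  exact Set.disjoint_left.1 (disjoint_openStratum_boundaryDivisor σ) hx this

theorem coheight_boundaryIrreducible (c : Chart b σ) :
    Order.coheight (boundaryIrreducible σ) = 1 := by
  have hmax : ∀ Z : TopologicalSpace.IrreducibleCloseds (Mbar S), boundaryIrreducible σ < Z →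
      Order.coheight Z = 0 := by
    intro Z hZ
    rw [Order.coheight_eq_zero]
    intro Z' _ x _
    have : x ∈ (Z : Set (Mbar S)) := by
      rw [c.eq_univ_of_lt hZ]
      trivial
    exact this
  refine le_antisymm ?_ ?_
  · refine Order.coheight_le_coe_iff.2 fun Z hZ => ?_
    rw [hmax Z hZ]
    exact one_pos
  · have := Order.coheight_add_one_le (boundaryIrreducible_lt b σ)
    exact le_trans (by simp) this

end Chart

end Chart

end ModuliZero

namespace ModuliZero

/-! ### Exterior forms -/

section Forms

/-- Both sides are alternating in the rows of `A`. So they need to be compared only when the rows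
are distinct standard basis vectors, where both produce the sign of a permutation. -/
theorem alternatingMap_matrix {R M N : Type*} [CommRing R] [AddCommGroup M] [Module R M]
    [AddCommGroup N] [Module R N] {n : ℕ} (f : M [⋀^Fin n]→ₗ[R] N) (v : Fin n → M)
    (A : Matrix (Fin n) (Fin n) R) :
    f (fun i => ∑ j, A i j • v j) = A.det • f v := by
  let L : (Fin n → R) →ₗ[R] M := Fintype.linearCombination R v
  have key : f.compLinearMap L =
      (LinearMap.toSpanSingleton R N (f v)).compAlternatingMap Matrix.detRowAlternating := by
    refine Module.Basis.ext_alternating (Pi.basisFun R (Fin n)) fun w hw => ?_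
    let π : Equiv.Perm (Fin n) := Equiv.ofBijective w (Finite.injective_iff_bijective.1 hw)
    have h1 : (fun i => L (Pi.basisFun R (Fin n) (w i))) = v ∘ π := by
      funext i
      simp [L, Fintype.linearCombination_apply, Pi.single_apply, π]
    have h2 : (Matrix.detRowAlternating (R := R) fun i => Pi.basisFun R (Fin n) (w i)) =
        (Equiv.Perm.sign π : ℤ) := by
      have := (Matrix.detRowAlternating (R := R) (n := Fin n)).map_perm
        (fun i => Pi.basisFun R (Fin n) i) π
      have h3 : (Matrix.detRowAlternating (R := R) fun i => Pi.basisFun R (Fin n) i) = 1 := by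
        have : (fun i => Pi.basisFun R (Fin n) i) = (1 : Matrix (Fin n) (Fin n) R) := by
          funext i j
          simp [Pi.single_apply, Matrix.one_apply, eq_comm]
        rw [this]
        exact Matrix.det_one
      rw [h3] at this
      refine this.trans ?_
      rw [Units.smul_def, zsmul_one]
    simp only [AlternatingMap.compLinearMap_apply, LinearMap.compAlternatingMap_apply,
      LinearMap.toSpanSingleton_apply, h2]
    rw [h1, f.map_perm, Units.smul_def, Int.cast_smul_eq_zsmul]
  exact DFunLike.congr_fun key A

variable {S : Type*} (b : Fin 3 ↪ S)

/-- The differentials of the indeterminates form a basis of the Kähler differentials. -/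
def kaehlerBasis : Module.Basis (Free b) (FunctionField b) (Ω[FunctionField b⁄ℂ]) :=
  (KaehlerDifferential.mvPolynomialBasis ℂ (Free b)).ofIsLocalizedModule (FunctionField b)
    (nonZeroDivisors (MvPolynomial (Free b) ℂ))
    (KaehlerDifferential.map ℂ ℂ (MvPolynomial (Free b) ℂ) (FunctionField b))

theorem kaehlerBasis_apply (s : Free b) : kaehlerBasis b s =
    KaehlerDifferential.D ℂ (FunctionField b) (algebraMap (MvPolynomial (Free b) ℂ) (FunctionField b) (MvPolynomial.X s)) := by
  unfold kaehlerBasis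
  rw [Module.Basis.ofIsLocalizedModule_apply, KaehlerDifferential.mvPolynomialBasis_apply,
    KaehlerDifferential.map_D]

theorem tCoord_eq (s : Free b) : tCoord b s = algebraMap (MvPolynomial (Free b) ℂ) (FunctionField b) (MvPolynomial.X s) := by
  unfold tCoord crossFun
  change finPart (crossRatio (generic b (b 0)) (generic b (b 1)) (generic b (b 2))
    (generic b s.1)) = _
  rw [generic_eq_configuration]
  simp only [configuration_zero, configuration_one, configuration_two, configuration_free,
    crossRatio_zero_one_infty, finPart_coe]

theorem tCoord_ne_algebraMap (s : Free b) (a : ℂ) :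
    tCoord b s ≠ algebraMap ℂ (FunctionField b) a := by
  rw [tCoord_eq, IsScalarTower.algebraMap_apply ℂ (MvPolynomial (Free b) ℂ)]
  intro h
  have := congrArg (MvPolynomial.eval fun _ => a + 1)
    (FaithfulSMul.algebraMap_injective (MvPolynomial (Free b) ℂ) (FunctionField b) h)
  simp [MvPolynomial.algebraMap_eq] at this

theorem tCoord_sub_ne_zero (s : Free b) (ε : Fin 2) :
    tCoord b s - ((ε : ℕ) : FunctionField b) ≠ 0 := by
  rw [sub_ne_zero]
  simpa using tCoord_ne_algebraMap b s (ε : ℕ)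

/-- The differentials form a basis, and the determinant with respect to it takes the value `1` on
this product. -/
theorem ιMulti_D_tCoord_ne_zero {n : ℕ} (e : Fin n ≃ Free b) :
    exteriorPower.ιMulti (FunctionField b) n (fun i =>
      KaehlerDifferential.D ℂ (FunctionField b) (tCoord b (e i))) ≠ 0 := by
  intro h
  let B := (kaehlerBasis b).reindex e.symm
  have h1 : (fun i => KaehlerDifferential.D ℂ (FunctionField b) (tCoord b (e i))) = B := by
    funext i
    rw [tCoord_eq, ← kaehlerBasis_apply]
    simp [B]
  have h2 := congrArg (exteriorPower.alternatingMapLinearEquiv B.det) h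
  rw [h1, exteriorPower.alternatingMapLinearEquiv_apply_ιMulti, Module.Basis.det_self, map_zero] at h2
  exact one_ne_zero h2

theorem Omega_eq_smul (ε : Free b → Fin 2) {n : ℕ} (e : Fin n ≃ Free b) : Omega b ε e =
    (∏ i, (tCoord b (e i) - ((ε (e i) : ℕ) : FunctionField b))⁻¹) •
      exteriorPower.ιMulti (FunctionField b) n (fun i =>
        KaehlerDifferential.D ℂ (FunctionField b) (tCoord b (e i))) := by
  unfold Omega
  rw [← AlternatingMap.map_smul_univ]

theorem Omega_ne_zero (ε : Free b → Fin 2) {n : ℕ} (e : Fin n ≃ Free b) : Omega b ε e ≠ 0 := by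
  rw [Omega_eq_smul]
  exact smul_ne_zero (Finset.prod_ne_zero_iff.2 fun i _ =>
    inv_ne_zero (tCoord_sub_ne_zero b _ _)) (ιMulti_D_tCoord_ne_zero b e)

theorem D_aeval {ι K : Type*} [Fintype ι] [Field K] [Algebra ℂ K] (a : ι → K)
    (G : MvPolynomial ι ℂ) : KaehlerDifferential.D ℂ K (MvPolynomial.aeval a G) =
      ∑ i, MvPolynomial.aeval a (MvPolynomial.pderiv i G) • KaehlerDifferential.D ℂ K (a i) := by
  classical
  induction G using MvPolynomial.induction_on with
  | C c => simp
  | add p q hp hq => simp only [map_add, hp, hq, add_smul, Finset.sum_add_distrib]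
  | mul_X p j hp =>
    simp only [map_mul, MvPolynomial.aeval_X, Derivation.leibniz, hp, smul_eq_mul, map_add,
      add_smul, Finset.sum_add_distrib, MvPolynomial.pderiv_X, Finset.smul_sum, smul_smul]
    congr 1
    rw [Finset.sum_eq_single j]
    · simp
    · intro i _ hi
      simp [hi.symm]
    · simp

end Forms

/-! ### Regular forms and pole orders in local coordinates -/

namespace Chart

variable {S : Type*} [Fintype S] [DecidableEq S] {b : Fin 3 ↪ S} {σ : StablePartition S}
  (c : Chart b σ)

/-- The differential of a function in the local ring is a combination of the differentials of the
local coordinates with coefficients in the local ring. -/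
theorem exists_D_eq_sum {n : ℕ} (e : Fin n ≃ Free b) (f : ring (b := b) (σ := σ)) :
    ∃ r : Fin n → ring (b := b) (σ := σ), KaehlerDifferential.D ℂ (FunctionField b) f =
      ∑ i, (r i : FunctionField b) • KaehlerDifferential.D ℂ (FunctionField b) (c.fn (e i)) := by
  have : Fintype (Free b) := Fintype.ofEquiv _ e
  obtain ⟨A, B, hB, hf⟩ := c.exists_eq_div f.2
  have hBinv := c.inv_aeval_mem_ring hB
  -- The coefficients come from the quotient rule. They lie in the ring since the inverse of the
  -- denominator does.
  have hmem : ∀ s, (MvPolynomial.aeval c.fn B)⁻¹ ^ 2 *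
      (MvPolynomial.aeval c.fn B * MvPolynomial.aeval c.fn (MvPolynomial.pderiv s A) -
        MvPolynomial.aeval c.fn A * MvPolynomial.aeval c.fn (MvPolynomial.pderiv s B)) ∈
      ring (b := b) (σ := σ) := fun s =>
    Subalgebra.mul_mem _ (Subalgebra.pow_mem _ hBinv 2) (Subalgebra.sub_mem _
      (Subalgebra.mul_mem _ (c.aeval_mem_ring _) (c.aeval_mem_ring _))
      (Subalgebra.mul_mem _ (c.aeval_mem_ring _) (c.aeval_mem_ring _)))
  refine ⟨fun i => ⟨_, hmem (e i)⟩, ?_⟩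
  have h1 : ∑ i, ((⟨_, hmem (e i)⟩ : ring (b := b) (σ := σ)) : FunctionField b) •
      KaehlerDifferential.D ℂ (FunctionField b) (c.fn (e i)) =
      ∑ s, ((MvPolynomial.aeval c.fn B)⁻¹ ^ 2 *
      (MvPolynomial.aeval c.fn B * MvPolynomial.aeval c.fn (MvPolynomial.pderiv s A) -
        MvPolynomial.aeval c.fn A * MvPolynomial.aeval c.fn (MvPolynomial.pderiv s B))) •
      KaehlerDifferential.D ℂ (FunctionField b) (c.fn s) :=
    Equiv.sum_comp e (fun s => ((MvPolynomial.aeval c.fn B)⁻¹ ^ 2 *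
      (MvPolynomial.aeval c.fn B * MvPolynomial.aeval c.fn (MvPolynomial.pderiv s A) -
        MvPolynomial.aeval c.fn A * MvPolynomial.aeval c.fn (MvPolynomial.pderiv s B))) •
      KaehlerDifferential.D ℂ (FunctionField b) (c.fn s))
  rw [h1, hf, Derivation.leibniz_div, D_aeval, D_aeval, Finset.smul_sum, Finset.smul_sum,
    ← Finset.sum_sub_distrib, Finset.smul_sum]
  refine Finset.sum_congr rfl fun s _ => ?_
  rw [smul_smul, smul_smul, ← sub_smul, smul_smul, inv_pow]

/-- The volume form of the local coordinates. -/
def volume {n : ℕ} (e : Fin n ≃ Free b) : RatForm b n :=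
  exteriorPower.ιMulti (FunctionField b) n
    (fun i => KaehlerDifferential.D ℂ (FunctionField b) (c.fn (e i)))

theorem volume_mem_regularForms {n : ℕ} (e : Fin n ≃ Free b) :
    c.volume e ∈ regularForms b n (boundaryIrreducible σ) :=
  Submodule.subset_span ⟨fun i => ⟨_, c.fn_mem_ring (e i)⟩, rfl⟩

/-- Differentials of functions in the local ring are combinations of coordinate differentials over
that ring, so their product is the volume form times a determinant with entries in the ring. -/
theorem exists_eq_smul_volume {n : ℕ} (e : Fin n ≃ Free b) {ω : RatForm b n}
    (hω : ω ∈ regularForms b n (boundaryIrreducible σ)) :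
    ∃ r ∈ ring (b := b) (σ := σ), ω = r • c.volume e := by
  unfold regularForms at hω
  induction hω using Submodule.span_induction with
  | mem ω h =>
    obtain ⟨f, rfl⟩ := h
    choose r hr using fun i => c.exists_D_eq_sum e (f i)
    let A : Matrix (Fin n) (Fin n) (ring (b := b) (σ := σ)) := fun i j => r i j
    refine ⟨((A.det : ring (b := b) (σ := σ)) : FunctionField b), A.det.2, ?_⟩
    have h2 : ((A.det : ring (b := b) (σ := σ)) : FunctionField b) =
        (A.map (ring (b := b) (σ := σ)).val).det :=
      RingHom.map_det (ring (b := b) (σ := σ)).val.toRingHom A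
    rw [h2]
    refine Eq.trans ?_ (alternatingMap_matrix (exteriorPower.ιMulti (FunctionField b) n)
      (fun i => KaehlerDifferential.D ℂ (FunctionField b) (c.fn (e i)))
      (A.map (ring (b := b) (σ := σ)).val))
    congr 1
    funext i
    exact hr i
  | zero => exact ⟨0, Subalgebra.zero_mem _, by simp⟩
  | add ω ω' _ _ h h' =>
    obtain ⟨r, hr, rfl⟩ := h
    obtain ⟨r', hr', rfl⟩ := h'
    exact ⟨r + r', Subalgebra.add_mem _ hr hr', (add_smul _ _ _).symm⟩
  | smul a ω _ h =>
    obtain ⟨r, hr, rfl⟩ := h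
    exact ⟨a * r, Subalgebra.mul_mem _ a.2 hr, (mul_smul (a : FunctionField b) r _).symm⟩

theorem mem_regularForms_iff {n : ℕ} (e : Fin n ≃ Free b) (hη : c.volume e ≠ 0)
    {r : FunctionField b} : r • c.volume e ∈ regularForms b n (boundaryIrreducible σ) ↔
      r ∈ ring (b := b) (σ := σ) := by
  constructor
  · intro h
    obtain ⟨r', hr', h'⟩ := c.exists_eq_smul_volume e h
    rwa [smul_left_injective (FunctionField b) hη h']
  · intro h
    exact Submodule.smul_mem _ (⟨r, h⟩ : ring (b := b) (σ := σ)) (c.volume_mem_regularForms e)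

/-- The order of the pole along the divisor of a form that is written in local coordinates. -/
theorem isLeast_pole {n : ℕ} (e : Fin n ≃ Free b) {ω : RatForm b n} (hω : ω ≠ 0)
    {u : FunctionField b} (hu : u ∈ ring (b := b) (σ := σ)) (hu' : u⁻¹ ∈ ring (b := b) (σ := σ))
    {k : ℤ} (hk : -1 ≤ k) (h : ω = (c.unif ^ k * u) • c.volume e) :
    IsLeast {m : ℕ | ∀ f ∈ IsLocalRing.maximalIdeal (ring (b := b) (σ := σ)) ^ m,
      f • ω ∈ regularForms b n (boundaryIrreducible σ)} (if k = -1 then 1 else 0) := by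
  have hη : c.volume e ≠ 0 := fun h0 => hω (by rw [h, h0, smul_zero])
  have hu0 : u ≠ 0 := fun h0 => hω (by rw [h, h0, mul_zero, zero_smul])
  have hmem : ∀ f : ring (b := b) (σ := σ), f • ω ∈ regularForms b n (boundaryIrreducible σ) ↔
      (f : FunctionField b) * (c.unif ^ k * u) ∈ ring (b := b) (σ := σ) := by
    intro f
    rw [← c.mem_regularForms_iff e hη, mul_smul, ← h]
    rfl
  split_ifs with hk1
  · subst hk1
    constructor
    · intro f hf
      rw [pow_one] at hf
      rw [hmem]
      obtain ⟨g, hg, hfg⟩ := c.exists_eq_unif_mul hf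
      have : (f : FunctionField b) * (c.unif ^ (-1 : ℤ) * u) = g * u := by
        rw [hfg, zpow_neg_one]
        have := c.unif_ne_zero
        field_simp
      rw [this]
      exact Subalgebra.mul_mem _ hg hu
    · intro m hm
      by_contra hlt
      -- The zeroth power of the maximal ideal contains `1`, so `ω` itself would be regular, and
      -- division by the unit `u` would put `unif⁻¹` into the ring.
      obtain rfl : m = 0 := by omega
      have h1 := (hmem 1).1 (hm 1 (by simp))
      refine c.inv_unif_notMem_ring ?_
      have h2 := Subalgebra.mul_mem _ h1 hu'
      rw [zpow_neg_one] at h2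
      simpa [mul_assoc, hu0] using h2
  · obtain ⟨m, rfl⟩ : ∃ m : ℕ, k = m := ⟨k.toNat, by omega⟩
    refine ⟨fun f _ => ?_, fun _ _ => Nat.zero_le _⟩
    rw [hmem, zpow_natCast]
    exact Subalgebra.mul_mem _ f.2 (Subalgebra.mul_mem _
      (Subalgebra.pow_mem _ (c.fn_mem_ring _) m) hu)

end Chart

end ModuliZero

namespace ModuliZero

/-! ### Construction of the charts -/

/-- Distinct points of the projective line in the affine coordinate that takes the values
`0, 1, ∞` at three of them. -/
theorem exists_affine {S F : Type*} [Field F] {m : S → OnePoint F} (hm : Function.Injective m)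
    (β : Fin 3 ↪ S) : ∃ v : S → F, v (β 0) = 0 ∧ v (β 1) = 1 ∧ Set.InjOn v {β 2}ᶜ ∧
      ∀ q : Fin 4 ↪ S, q 2 = β 2 → finPart (crossRatio (m (q 0)) (m (q 1)) (m (q 2)) (m (q 3))) =
        (v (q 3) - v (q 0)) / (v (q 1) - v (q 0)) := by
  classical
  obtain ⟨g, hg⟩ := exists_smul_eq_crossRatio (a := m (β 0)) (b := m (β 1)) (c := m (β 2))
    (hm.ne (by simp)) (hm.ne (by simp)) (hm.ne (by simp))
  have hginj := (MulAction.injective (β := OnePoint F) g)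
  have e2 : g • m (β 2) = ∞ := by
    rw [hg, crossRatio_eq_infty_iff (hm.ne (by simp))]
  have e : ∀ s, s ≠ β 2 → g • m s = ((finPart (g • m s) : F) : OnePoint F) := by
    intro s hs
    rw [coe_finPart]
    rw [← e2]
    exact hginj.ne (hm.ne hs)
  refine ⟨fun s => finPart (g • m s), ?_, ?_, ?_, ?_⟩
  · simp only [hg]
    rw [finPart_crossRatio, bracket_eq_zero_iff.2 rfl]
    simp
  · simp only [hg]
    rw [finPart_crossRatio, mul_comm, div_self]
    exact mul_ne_zero (fun h => hm.ne (by simp) (bracket_eq_zero_iff.1 h))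
      (fun h => hm.ne (by simp) (bracket_eq_zero_iff.1 h))
  · intro s hs s' hs' h
    refine hm (hginj ?_)
    change finPart (g • m s) = finPart (g • m s') at h
    change g • m s = g • m s'
    rw [e s hs, e s' hs', h]
  · intro q hq
    have hne : ∀ i, i ≠ 2 → q i ≠ β 2 := fun i hi => by
      rw [← hq]
      exact q.injective.ne hi
    rw [← crossRatio_smul g, hq, e2, e (q 0) (hne 0 (by decide)), e (q 1) (hne 1 (by decide)),
      e (q 3) (hne 3 (by decide)), finPart_crossRatio]
    simp only [bracket, homog_coe, homog_infty]
    -- Brackets with the third point, which is at infinity, equal `-1`; the signs cancel.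
    rw [← neg_div_neg_eq]
    congr 1 <;> ring

/-- The labels `β 0, β 1, β 2, s`. -/
def snocQuad {S : Type*} (β : Fin 3 ↪ S) {s : S} (hs : s ∉ Set.range β) : Fin 4 ↪ S :=
  ⟨Fin.snoc (α := fun _ => S) β s, Fin.snoc_injective_iff.2 ⟨β.injective, hs⟩⟩

theorem generic_injective {S : Type*} (b : Fin 3 ↪ S) : Function.Injective (generic b) := by
  rw [generic_eq_configuration]
  refine configuration_injective _ ?_ fun s => ?_
  · intro s s' h
    exact MvPolynomial.X_injective (FaithfulSMul.algebraMap_injective _ _ h)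
  · rw [← tCoord_eq]
    constructor
    · simpa using tCoord_ne_algebraMap b s 0
    · simpa using tCoord_ne_algebraMap b s 1

theorem adjoin_range_tCoord {S : Type*} (b : Fin 3 ↪ S) :
    IntermediateField.adjoin ℂ (Set.range (tCoord b)) = ⊤ := by
  have h : tCoord b = fun s => algebraMap (MvPolynomial (Free b) ℂ) (FunctionField b)
    (MvPolynomial.X s) := funext (tCoord_eq b)
  rw [eq_top_iff]
  intro x _
  rw [h, IntermediateField.mem_adjoin_range_iff]
  obtain ⟨A, B, -, rfl⟩ := IsFractionRing.div_surjective (A := MvPolynomial (Free b) ℂ) x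
  have e : ∀ A : MvPolynomial (Free b) ℂ, MvPolynomial.aeval (fun s => algebraMap
      (MvPolynomial (Free b) ℂ) (FunctionField b) (MvPolynomial.X s)) A = algebraMap _ _ A := by
    intro A
    exact (MvPolynomial.aeval_algebraMap_apply _ MvPolynomial.X A).trans
      (by rw [MvPolynomial.aeval_X_left_apply])
  exact ⟨A, B, by rw [e, e]⟩

variable {S : Type*} [Fintype S] [DecidableEq S]

/-- The choices on which a chart at the boundary divisor of `σ` depends: the part `part` of `σ`
that contains at most one of the labels `0, 1, ∞`, two labels `anchor` and `free` in it, of which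
`anchor` is one of `0, 1, ∞` if possible, and an ordering `β` of these three labels such that
the last one is not in `part`. -/
structure Frame (b : Fin 3 ↪ S) (σ : StablePartition S) where
  β : Fin 3 ↪ S
  part : Finset S
  mem_parts : part ∈ σ.1.parts
  anchor : S
  anchor_mem : anchor ∈ part
  free : Free b
  free_mem : free.1 ∈ part
  free_ne : free.1 ≠ anchor
  two_notMem : β 2 ∉ part
  notMem_range : ∀ s ∈ part, s ≠ anchor → s ∉ Set.range b
  -- In the second case, needed when `∞` lies in the part, the affine coordinates are the inverses
  -- of the `t s`, so that the labels of the part come together at the finite point `0`.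
  β_eq : β = b ∨ (β 0 = b 2 ∧ β 1 = b 1 ∧ β 2 = b 0 ∧ anchor = b 2)

namespace Frame

variable {b : Fin 3 ↪ S} {σ : StablePartition S} (f : Frame b σ)

theorem range_β : Set.range f.β = Set.range b := by
  rcases f.β_eq with h | ⟨h0, h1, h2, -⟩
  · rw [h]
  · ext s
    simp only [Set.mem_range, Fin.exists_fin_succ]
    simp [h0, h1, h2]
    tauto

theorem notMem_range_β (s : Free b) : s.1 ∉ Set.range f.β := by
  rw [f.range_β]
  exact s.2

theorem anchor_ne : f.anchor ≠ f.β 2 := fun h => f.two_notMem (h ▸ f.anchor_mem)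

theorem free_ne_two (s : Free b) : s.1 ≠ f.β 2 := fun h => f.notMem_range_β s ⟨2, h.symm⟩

/-- The label is in the chosen part and different from the anchor. -/
def Inner (s : Free b) : Prop := s.1 ∈ f.part ∧ s.1 ≠ f.anchor

theorem inner_free : f.Inner f.free := ⟨f.free_mem, f.free_ne⟩

theorem not_two_mem {i j : Fin 3} (hij : i ≠ j) : ¬ (f.β i ∈ f.part ∧ f.β j ∈ f.part) := by
  rintro ⟨hi, hj⟩
  have h : ∀ i, f.β i ∈ f.part → f.β i = f.anchor := by
    intro i hi
    by_contra h
    refine f.notMem_range _ hi h ?_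
    rw [← f.range_β]
    exact ⟨i, rfl⟩
  exact hij (f.β.injective ((h i hi).trans (h j hj).symm))

/-- The coordinate of the label `s` when `β 0, β 1, β 2` are put at `0, 1, ∞`. -/
def coordPoly (s : S) : MvPolynomial (Fin 4 ↪ S) ℂ :=
  open Classical in
  if h : s ∈ Set.range f.β then (if s = f.β 1 then 1 else 0) else MvPolynomial.X (snocQuad f.β h)

/-- The labels `anchor, free, β 2, s`. -/
def innerQuad {s : Free b} (h : f.Inner s) (h' : s ≠ f.free) : Fin 4 ↪ S :=
  quad (k := f.anchor) (l := f.free.1) (i := f.β 2) (j := s.1) f.free_ne.symm f.anchor_ne h.2.symm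
    (f.free_ne_two _) (fun e => h' (Subtype.ext e.symm)) (f.free_ne_two _).symm

/-- The local coordinates. -/
def poly (s : Free b) : MvPolynomial (Fin 4 ↪ S) ℂ :=
  open Classical in
  -- Labels outside of the part, and an anchor that is not one of `0, 1, ∞`, keep their affine
  -- coordinate. The difference of `free` and `anchor` is the scale of the colliding cluster and the
  -- equation of the divisor. The other labels get their position relative to this scale, which is
  -- their coordinate on the inner component.
  if h : f.Inner s then
    if h' : s = f.free then f.coordPoly s.1 - f.coordPoly f.anchor
    else MvPolynomial.X (f.innerQuad h h')
  else f.coordPoly s.1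

theorem poly_of_not_inner {s : Free b} (h : ¬ f.Inner s) : f.poly s = f.coordPoly s.1 := by
  rw [poly, dif_neg h]

theorem poly_free : f.poly f.free = f.coordPoly f.free.1 - f.coordPoly f.anchor := by
  rw [poly, dif_pos f.inner_free, dif_pos rfl]

theorem poly_of_inner {s : Free b} (h : f.Inner s) (h' : s ≠ f.free) :
    f.poly s = MvPolynomial.X (f.innerQuad h h') := by
  rw [poly, dif_pos h, dif_neg h']

/-- The homomorphism `φ` computes the cross-ratios of labels with affine coordinates `v`. -/
structure Realizes {F : Type*} [Field F] (φ : MvPolynomial (Fin 4 ↪ S) ℂ →+* F) (v : S → F) :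
    Prop where
  zero : v (f.β 0) = 0
  one : v (f.β 1) = 1
  injOn : Set.InjOn v {f.β 2}ᶜ
  map_X : ∀ q, q 2 = f.β 2 →
    φ (MvPolynomial.X q) = (v (q 3) - v (q 0)) / (v (q 1) - v (q 0))

namespace Realizes

variable {f} {F : Type*} [Field F] {φ : MvPolynomial (Fin 4 ↪ S) ℂ →+* F} {v : S → F}

theorem map_coordPoly (h : f.Realizes φ v) {s : S} (hs : s ≠ f.β 2) :
    φ (f.coordPoly s) = v s := by
  unfold coordPoly
  split_ifs with h₁ h₂
  · rw [h₂, h.one, map_one]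
  · obtain ⟨i, rfl⟩ := h₁
    fin_cases i
    · simpa using h.zero.symm
    · exact absurd rfl h₂
    · exact absurd rfl hs
  · rw [h.map_X _ rfl]
    change (v s - v (f.β 0)) / (v (f.β 1) - v (f.β 0)) = v s
    rw [h.zero, h.one]
    simp

theorem free_sub_ne_zero (h : f.Realizes φ v) : v f.free.1 - v f.anchor ≠ 0 :=
  sub_ne_zero.2 fun e => f.free_ne (h.injOn (f.free_ne_two _) f.anchor_ne e)

theorem map_poly_of_not_inner (h : f.Realizes φ v) {s : Free b} (hs : ¬ f.Inner s) :
    φ (f.poly s) = v s.1 := by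
  rw [f.poly_of_not_inner hs, h.map_coordPoly (f.free_ne_two s)]

theorem map_poly_free (h : f.Realizes φ v) :
    φ (f.poly f.free) = v f.free.1 - v f.anchor := by
  rw [f.poly_free, map_sub, h.map_coordPoly (f.free_ne_two _), h.map_coordPoly f.anchor_ne]

theorem map_poly_of_inner (h : f.Realizes φ v) {s : Free b} (hs : f.Inner s) (hs' : s ≠ f.free) :
    φ (f.poly s) = (v s.1 - v f.anchor) / (v f.free.1 - v f.anchor) := by
  rw [f.poly_of_inner hs hs', h.map_X _ rfl]
  rfl

end Realizes

theorem exists_realizes {F : Type*} [Field F] {m : S → OnePoint F} (hm : Function.Injective m)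
    {φ : MvPolynomial (Fin 4 ↪ S) ℂ →+* F} (hφ : ∀ q, φ (MvPolynomial.X q) =
      finPart (crossRatio (m (q 0)) (m (q 1)) (m (q 2)) (m (q 3)))) :
    ∃ v, f.Realizes φ v := by
  obtain ⟨v, h0, h1, h2, h3⟩ := exists_affine hm f.β
  exact ⟨v, h0, h1, h2, fun q hq => (hφ q).trans (h3 q hq)⟩

theorem exists_realizes_of_mem_openStratum {x : Mbar S} (hx : x ∈ openStratum S) :
    ∃ v, f.Realizes (MvPolynomial.eval fun q => finPart (coord q x)) v := by
  obtain ⟨C⟩ := x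
  obtain ⟨u, hu⟩ := exists_pos_injective hx b
  refine f.exists_realizes hu fun q => ?_
  rw [MvPolynomial.eval_X]
  change finPart (C.cross q) = _
  rw [C.cross_eq]
  exact ⟨hu.ne (by simp), hu.ne (by simp), hu.ne (by simp)⟩

theorem exists_realizes_crossFun :
    ∃ v, f.Realizes (MvPolynomial.aeval (crossFun b)).toRingHom v := by
  refine f.exists_realizes (generic_injective b) fun q => ?_
  change MvPolynomial.aeval (crossFun b) (MvPolynomial.X q) = _
  rw [MvPolynomial.aeval_X]
  rfl

/-- The affine coordinates of the labels as rational functions. -/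
def affine : S → FunctionField b := f.exists_realizes_crossFun.choose

theorem realizes_affine : f.Realizes (MvPolynomial.aeval (crossFun b)).toRingHom f.affine :=
  f.exists_realizes_crossFun.choose_spec

theorem affine_eq_crossFun (s : Free b) :
    f.affine s.1 = crossFun b (snocQuad f.β (f.notMem_range_β s)) := by
  have := f.realizes_affine.map_coordPoly (f.free_ne_two s)
  rw [← this, coordPoly, dif_neg (f.notMem_range_β s)]
  exact (MvPolynomial.aeval_X _ _)

theorem affine_eq_tCoord (h : f.β = b) (s : Free b) : f.affine s.1 = tCoord b s := by
  rw [affine_eq_crossFun]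
  unfold tCoord snocQuad
  congr 2
  rw [h]

theorem affine_eq_inv_tCoord (h0 : f.β 0 = b 2) (h1 : f.β 1 = b 1) (h2 : f.β 2 = b 0)
    (s : Free b) : f.affine s.1 = (tCoord b s)⁻¹ := by
  rw [affine_eq_crossFun, tCoord_eq]
  change finPart (crossRatio (generic b (f.β 0)) (generic b (f.β 1)) (generic b (f.β 2))
    (generic b s.1)) = _
  rw [h0, h1, h2, generic_eq_configuration]
  simp only [configuration_zero, configuration_one, configuration_two, configuration_free,
    finPart_crossRatio, bracket, homog_coe, homog_infty]
  rw [← neg_div_neg_eq]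
  simp

/-- The blow-up can be undone: the anchor is constant or itself a coordinate, scale and relative
position give back the affine coordinate of each inner label, and `t s` is this coordinate or its
inverse. -/
theorem adjoin_eq_top : IntermediateField.adjoin ℂ
    (Set.range fun s => MvPolynomial.aeval (crossFun b) (f.poly s)) = ⊤ := by
  rw [← top_le_iff, ← adjoin_range_tCoord b, IntermediateField.adjoin_le_iff]
  set L := IntermediateField.adjoin ℂ
    (Set.range fun s => MvPolynomial.aeval (crossFun b) (f.poly s))
  have hr := f.realizes_affine
  have hmem : ∀ s, MvPolynomial.aeval (crossFun b) (f.poly s) ∈ L := fun s =>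
    IntermediateField.subset_adjoin _ _ ⟨s, rfl⟩
  have hnot : ∀ s : Free b, ¬ f.Inner s → f.affine s.1 ∈ L := by
    intro s hs
    have := hmem s
    rwa [show MvPolynomial.aeval (crossFun b) (f.poly s) = _ from hr.map_poly_of_not_inner hs]
      at this
  have hanchor : f.affine f.anchor ∈ L := by
    by_cases h : f.anchor ∈ Set.range b
    · rw [← f.range_β] at h
      obtain ⟨i, hi⟩ := h
      rw [← hi]
      fin_cases i
      · exact hr.zero.symm ▸ L.zero_mem
      · exact hr.one.symm ▸ L.one_mem
      · exact absurd hi.symm f.anchor_ne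
    · exact hnot ⟨f.anchor, h⟩ fun h => h.2 rfl
  have hfree : f.affine f.free.1 - f.affine f.anchor ∈ L := by
    have := hmem f.free
    rwa [show MvPolynomial.aeval (crossFun b) (f.poly f.free) = _ from hr.map_poly_free] at this
  have key : ∀ s : Free b, f.affine s.1 ∈ L := by
    intro s
    by_cases hs : f.Inner s
    · by_cases hs' : s = f.free
      · subst hs'
        simpa using L.add_mem hfree hanchor
      · have := hmem s
        rw [show MvPolynomial.aeval (crossFun b) (f.poly s) = _ from hr.map_poly_of_inner hs hs']
          at this
        have h1 := L.add_mem (L.mul_mem this hfree) hanchor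
        rwa [div_mul_cancel₀ _ hr.free_sub_ne_zero, sub_add_cancel] at h1
    · exact hnot s hs
  rintro _ ⟨s, rfl⟩
  rcases f.β_eq with h | ⟨h0, h1, h2, -⟩
  · rw [← f.affine_eq_tCoord h]
    exact key s
  · have := L.inv_mem (key s)
    rwa [f.affine_eq_inv_tCoord h0 h1 h2, inv_inv] at this

theorem value_poly_free_of_mem_openStratum {x : Mbar S} (hx : x ∈ openStratum S) :
    value (f.poly f.free) x ≠ 0 := by
  obtain ⟨v, hv⟩ := f.exists_realizes_of_mem_openStratum hx
  unfold value
  rw [hv.map_poly_free]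
  exact hv.free_sub_ne_zero

theorem coord_snocQuad {C : StableCurve S} {u : Fin C.size}
    (hu : C.Separates u (f.β 0) (f.β 1) (f.β 2)) {s : S} (hs : s ∉ Set.range f.β) :
    coord (snocQuad f.β hs) (Quot.mk _ C : Mbar S) =
      crossRatio (C.pos u (f.β 0)) (C.pos u (f.β 1)) (C.pos u (f.β 2)) (C.pos u s) :=
  C.cross_eq (q := snocQuad f.β hs) hu

theorem value_coordPoly {C : StableCurve S} {u : Fin C.size}
    (hu : C.Separates u (f.β 0) (f.β 1) (f.β 2)) {s : S} (hs : s ≠ f.β 2) :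
    value (f.coordPoly s) (Quot.mk _ C : Mbar S) =
      finPart (crossRatio (C.pos u (f.β 0)) (C.pos u (f.β 1)) (C.pos u (f.β 2)) (C.pos u s)) := by
  have h0 : finPart (crossRatio (C.pos u (f.β 0)) (C.pos u (f.β 1)) (C.pos u (f.β 2))
      (C.pos u (f.β 0))) = 0 := by
    rw [finPart_crossRatio, bracket_eq_zero_iff.2 rfl, zero_mul, zero_div]
  unfold coordPoly value
  split_ifs with h₁ h₂
  · rw [h₂, finPart_crossRatio, mul_comm (bracket _ _), map_one, div_self]
    exact mul_ne_zero (fun h => hu.2.1 (bracket_eq_zero_iff.1 h))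
      (fun h => hu.1 (bracket_eq_zero_iff.1 h).symm)
  · obtain ⟨i, rfl⟩ := h₁
    fin_cases i
    · exact (map_zero _).trans h0.symm
    · exact absurd rfl h₂
    · exact absurd rfl hs
  · rw [MvPolynomial.eval_X, f.coord_snocQuad hu]

theorem definedAt_coordPoly {C : StableCurve S} {u : Fin C.size}
    (hu : C.Separates u (f.β 0) (f.β 1) (f.β 2)) {s : S} (hs : C.pos u s ≠ C.pos u (f.β 2)) :
    DefinedAt (f.coordPoly s) (Quot.mk _ C : Mbar S) := by
  unfold coordPoly
  split_ifs with h₁ h₂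
  · intro q hq
    simp at hq
  · intro q hq
    simp at hq
  · intro q hq
    rw [MvPolynomial.vars_X, Finset.mem_singleton] at hq
    rw [hq, f.coord_snocQuad hu]
    exact fun h => hs ((crossRatio_eq_infty_iff hu.1).1 h)

/-- The component that separates `β 0, β 1, β 2` lies outside of the node, as at least two of these
labels are not in `part`. From it, `free` and `anchor` are seen in the same direction. Both
coordinates therefore have the same value, even if this is the default value `0` at infinity. -/
theorem value_poly_free_of_mem_boundaryDivisor {x : Mbar S} (hx : x ∈ boundaryDivisor σ) :
    value (f.poly f.free) x = 0 := by
  obtain ⟨C⟩ := x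
  obtain ⟨v, w, h, hP⟩ := (mk_mem_boundaryDivisor_iff f.mem_parts C).1 hx
  obtain ⟨u, hu⟩ := C.exists_separates (i := f.β 0) (j := f.β 1) (k := f.β 2)
      (by simp) (by simp) (by simp)
  have hmem : ∀ s, s ∈ C.behind h ↔ s ∈ f.part := fun s => by
    rw [← Finset.mem_coe]
    change s ∈ {s | C.pos v s = C.node h} ↔ _
    rw [hP]
  have hside : ¬ C.OnSide v w u := by
    intro hs
    have key : ∀ i j, f.β i ∉ f.part → f.β j ∉ f.part → C.pos u (f.β i) = C.pos u (f.β j) :=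
      fun i j hi hj => C.pos_eq_pos_of_notMem h hs (by rwa [hmem]) (by rwa [hmem])
    by_cases h0 : f.β 0 ∈ f.part
    · exact hu.2.1 (key 1 2 (fun h1 => f.not_two_mem (i := 0) (j := 1) (by decide) ⟨h0, h1⟩)
        f.two_notMem)
    · exact hu.2.2 (key 0 2 h0 f.two_notMem)
  have hpos := C.pos_eq_pos_of_mem h hside ((hmem _).2 f.free_mem) ((hmem _).2 f.anchor_mem)
  have h1 := f.value_coordPoly hu (f.free_ne_two f.free)
  have h2 := f.value_coordPoly hu f.anchor_ne
  unfold value at h1 h2 ⊢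
  change MvPolynomial.eval _ _ = 0
  rw [f.poly_free, map_sub]
  refine sub_eq_zero.2 (h1.trans (Eq.trans ?_ h2.symm))
  rw [hpos]

/-- The affine coordinate of the label `s` in the configuration in which `β 0, β 1, β 2` are at
`0, 1, ∞`, and the other labels at `z`. -/
def outerValue (z : Free b → ℂ) (s : S) : ℂ :=
  open Classical in
  if h : s ∈ Set.range b then (if s = f.β 1 then 1 else 0) else z ⟨s, h⟩

theorem outerValue_zero (z : Free b → ℂ) : f.outerValue z (f.β 0) = 0 := by
  rw [outerValue, dif_pos (by rw [← f.range_β]; exact ⟨0, rfl⟩), if_neg (by simp)]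

theorem outerValue_one (z : Free b → ℂ) : f.outerValue z (f.β 1) = 1 := by
  rw [outerValue, dif_pos (by rw [← f.range_β]; exact ⟨1, rfl⟩), if_pos rfl]

theorem outerValue_free (z : Free b → ℂ) (s : Free b) : f.outerValue z s.1 = z s := by
  rw [outerValue, dif_neg s.2]
  rfl

/-- The label `free` is excluded because its parameter is `0`, which is also the position of `β 0`.
-/
theorem outerValue_injOn {z : Free b → ℂ} (hz : Function.Injective z) (h0 : z f.free = 0)
    (h1 : ∀ s, z s ≠ 1) : Set.InjOn (f.outerValue z) {s | s ≠ f.β 2 ∧ s ≠ f.free.1} := by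
  have cases : ∀ s : S, s ≠ f.β 2 → s = f.β 0 ∨ s = f.β 1 ∨ ∃ t : Free b, s = t.1 := by
    intro s hs2
    by_cases hs : s ∈ Set.range b
    · rw [← f.range_β] at hs
      obtain ⟨i, rfl⟩ := hs
      fin_cases i
      · exact Or.inl rfl
      · exact Or.inr (Or.inl rfl)
      · exact absurd rfl hs2
    · exact Or.inr (Or.inr ⟨⟨s, hs⟩, rfl⟩)
  have hne : ∀ t : Free b, t.1 ≠ f.free.1 → z t ≠ 0 := fun t ht h =>
    ht (congrArg Subtype.val (hz (h.trans h0.symm)))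
  rintro s ⟨hs, hs'⟩ t ⟨ht, ht'⟩ h
  rcases cases s hs with rfl | rfl | ⟨s, rfl⟩ <;> rcases cases t ht with rfl | rfl | ⟨t, rfl⟩ <;>
    simp only [outerValue_zero, outerValue_one, outerValue_free] at h
  · rfl
  · exact absurd h zero_ne_one
  · exact absurd h.symm (hne t ht')
  · exact absurd h one_ne_zero
  · rfl
  · exact absurd h.symm (h1 t)
  · exact absurd h (hne s hs')
  · exact absurd h (h1 s)
  · rw [hz h]

/-- The affine coordinate of a label on the inner component. -/
def innerValue (z : Free b → ℂ) (s : S) : ℂ :=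
  -- With the node at infinity this is the normalization of the labels in `innerQuad`, so that the
  -- cross-ratio coordinate of a further label is its position.
  if s = f.anchor then 0 else if s = f.free.1 then 1 else f.outerValue z s

theorem innerValue_injOn {z : Free b → ℂ} (hz : Function.Injective z) (h0 : z f.free = 0)
    (h1 : ∀ s, z s ≠ 1) : Set.InjOn (f.innerValue z) f.part := by
  have hne : ∀ s ∈ f.part, s ≠ f.anchor → s ≠ f.free.1 →
      f.outerValue z s ≠ 0 ∧ f.outerValue z s ≠ 1 := by
    intro s hs hs' hs''
    have e := f.outerValue_free z ⟨s, f.notMem_range s hs hs'⟩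
    change f.outerValue z s = _ at e
    rw [e]
    exact ⟨fun h => hs'' (congrArg Subtype.val (hz (h.trans h0.symm))), h1 _⟩
  intro s hs t ht h
  rw [Finset.mem_coe] at hs ht
  unfold innerValue at h
  split_ifs at h with h₁ h₂ h₃ h₄ h₅ h₆ h₇ h₈
  · rw [h₁, h₂]
  · exact absurd h zero_ne_one
  · exact absurd h.symm (hne t ht h₂ h₃).1
  · exact absurd h one_ne_zero
  · rw [h₄, h₆]
  · exact absurd h.symm (hne t ht h₅ h₆).2
  · exact absurd h (hne s hs h₁ h₄).1
  · exact absurd h (hne s hs h₁ h₄).2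
  · exact f.outerValue_injOn hz h0 h1 ⟨fun e => f.two_notMem (e ▸ hs), h₄⟩
      ⟨fun e => f.two_notMem (e ▸ ht), h₈⟩ h

/-- The curve with two components whose local coordinates are given by `z`. -/
def twoComp {z : Free b → ℂ} (hz : Function.Injective z) (h0 : z f.free = 0)
    (h1 : ∀ s, z s ≠ 1) : TwoComp (f.part : Set S) where
  mark s := if s ∈ f.part then (f.innerValue z s : OnePoint ℂ)
    else if s = f.β 2 then ∞ else (f.outerValue z s : OnePoint ℂ)
  node := ![(f.outerValue z f.anchor : OnePoint ℂ), ∞]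
  injOn s hs t ht h := by
    simp only [Finset.mem_coe.1 hs, Finset.mem_coe.1 ht, if_true] at h
    exact f.innerValue_injOn hz h0 h1 hs ht (OnePoint.coe_injective h)
  injOn_compl s hs t ht h := by
    have hs' : s ∉ f.part := hs
    have ht' : t ∉ f.part := ht
    simp only [hs', ht', if_false] at h
    split_ifs at h with h₁ h₂ h₂
    · rw [h₁, h₂]
    · exact absurd h.symm (OnePoint.coe_ne_infty _)
    · exact absurd h (OnePoint.coe_ne_infty _)
    · exact f.outerValue_injOn hz h0 h1 ⟨h₁, fun e => hs' (e ▸ f.free_mem)⟩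
        ⟨h₂, fun e => ht' (e ▸ f.free_mem)⟩ (OnePoint.coe_injective h)
  ne_node s hs := by
    simp [Finset.mem_coe.1 hs]
  ne_node_compl s hs h := by
    have hs' : s ∉ f.part := hs
    simp only [hs', if_false] at h
    split_ifs at h with h₁
    · exact absurd h.symm (OnePoint.coe_ne_infty _)
    · refine hs' ?_
      rw [f.outerValue_injOn hz h0 h1 ⟨h₁, fun e => hs' (e ▸ f.free_mem)⟩
        ⟨f.anchor_ne, f.free_ne.symm⟩ (OnePoint.coe_injective h)]
      exact f.anchor_mem
  two_le := by
    rw [Set.ncard_coe_finset]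
    exact σ.two_le_card f.mem_parts
  two_le_compl := by
    rw [← Finset.coe_compl, Set.ncard_coe_finset]
    exact σ.two_le_card (σ.compl_mem f.mem_parts)

/-- On the outer component `β 0, β 1, β 2` are in standard position, so the coordinates of non-inner
labels are their positions there. The inner component gives the relative coordinates, and the
equation of the divisor vanishes as does `z f.free`. -/
theorem exists_point {z : Free b → ℂ} (hz : Function.Injective z) (h0 : z f.free = 0)
    (h1 : ∀ s, z s ≠ 1) :
    ∃ x ∈ boundaryDivisor σ, ∀ s, DefinedAt (f.poly s) x ∧ value (f.poly s) x = z s := by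
  let D := f.twoComp hz h0 h1
  have hout : ∀ s, s ∉ f.part → s ≠ f.β 2 →
      D.curve.pos D.outer s = (f.outerValue z s : OnePoint ℂ) := by
    intro s hs hs'
    rw [D.pos_outer_of_notMem hs]
    change (if s ∈ f.part then _ else if s = f.β 2 then ∞ else _) = _
    rw [if_neg hs, if_neg hs']
  have houtP : ∀ s ∈ f.part,
      D.curve.pos D.outer s = (f.outerValue z f.anchor : OnePoint ℂ) := fun s hs =>
    D.pos_outer_of_mem hs
  have hout2 : D.curve.pos D.outer (f.β 2) = ∞ := by
    rw [D.pos_outer_of_notMem f.two_notMem]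
    change (if f.β 2 ∈ f.part then _ else if f.β 2 = f.β 2 then ∞ else _) = _
    rw [if_neg f.two_notMem, if_pos rfl]
  have hin : ∀ s ∈ f.part, D.curve.pos D.inner s = (f.innerValue z s : OnePoint ℂ) := by
    intro s hs
    rw [D.pos_inner_of_mem hs]
    change (if s ∈ f.part then _ else _) = _
    rw [if_pos hs]
  have hin2 : D.curve.pos D.inner (f.β 2) = ∞ := D.pos_inner_of_notMem f.two_notMem
  have hsep : D.curve.Separates D.outer (f.β 0) (f.β 1) (f.β 2) :=
    D.separates_outer (by simp) (by simp) (by simp) ⟨f.not_two_mem (by decide),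
      f.not_two_mem (by decide), f.not_two_mem (by decide)⟩
  have hbase : ∀ i, i ≠ 2 → D.curve.pos D.outer (f.β i) =
      (f.outerValue z (f.β i) : OnePoint ℂ) := by
    intro i hi
    by_cases hP : f.β i ∈ f.part
    · have : f.β i = f.anchor := by
        by_contra h
        refine f.notMem_range _ hP h ?_
        rw [← f.range_β]
        exact ⟨i, rfl⟩
      rw [houtP _ hP, this]
    · exact hout _ hP (f.β.injective.ne hi)
  have hcr : ∀ s, crossRatio (D.curve.pos D.outer (f.β 0)) (D.curve.pos D.outer (f.β 1))
      (D.curve.pos D.outer (f.β 2)) (D.curve.pos D.outer s) = D.curve.pos D.outer s := by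
    intro s
    rw [hbase 0 (by decide), hbase 1 (by decide), f.outerValue_zero, f.outerValue_one, hout2,
      crossRatio_zero_one_infty]
  have hanchor : D.curve.pos D.outer f.anchor = (f.outerValue z f.anchor : OnePoint ℂ) :=
    houtP _ f.anchor_mem
  have hfree : D.curve.pos D.outer f.free.1 = (f.outerValue z f.anchor : OnePoint ℂ) :=
    houtP _ f.free_mem
  have hdef : ∀ (s : S) (c : ℂ), D.curve.pos D.outer s = (c : OnePoint ℂ) →
      DefinedAt (f.coordPoly s) (Quot.mk _ D.curve : Mbar S) := by
    intro s c h
    refine f.definedAt_coordPoly hsep ?_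
    rw [h, hout2]
    exact OnePoint.coe_ne_infty _
  refine ⟨Quot.mk _ D.curve, D.mk_mem_boundaryDivisor f.mem_parts, fun s => ?_⟩
  by_cases hs : f.Inner s
  · by_cases hs' : s = f.free
    · subst hs'
      constructor
      · rw [f.poly_free, sub_eq_add_neg, neg_eq_neg_one_mul, ← map_one MvPolynomial.C, ← map_neg]
        exact (hdef _ _ hfree).add ((DefinedAt.C _ _).mul (hdef _ _ hanchor))
      · rw [f.value_poly_free_of_mem_boundaryDivisor (D.mk_mem_boundaryDivisor f.mem_parts), h0]
    · have hsep' : D.curve.Separates D.inner f.anchor f.free.1 (f.β 2) :=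
        D.separates_inner f.free_ne.symm (f.free_ne_two _) f.anchor_ne
          ⟨fun h => h.1 f.anchor_mem, fun h => h.1 f.free_mem, fun h => h.1 f.anchor_mem⟩
      have hc : coord (f.innerQuad hs hs') (Quot.mk _ D.curve : Mbar S) = (z s : OnePoint ℂ) := by
        have h2 : f.innerValue z f.anchor = 0 := if_pos rfl
        have h3 : f.innerValue z f.free.1 = 1 := by
          rw [innerValue, if_neg f.free_ne, if_pos rfl]
        have h4 : f.innerValue z s.1 = z s := by
          rw [innerValue, if_neg hs.2, if_neg (fun e => hs' (Subtype.ext e)), outerValue_free]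
        refine (D.curve.cross_eq (q := f.innerQuad hs hs') hsep').trans ?_
        change crossRatio (D.curve.pos D.inner f.anchor) (D.curve.pos D.inner f.free.1)
          (D.curve.pos D.inner (f.β 2)) (D.curve.pos D.inner s.1) = _
        rw [hin _ f.anchor_mem, hin _ f.free_mem, hin2, hin _ hs.1, h2, h3, h4,
          crossRatio_zero_one_infty]
      rw [f.poly_of_inner hs hs']
      constructor
      · intro q hq
        rw [MvPolynomial.vars_X, Finset.mem_singleton] at hq
        rw [hq, hc]
        exact OnePoint.coe_ne_infty _
      · unfold value
        rw [MvPolynomial.eval_X, hc, finPart_coe]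
  · have hpos : D.curve.pos D.outer s.1 = (z s : OnePoint ℂ) := by
      by_cases hP : s.1 ∈ f.part
      · have : s.1 = f.anchor := by
          by_contra h
          exact hs ⟨hP, h⟩
        rw [houtP _ hP, ← this, outerValue_free]
      · rw [hout _ hP (f.free_ne_two s), outerValue_free]
    rw [f.poly_of_not_inner hs]
    refine ⟨hdef _ _ hpos, ?_⟩
    rw [f.value_coordPoly hsep (f.free_ne_two s), hcr, hpos, finPart_coe]

/-- The chart of a frame. -/
def chart : Chart b σ where
  poly := f.poly
  s₀ := f.free
  exists_point _ hz h0 h1 := f.exists_point hz h0 h1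
  value_boundary _ hx _ := f.value_poly_free_of_mem_boundaryDivisor hx
  value_open _ hx := f.value_poly_free_of_mem_openStratum hx
  adjoin_eq_top := f.adjoin_eq_top

end Frame

/-- One of the two parts contains at most one of the labels `0, 1, ∞`, and such a label is taken as
the anchor. If it is `∞`, the labels `0` and `∞` are interchanged to get `β 2` out of the part. -/
theorem nonempty_frame (b : Fin 3 ↪ S) (σ : StablePartition S) : Nonempty (Frame b σ) := by
  obtain ⟨P, hP, h01, h02, h12⟩ : ∃ P ∈ σ.1.parts, ¬ (b 0 ∈ P ∧ b 1 ∈ P) ∧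
      ¬ (b 0 ∈ P ∧ b 2 ∈ P) ∧ ¬ (b 1 ∈ P ∧ b 2 ∈ P) := by
    obtain ⟨P, hσ⟩ := σ.exists_parts
    by_cases h : ¬ (b 0 ∈ P ∧ b 1 ∈ P) ∧ ¬ (b 0 ∈ P ∧ b 2 ∈ P) ∧ ¬ (b 1 ∈ P ∧ b 2 ∈ P)
    · exact ⟨P, by simp [hσ], h⟩
    · refine ⟨Pᶜ, by simp [hσ], ?_⟩
      simp only [Finset.mem_compl]
      tauto
  have hcard := σ.two_le_card hP
  -- a frame for an anchor such that all other labels in the part are free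
  have key : ∀ (β : Fin 3 ↪ S) (p : S), p ∈ P → β 2 ∉ P →
      (∀ s ∈ P, s ≠ p → s ∉ Set.range b) →
      (β = b ∨ (β 0 = b 2 ∧ β 1 = b 1 ∧ β 2 = b 0 ∧ p = b 2)) → Nonempty (Frame b σ) := by
    intro β p hp h2 hrange hβ
    obtain ⟨s, hs, hsp⟩ := Finset.exists_mem_ne hcard p
    exact ⟨⟨β, P, hP, p, hp, ⟨s, hrange s hs hsp⟩, hs, hsp, h2, hrange, hβ⟩⟩
  by_cases h2 : b 2 ∈ P
  · refine key ((Equiv.swap 0 2).toEmbedding.trans b) (b 2) h2 ?_ ?_ (Or.inr ?_)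
    · exact fun h => h02 ⟨h, h2⟩
    · rintro s hs hne ⟨i, rfl⟩
      fin_cases i
      · exact h02 ⟨hs, h2⟩
      · exact h12 ⟨hs, h2⟩
      · exact hne rfl
    · exact ⟨rfl, rfl, rfl, rfl⟩
  by_cases h0 : b 0 ∈ P
  · refine key b (b 0) h0 h2 ?_ (Or.inl rfl)
    rintro s hs hne ⟨i, rfl⟩
    fin_cases i
    · exact hne rfl
    · exact h01 ⟨h0, hs⟩
    · exact h2 hs
  by_cases h1 : b 1 ∈ P
  · refine key b (b 1) h1 h2 ?_ (Or.inl rfl)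
    rintro s hs hne ⟨i, rfl⟩
    fin_cases i
    · exact h01 ⟨hs, h1⟩
    · exact hne rfl
    · exact h2 hs
  · obtain ⟨p, hp⟩ : P.Nonempty := Finset.card_pos.1 (by omega)
    refine key b p hp h2 ?_ (Or.inl rfl)
    rintro s hs - ⟨i, rfl⟩
    fin_cases i
    exacts [h0 hs, h1 hs, h2 hs]

end ModuliZero

namespace ModuliZero

/-! ### The form in local coordinates -/

/-- The transition matrix is the identity plus a matrix of rank one, with determinant `1 + a k = 1`.
-/
theorem alternatingMap_add_smul {R M N : Type*} [CommRing R] [AddCommGroup M] [Module R M]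
    [AddCommGroup N] [Module R N] {n : ℕ} (g : M [⋀^Fin n]→ₗ[R] N) (v : Fin n → M)
    (a : Fin n → R) {k : Fin n} (hk : a k = 0) :
    g (fun i => v i + a i • v k) = g v := by
  have h := alternatingMap_matrix g v
    (1 + Matrix.replicateCol Unit a * Matrix.replicateRow Unit (Pi.single k (1 : R)))
  rw [Matrix.det_one_add_replicateCol_mul_replicateRow, single_dotProduct, hk, mul_zero, add_zero,
    one_smul] at h
  rw [← h]
  congr 1
  funext i
  simp [Matrix.mul_apply, Matrix.one_apply, add_smul, Finset.sum_add_distrib, Pi.single_apply]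

namespace Chart

variable {S : Type*} [Fintype S] [DecidableEq S] {b : Fin 3 ↪ S} {σ : StablePartition S}

/-- The function is a unit of the local ring along the divisor. -/
def IsUnitAlong (b : Fin 3 ↪ S) (σ : StablePartition S) (x : FunctionField b) : Prop :=
  x ∈ ring (b := b) (σ := σ) ∧ x⁻¹ ∈ ring (b := b) (σ := σ)

namespace IsUnitAlong

theorem one : IsUnitAlong b σ 1 :=
  ⟨Subalgebra.one_mem _, by rw [inv_one]; exact Subalgebra.one_mem _⟩

theorem mul {x y : FunctionField b} (hx : IsUnitAlong b σ x) (hy : IsUnitAlong b σ y) :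
    IsUnitAlong b σ (x * y) :=
  ⟨Subalgebra.mul_mem _ hx.1 hy.1, by rw [mul_inv]; exact Subalgebra.mul_mem _ hx.2 hy.2⟩

theorem inv {x : FunctionField b} (hx : IsUnitAlong b σ x) : IsUnitAlong b σ x⁻¹ :=
  ⟨hx.2, by rw [inv_inv]; exact hx.1⟩

theorem prod {ι : Type*} (s : Finset ι) {x : ι → FunctionField b}
    (hx : ∀ i, IsUnitAlong b σ (x i)) : IsUnitAlong b σ (∏ i ∈ s, x i) :=
  Finset.prod_induction _ _ (fun _ _ => mul) one fun i _ => hx i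

end IsUnitAlong

/-- A single point of the hyperplane at which `G` is nonzero excludes divisibility by the equation.
-/
theorem isUnitAlong_aeval (c : Chart b σ) {G : MvPolynomial (Free b) ℂ} {z : Free b → ℂ}
    (hz : z c.s₀ = 0) (hG : MvPolynomial.eval z G ≠ 0) :
    IsUnitAlong b σ (MvPolynomial.aeval c.fn G) := by
  refine ⟨c.aeval_mem_ring G, c.inv_aeval_mem_ring ?_⟩
  rintro ⟨H, rfl⟩
  simp [hz] at hG

end Chart

/-! ### The affine coordinates and the form in the chart of a frame -/

namespace Frame

variable {S : Type*} [Fintype S] [DecidableEq S] {b : Fin 3 ↪ S} {σ : StablePartition S}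
  (f : Frame b σ)

theorem fn_of_not_inner {s : Free b} (hs : ¬ f.Inner s) : f.chart.fn s = f.affine s.1 :=
  f.realizes_affine.map_poly_of_not_inner hs

theorem affine_free : f.affine f.free.1 = f.affine f.anchor + f.chart.unif := by
  have : f.chart.unif = f.affine f.free.1 - f.affine f.anchor := f.realizes_affine.map_poly_free
  rw [this]
  ring

theorem affine_of_inner {s : Free b} (hs : f.Inner s) (hs' : s ≠ f.free) :
    f.affine s.1 = f.affine f.anchor + f.chart.unif * f.chart.fn s := by
  have h1 : f.chart.unif = f.affine f.free.1 - f.affine f.anchor := f.realizes_affine.map_poly_free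
  have h2 : f.chart.fn s = (f.affine s.1 - f.affine f.anchor) /
    (f.affine f.free.1 - f.affine f.anchor) := f.realizes_affine.map_poly_of_inner hs hs'
  rw [h2, ← h1, mul_div_cancel₀ _ f.chart.unif_ne_zero]
  ring

theorem affine_anchor_of_mem (h : f.anchor ∈ Set.range b) :
    f.affine f.anchor = 0 ∨ f.affine f.anchor = 1 := by
  rw [← f.range_β] at h
  obtain ⟨i, hi⟩ := h
  rw [← hi]
  fin_cases i
  · exact Or.inl f.realizes_affine.zero
  · exact Or.inr f.realizes_affine.one
  · exact absurd hi.symm f.anchor_ne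

open Classical in
-- With `y` for the affine coordinates, `u` for the equation and `x` for the relative coordinates,
-- `dy_s = dy_anchor + u dx_s + x_s du` for an inner label `s` other than `free`. The terms with
-- `du` drop out since `du` is the contribution of `free`. Those with `dy_anchor` drop out since
-- `dy_anchor` is a factor of the product too, or zero if the anchor is at `0` or `1`. One factor
-- `u` remains for each inner label except `free`.
theorem ιMulti_D_affine {n : ℕ} (e : Fin n ≃ Free b) :
    exteriorPower.ιMulti (FunctionField b) n (fun i =>
      KaehlerDifferential.D ℂ (FunctionField b) (f.affine (e i).1)) =
    (∏ i, if f.Inner (e i) ∧ e i ≠ f.free then f.chart.unif else 1) • f.chart.volume e := by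
  let d := KaehlerDifferential.D ℂ (FunctionField b)
  let r : Fin n → FunctionField b :=
    fun i => if f.Inner (e i) ∧ e i ≠ f.free then f.chart.unif else 1
  let v : Fin n → Ω[FunctionField b⁄ℂ] := fun i => r i • d (f.chart.fn (e i))
  let a : Fin n → FunctionField b :=
    fun i => if f.Inner (e i) ∧ e i ≠ f.free then f.chart.fn (e i) else 0
  let w : Fin n → Ω[FunctionField b⁄ℂ] := fun i => v i + a i • v (e.symm f.free)
  let δ : Fin n → FunctionField b := fun i => if f.Inner (e i) then 1 else 0
  have hv : v (e.symm f.free) = d f.chart.unif := by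
    simp only [v, r, Equiv.apply_symm_apply, ne_eq, not_true_eq_false, and_false, if_false,
      one_smul]
    rfl
  have hD : ∀ i, d (f.affine (e i).1) = w i + δ i • d (f.affine f.anchor) := by
    intro i
    by_cases hi : f.Inner (e i)
    · by_cases hi' : e i = f.free
      · have h1 : v i = d f.chart.unif := by
          rw [← hv, ← hi', Equiv.symm_apply_apply]
        have h2 : a i = 0 := if_neg fun h => h.2 hi'
        have h3 : δ i = 1 := if_pos hi
        simp only [w, h1, h2, h3, hi', affine_free, map_add, zero_smul, add_zero, one_smul]
        rw [add_comm]
      · have h1 : v i = f.chart.unif • d (f.chart.fn (e i)) := by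
          simp only [v, r, hi, hi', ne_eq, not_false_eq_true, and_self, if_true]
        have h2 : a i = f.chart.fn (e i) := if_pos ⟨hi, hi'⟩
        have h3 : δ i = 1 := if_pos hi
        simp only [w, hv, h1, h2, h3, f.affine_of_inner hi hi', map_add, Derivation.leibniz,
          one_smul]
        rw [add_comm]
    · have h1 : v i = d (f.chart.fn (e i)) := by
        simp only [v, r, hi, false_and, if_false, one_smul]
      have h2 : a i = 0 := if_neg fun h => hi h.1
      have h3 : δ i = 0 := if_neg hi
      simp only [w, h1, h2, h3, zero_smul, add_zero, f.fn_of_not_inner hi]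
  have hw : exteriorPower.ιMulti (FunctionField b) n w =
      exteriorPower.ιMulti (FunctionField b) n v :=
    alternatingMap_add_smul _ v a (by simp [a])
  have hfin : exteriorPower.ιMulti (FunctionField b) n v = (∏ i, r i) • f.chart.volume e :=
    AlternatingMap.map_smul_univ _ _ _
  rw [← hfin, ← hw]
  change exteriorPower.ιMulti (FunctionField b) n (fun i => d (f.affine (e i).1)) = _
  simp only [hD]
  by_cases h : f.anchor ∈ Set.range b
  · have : d (f.affine f.anchor) = 0 := by
      rcases f.affine_anchor_of_mem h with h | h <;> simp [h, d]
    simp only [this, smul_zero, add_zero]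
  · obtain ⟨k, hk⟩ : ∃ k, (e k).1 = f.anchor := by
      obtain ⟨k, hk⟩ := e.surjective ⟨f.anchor, h⟩
      exact ⟨k, congrArg Subtype.val hk⟩
    have h3 : δ k = 0 := if_neg fun h => h.2 hk
    have h1 : w k = d (f.affine f.anchor) := by
      have h2 := hD k
      rw [h3, zero_smul, add_zero, hk] at h2
      exact h2.symm
    rw [← h1]
    exact alternatingMap_add_smul _ w δ h3

/-- The label is of the type of the anchor. -/
def Polar (ε : Free b → Fin 2) (s : Free b) : Prop := ∃ α, b α = f.anchor ∧ s ∈ typeSet ε α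

theorem eq_anchor_of_mem {α : Fin 3} (h : b α ∈ f.part) : b α = f.anchor := by
  by_contra hne
  exact f.notMem_range _ h hne ⟨α, rfl⟩

/-- A part that shows a type contains exactly one of the labels `0, 1, ∞`, so it is the part of the
frame, this label is the anchor, and `T` is the set of inner labels. -/
theorem exists_hasType_iff (ε : Free b → Fin 2) :
    (∃ α, HasType ε σ α) ↔ ∀ s, f.Inner s → f.Polar ε s := by
  constructor
  · rintro ⟨α, Q, hQ, T, hT, hTα, hQT⟩ s hs
    have hQP : Q = f.part := by
      have hp := σ.parts_eq f.mem_parts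
      rw [hp, Finset.mem_insert, Finset.mem_singleton] at hQ
      rcases hQ with rfl | rfl
      · rfl
      -- If the complement showed the type, two of the labels `0, 1, ∞` would lie in `part`, and
      -- both would be the anchor.
      · have h : ∀ i, i ≠ α → b i ∈ f.part := by
          intro i hi
          by_contra hn
          have : b i ∈ ((f.partᶜ : Finset S) : Set S) := by simpa using hn
          rw [hQT] at this
          rcases this with h | ⟨t, -, ht⟩
          · exact hi (b.injective h)
          · exact t.2 ⟨i, ht.symm⟩
        obtain ⟨i, j, hij, hi, hj⟩ : ∃ i j : Fin 3, i ≠ j ∧ i ≠ α ∧ j ≠ α := by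
          clear hTα hQT h
          revert α
          decide
        exact absurd (b.injective ((f.eq_anchor_of_mem (h i hi)).trans
          (f.eq_anchor_of_mem (h j hj)).symm)) hij
    subst hQP
    have hα : b α ∈ f.part := by
      rw [← Finset.mem_coe, hQT]
      exact Or.inl rfl
    refine ⟨α, f.eq_anchor_of_mem hα, ?_⟩
    have : s.1 ∈ (f.part : Set S) := hs.1
    rw [hQT] at this
    rcases this with h | ⟨t, ht, hts⟩
    · exact absurd ⟨α, (Set.mem_singleton_iff.1 h).symm⟩ s.2
    · rw [← Subtype.ext (hts : t.1 = s.1)]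
      exact hTα ht
  · intro h
    obtain ⟨α, hα, -⟩ := h f.free f.inner_free
    refine ⟨α, f.part, f.mem_parts, {s | f.Inner s}, ⟨f.free, f.inner_free⟩, fun s hs => ?_, ?_⟩
    · obtain ⟨α', hα', hs'⟩ := h s hs
      rwa [b.injective (hα.trans hα'.symm)]
    · ext s
      constructor
      · intro hs
        by_cases hsa : s = f.anchor
        · exact Or.inl (hsa.trans hα.symm)
        · exact Or.inr ⟨⟨s, f.notMem_range s hs hsa⟩, ⟨hs, hsa⟩, rfl⟩
      · rintro (h | ⟨t, ht, rfl⟩)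
        · rw [Set.mem_singleton_iff.1 h, hα]
          exact f.anchor_mem
        · exact ht.1

theorem aeval_X_free : MvPolynomial.aeval f.chart.fn
    (MvPolynomial.X f.free : MvPolynomial (Free b) ℂ) = f.chart.unif :=
  MvPolynomial.aeval_X _ _

open Classical in
/-- The point `0` for the coordinate `free` and `2` for all other coordinates. -/
def testPoint (t : Free b) : ℂ := if t = f.free then 0 else 2

theorem testPoint_free : f.testPoint f.free = 0 := if_pos rfl

theorem testPoint_of_ne {t : Free b} (h : t ≠ f.free) : f.testPoint t = 2 := if_neg h

theorem isUnitAlong_aeval {G : MvPolynomial (Free b) ℂ}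
    (hG : MvPolynomial.eval f.testPoint G ≠ 0) :
    Chart.IsUnitAlong b σ (MvPolynomial.aeval f.chart.fn G) :=
  f.chart.isUnitAlong_aeval f.testPoint_free hG

theorem ne_free_of_not_inner {s : Free b} (hs : ¬ f.Inner s) : s ≠ f.free :=
  fun h => hs (h ▸ f.inner_free)

theorem exists_affine_eq {s : Free b} (hs : f.Inner s) : ∃ g : MvPolynomial (Free b) ℂ,
    MvPolynomial.eval f.testPoint g ≠ 0 ∧
    f.affine s.1 = f.affine f.anchor + f.chart.unif * MvPolynomial.aeval f.chart.fn g := by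
  by_cases hs' : s = f.free
  · subst hs'
    refine ⟨1, by simp, ?_⟩
    rw [map_one, mul_one, f.affine_free]
  · refine ⟨MvPolynomial.X s, by simp [f.testPoint_of_ne hs'], ?_⟩
    rw [MvPolynomial.aeval_X, f.affine_of_inner hs hs']

theorem aeval_C_natCast (a : ℕ) : MvPolynomial.aeval f.chart.fn (MvPolynomial.C (a : ℂ)) =
    (a : FunctionField b) := by simp

theorem isUnitAlong_sub {s : Free b} (h : ¬ f.Inner s) (a : Fin 2) :
    Chart.IsUnitAlong b σ (f.affine s.1 - ((a : ℕ) : FunctionField b)) := by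
  rw [← f.fn_of_not_inner h, ← f.aeval_C_natCast,
    ← MvPolynomial.aeval_X (R := ℂ) f.chart.fn s, ← map_sub]
  -- The value `2` at the test point differs from both possible values `0` and `1` of `a`.
  refine f.isUnitAlong_aeval ?_
  fin_cases a <;> simp [f.testPoint_of_ne (f.ne_free_of_not_inner h)]
  norm_num

theorem isUnitAlong_sub_of_anchor_free {s : Free b} (h : f.Inner s)
    (ha : f.anchor ∉ Set.range b) (a : Fin 2) :
    Chart.IsUnitAlong b σ (f.affine s.1 - ((a : ℕ) : FunctionField b)) := by
  obtain ⟨t, ht⟩ : ∃ t : Free b, t.1 = f.anchor := ⟨⟨f.anchor, ha⟩, rfl⟩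
  have htn : ¬ f.Inner t := fun h => h.2 ht
  obtain ⟨g, -, e⟩ := f.exists_affine_eq h
  rw [e, ← ht, ← f.fn_of_not_inner htn, ← f.aeval_C_natCast,
    ← MvPolynomial.aeval_X (R := ℂ) f.chart.fn t, ← f.aeval_X_free, ← map_mul, ← map_add,
    ← map_sub]
  refine f.isUnitAlong_aeval ?_
  fin_cases a <;> simp [f.testPoint_of_ne (f.ne_free_of_not_inner htn), f.testPoint_free]
  norm_num

open Classical in
-- An inner label has the coordinate of the anchor plus `unif` times a unit. After subtraction of `ε
-- s` this is a unit, unless the anchor is the label `ε s`, when a simple zero remains.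
theorem exists_sub_eq (hβ : f.β = b) (ε : Free b → Fin 2) (s : Free b) :
    ∃ U, Chart.IsUnitAlong b σ U ∧ f.affine s.1 - ((ε s : ℕ) : FunctionField b) =
      f.chart.unif ^ (if f.Inner s ∧ f.Polar ε s then 1 else 0) * U := by
  by_cases hs : f.Inner s
  · by_cases ha : f.anchor ∈ Set.range b
    · obtain ⟨α, hα⟩ := ha
      obtain ⟨g, hg, e⟩ := f.exists_affine_eq hs
      obtain ⟨c, hc, hc'⟩ : ∃ c : Fin 2, f.affine f.anchor = ((c : ℕ) : FunctionField b) ∧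
          (f.Polar ε s ↔ ε s = c) := by
        have hpolar : f.Polar ε s ↔ s ∈ typeSet ε α := by
          refine ⟨fun ⟨α', h, h'⟩ => ?_, fun h => ⟨α, hα, h⟩⟩
          rwa [← b.injective (h.trans hα.symm)]
        rw [hpolar, ← hα]
        have h0 := f.realizes_affine.zero
        have h1 := f.realizes_affine.one
        have h2 := f.anchor_ne
        rw [hβ] at h0 h1 h2
        fin_cases α
        · exact ⟨0, by simpa using h0, Iff.rfl⟩
        · exact ⟨1, by simpa using h1, Iff.rfl⟩
        · exact absurd hα.symm h2
      by_cases hεc : ε s = c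
      · refine ⟨_, f.isUnitAlong_aeval hg, ?_⟩
        rw [if_pos ⟨hs, hc'.2 hεc⟩, e, hc, hεc, pow_one]
        ring
      · refine ⟨_, f.isUnitAlong_aeval (G := MvPolynomial.C ((c : ℕ) : ℂ) +
          MvPolynomial.X f.free * g - MvPolynomial.C ((ε s : ℕ) : ℂ)) ?_, ?_⟩
        · simp only [map_sub, map_add, map_mul, MvPolynomial.eval_C, MvPolynomial.eval_X,
            f.testPoint_free, zero_mul, add_zero, sub_ne_zero]
          exact fun h => hεc (Fin.ext (Nat.cast_injective h).symm)
        · rw [if_neg fun h => hεc (hc'.1 h.2), pow_zero, one_mul, map_sub, map_add, map_mul,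
            f.aeval_C_natCast, f.aeval_C_natCast, f.aeval_X_free, e, hc]
    · refine ⟨_, f.isUnitAlong_sub_of_anchor_free hs ha (ε s), ?_⟩
      rw [if_neg, pow_zero, one_mul]
      rintro ⟨-, α, h, -⟩
      exact ha ⟨α, h⟩
  · refine ⟨_, f.isUnitAlong_sub hs (ε s), ?_⟩
    rw [if_neg fun h => hs h.1, pow_zero, one_mul]

open Classical in
-- For `v = 1 / t` one has `dt / (t - ε) = dv / (v * (ε * v - 1))`, whose denominator is treated
-- here. The anchor is at `v = 0`, so for inner labels the first factor has a simple zero and the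
-- second is a unit, whatever `ε s` is; accordingly all labels are of the type of `∞`.
theorem exists_mul_eq (h0 : f.β 0 = b 2) (ha : f.anchor = b 2) (ε : Free b → Fin 2)
    (s : Free b) : ∃ U, Chart.IsUnitAlong b σ U ∧
      f.affine s.1 * (((ε s : ℕ) : FunctionField b) * f.affine s.1 - 1) =
      f.chart.unif ^ (if f.Inner s ∧ f.Polar ε s then 1 else 0) * U := by
  by_cases hs : f.Inner s
  · have hpolar : f.Polar ε s := by
      refine ⟨2, ha.symm, ?_⟩
      change ε s = 0 ∨ ε s = 1
      generalize ε s = x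
      fin_cases x <;> simp
    obtain ⟨g, hg, e⟩ := f.exists_affine_eq hs
    rw [ha, ← h0, f.realizes_affine.zero, zero_add] at e
    refine ⟨_, f.isUnitAlong_aeval (G := g * (MvPolynomial.C ((ε s : ℕ) : ℂ) *
      (MvPolynomial.X f.free * g) - 1)) ?_, ?_⟩
    · simpa [f.testPoint_free] using hg
    · rw [if_pos ⟨hs, hpolar⟩, e, map_mul, map_sub, map_mul, map_mul, map_one,
        f.aeval_C_natCast, f.aeval_X_free, pow_one, mul_assoc]
  · refine ⟨_, f.isUnitAlong_aeval (G := MvPolynomial.X s * (MvPolynomial.C ((ε s : ℕ) : ℂ) *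
      MvPolynomial.X s - 1)) ?_, ?_⟩
    · generalize ε s = x
      fin_cases x <;> simp [f.testPoint_of_ne (f.ne_free_of_not_inner hs)]
      norm_num
    · rw [if_neg fun h => hs h.1, pow_zero, one_mul, map_mul, map_sub, map_mul, map_one,
        f.aeval_C_natCast, MvPolynomial.aeval_X, f.fn_of_not_inner hs]

open Classical in
/-- The factor of `s` in the form, in terms of the differential of the affine coordinate. -/
theorem exists_factor (ε : Free b → Fin 2) (s : Free b) : ∃ U : FunctionField b,
    Chart.IsUnitAlong b σ U ∧
    (tCoord b s - ((ε s : ℕ) : FunctionField b))⁻¹ •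
      KaehlerDifferential.D ℂ (FunctionField b) (tCoord b s) =
    ((f.chart.unif ^ (if f.Inner s ∧ f.Polar ε s then 1 else 0))⁻¹ * U) •
      KaehlerDifferential.D ℂ (FunctionField b) (f.affine s.1) := by
  have ht := tCoord_ne_algebraMap b s 0
  rw [map_zero] at ht
  rcases f.β_eq with hβ | ⟨h0, h1, h2, ha⟩
  · obtain ⟨U, hU, e⟩ := f.exists_sub_eq hβ ε s
    refine ⟨U⁻¹, hU.inv, ?_⟩
    rw [← mul_inv, ← e, f.affine_eq_tCoord hβ]
  · obtain ⟨U, hU, e⟩ := f.exists_mul_eq h0 ha ε s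
    refine ⟨U⁻¹, hU.inv, ?_⟩
    have hsub := tCoord_sub_ne_zero b s (ε s)
    rw [← mul_inv, ← e, f.affine_eq_inv_tCoord h0 h1 h2, Derivation.leibniz_inv, smul_smul]
    congr 1
    have h3 : ((ε s : ℕ) : FunctionField b) * (tCoord b s)⁻¹ - 1 =
        -((tCoord b s - ((ε s : ℕ) : FunctionField b)) * (tCoord b s)⁻¹) := by
      field_simp
      ring
    rw [h3]
    field_simp

open Classical in
/-- The form is a power of the equation of the divisor times a unit in local coordinates. -/
theorem exists_Omega_eq (ε : Free b → Fin 2) {n : ℕ} (e : Fin n ≃ Free b) :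
    ∃ (k : ℤ) (U : FunctionField b), Chart.IsUnitAlong b σ U ∧ -1 ≤ k ∧
      (k = -1 ↔ ∃ α, HasType ε σ α) ∧ Omega b ε e = (f.chart.unif ^ k * U) • f.chart.volume e := by
  choose U hU hform using f.exists_factor ε
  have hu := f.chart.unif_ne_zero
  -- The differentials contribute one factor `unif` for each inner label except `free`, and each
  -- polar inner label takes one away. This leaves the number of non-polar inner labels minus one.
  let N : ℕ := (Finset.univ.filter fun i => f.Inner (e i) ∧ ¬ f.Polar ε (e i)).card
  refine ⟨N - 1, ∏ i, U (e i), Chart.IsUnitAlong.prod _ fun i => hU _, by omega, ?_, ?_⟩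
  · rw [f.exists_hasType_iff, sub_eq_iff_eq_add, show (-1 + 1 : ℤ) = 0 from rfl, Nat.cast_eq_zero,
      Finset.card_eq_zero, Finset.filter_eq_empty_iff]
    constructor
    · intro h s hs
      have := @h (e.symm s) (Finset.mem_univ _)
      rw [Equiv.apply_symm_apply] at this
      tauto
    · intro h i _ hi
      exact hi.2 (h _ hi.1)
  · unfold Omega
    simp only [hform]
    rw [AlternatingMap.map_smul_univ, f.ιMulti_D_affine, smul_smul]
    congr 1
    rw [Finset.prod_mul_distrib, mul_right_comm]
    congr 1
    rw [← Finset.prod_mul_distrib]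
    -- The factor missing at `free` is split off as `unif⁻¹`, so that `free` is counted like every
    -- other inner label.
    have h1 : ∀ i, (f.chart.unif ^ (if f.Inner (e i) ∧ f.Polar ε (e i) then 1 else 0))⁻¹ *
        (if f.Inner (e i) ∧ e i ≠ f.free then f.chart.unif else 1) =
        (if f.Inner (e i) ∧ ¬ f.Polar ε (e i) then f.chart.unif else 1) *
          (if e i = f.free then f.chart.unif⁻¹ else 1) := by
      intro i
      by_cases hi : e i = f.free
      · by_cases hp : f.Polar ε f.free <;> simp [hi, f.inner_free, hp, hu]
      · by_cases hin : f.Inner (e i) <;> by_cases hp : f.Polar ε (e i) <;> simp [hi, hin, hp, hu]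
    rw [Finset.prod_congr rfl fun i _ => h1 i, Finset.prod_mul_distrib, zpow_sub₀ hu, zpow_one,
      zpow_natCast, div_eq_mul_inv]
    congr 1
    · rw [Finset.prod_ite, Finset.prod_const, Finset.prod_const_one, mul_one]
    · have : Fintype (Free b) := Fintype.ofEquiv _ e
      rw [Equiv.prod_comp e (fun s => if s = f.free then f.chart.unif⁻¹ else 1)]
      simp

end Frame

end ModuliZero

namespace ModuliZero

/-! ### The polar divisor -/

section

variable {S : Type*} [Fintype S] [DecidableEq S]

theorem coheight_boundaryIrreducible (b : Fin 3 ↪ S) (σ : StablePartition S) :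
    Order.coheight (boundaryIrreducible σ) = 1 := by
  obtain ⟨f⟩ := nonempty_frame b σ
  exact f.chart.coheight_boundaryIrreducible

theorem isPrimeDivisor_boundaryDivisor (b : Fin 3 ↪ S) (σ : StablePartition S) :
    IsPrimeDivisor (boundaryDivisor σ) :=
  ⟨⟨boundaryIrreducible σ, coheight_boundaryIrreducible b σ⟩, rfl⟩

/-- A prime divisor that does not meet the open stratum is a boundary divisor. -/
theorem exists_eq_boundaryIrreducible (b : Fin 3 ↪ S) (Z : PrimeDivisor S)
    (h : ¬ ((Z.1 : Set (Mbar S)) ∩ openStratum S).Nonempty) :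
    ∃ σ : StablePartition S, Z.1 = boundaryIrreducible σ := by
  obtain ⟨σ, hσ⟩ := exists_subset_boundaryDivisor Z.1.isIrreducible h
  refine ⟨σ, eq_of_le_of_not_lt (show Z.1 ≤ boundaryIrreducible σ from hσ) fun hlt => ?_⟩
  -- A prime divisor strictly inside a boundary divisor would have codimension at least two.
  have := Order.coheight_add_one_le hlt
  rw [coheight_boundaryIrreducible b, Z.2] at this
  exact absurd this (by decide)

end

section Regular

variable {S : Type*} {b : Fin 3 ↪ S}

theorem exists_coord_snocQuad {x : Mbar S} (hx : x ∈ openStratum S) (s : Free b) :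
    ∃ z : ℂ, z ≠ 0 ∧ z ≠ 1 ∧ coord (snocQuad b s.2) x = (z : OnePoint ℂ) := by
  obtain ⟨C⟩ := x
  obtain ⟨z, hz, hC⟩ := exists_configuration hx b
  refine ⟨z s, fun h => ?_, fun h => ?_, ?_⟩
  · refine hz.ne (a₁ := s.1) (a₂ := b 0) (fun e => s.2 ⟨0, e.symm⟩) ?_
    rw [configuration_free, configuration_zero, h]
  · refine hz.ne (a₁ := s.1) (a₂ := b 1) (fun e => s.2 ⟨1, e.symm⟩) ?_
    rw [configuration_free, configuration_one, h]
  · refine (hC _).trans ?_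
    change crossRatio (configuration b z (b 0)) (configuration b z (b 1)) (configuration b z (b 2))
      (configuration b z s.1) = _
    rw [configuration_zero, configuration_one, configuration_two, configuration_free,
      crossRatio_zero_one_infty]

theorem regularAt_tCoord {x : Mbar S} (hx : x ∈ openStratum S) (s : Free b) :
    RegularAt b (tCoord b s) x := by
  refine ⟨MvPolynomial.X (snocQuad b s.2), MvPolynomial.C 1, fun q _ => hx q, .C 1 x,
    by simp [value], by simp, ?_⟩
  rw [MvPolynomial.aeval_X, map_one, map_one, div_one]
  rfl

theorem regularAt_inv_tCoord_sub {x : Mbar S} (hx : x ∈ openStratum S) (s : Free b) (a : Fin 2) :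
    RegularAt b (tCoord b s - ((a : ℕ) : FunctionField b))⁻¹ x := by
  have e : MvPolynomial.aeval (crossFun b) (MvPolynomial.X (snocQuad b s.2) -
      MvPolynomial.C ((a : ℕ) : ℂ)) = tCoord b s - ((a : ℕ) : FunctionField b) := by
    rw [map_sub, MvPolynomial.aeval_X]
    simp
    rfl
  refine ⟨MvPolynomial.C 1, MvPolynomial.X (snocQuad b s.2) - MvPolynomial.C ((a : ℕ) : ℂ),
    .C 1 x, fun q _ => hx q, ?_, ?_, ?_⟩
  · obtain ⟨z, h0, h1, h⟩ := exists_coord_snocQuad hx s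
    unfold value
    rw [map_sub, MvPolynomial.eval_X, MvPolynomial.eval_C, h, finPart_coe, sub_ne_zero]
    fin_cases a
    · simpa using h0
    · simpa using h1
  · rw [e]
    exact tCoord_sub_ne_zero b s a
  · rw [e]
    simp

/-- The form is regular along divisors that meet the open stratum. -/
theorem Omega_mem_regularForms {Z : TopologicalSpace.IrreducibleCloseds (Mbar S)}
    (h : ((Z : Set (Mbar S)) ∩ openStratum S).Nonempty) (ε : Free b → Fin 2) {n : ℕ}
    (e : Fin n ≃ Free b) : Omega b ε e ∈ regularForms b n Z := by
  obtain ⟨x, hxZ, hx⟩ := h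
  rw [Omega_eq_smul]
  have h1 : (∏ i, (tCoord b (e i) - ((ε (e i) : ℕ) : FunctionField b))⁻¹) ∈ localRing b Z :=
    Subalgebra.prod_mem _ fun i _ => ⟨x, hxZ, regularAt_inv_tCoord_sub hx _ _⟩
  exact Submodule.smul_mem _ (⟨_, h1⟩ : localRing b Z)
    (Submodule.subset_span ⟨fun i => ⟨_, x, hxZ, regularAt_tCoord hx (e i)⟩, rfl⟩)

end Regular

variable {S : Type*} [Fintype S] [DecidableEq S] {b : Fin 3 ↪ S}

theorem divisorA_eq_zero (ε : Free b → Fin 2) {Z : PrimeDivisor S}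
    (h : ((Z.1 : Set (Mbar S)) ∩ openStratum S).Nonempty) : divisorA ε Z = 0 := by
  obtain ⟨x, hxZ, hx⟩ := h
  refine Finset.sum_eq_zero fun σ _ => if_neg fun e => ?_
  exact Set.disjoint_left.1 (disjoint_openStratum_boundaryDivisor σ) hx (e ▸ hxZ)

open Classical in
theorem divisorA_boundaryDivisor (ε : Free b → Fin 2) {Z : PrimeDivisor S} {σ : StablePartition S}
    (h : Z.1 = boundaryIrreducible σ) :
    divisorA ε Z = if ∃ α, HasType ε σ α then 1 else 0 := by
  have e : ∀ τ : StablePartition S, boundaryDivisor τ = (Z.1 : Set (Mbar S)) ↔ τ = σ := by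
    intro τ
    rw [h]
    exact boundaryDivisor_injective.eq_iff (b := σ)
  unfold divisorA
  simp only [e]
  rw [Finset.sum_ite_eq']
  simp

/-- Along a prime divisor meeting the open stratum both the pole and the coefficient vanish. Any
other prime divisor is a boundary divisor, and distinct partitions have distinct divisors, so its
coefficient is `1` or `0` according to whether its partition has a type. -/
theorem isPolarDivisor_divisorA (ε : Free b → Fin 2) {n : ℕ} (e : Fin n ≃ Free b) :
    IsPolarDivisor b (Omega b ε e) (divisorA ε) := by
  classical
  intro Z
  by_cases h : ((Z.1 : Set (Mbar S)) ∩ openStratum S).Nonempty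
  · rw [divisorA_eq_zero ε h]
    exact ⟨fun a _ => Submodule.smul_mem _ a (Omega_mem_regularForms h ε e),
      fun _ _ => Nat.zero_le _⟩
  · obtain ⟨σ, hσ⟩ := exists_eq_boundaryIrreducible b Z h
    rw [divisorA_boundaryDivisor ε hσ]
    obtain ⟨Z, hZ⟩ := Z
    change Z = _ at hσ
    subst hσ
    obtain ⟨f⟩ := nonempty_frame b σ
    obtain ⟨k, U, hU, hk, hk', hΩ⟩ := f.exists_Omega_eq ε e
    have := f.chart.isLeast_pole e (Omega_ne_zero b ε e) hU.1 hU.2 hk hΩ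
    simp only [hk'] at this
    exact this

end ModuliZero

end

open ModuliZero in
theorem proposition3p1 {S : Type*} [Fintype S] [DecidableEq S] (b : Fin 3 ↪ S)
    (ε : Free b → Fin 2) {n : ℕ} (e : Fin n ≃ Free b) :
    (∀ σ : StablePartition S, IsPrimeDivisor (boundaryDivisor σ)) ∧
      IsPolarDivisor b (Omega b ε e) (divisorA ε) :=
  ⟨isPrimeDivisor_boundaryDivisor b, isPolarDivisor_divisorA ε e⟩
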